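/- There exist a finite alphabet $S$ and a countable two-dimensional subshift of finite type $X \subseteq S^{\mathbb{Z}^2}$ such that: 1. $X$ is southward deterministic: if two points $y, z \in X$ agree on the half plane $\{(a,b) \in \mathbb{Z}^2 : b \ge 1\}$ (the second coordinate pointing north), then $y = z$; 2. $X$ has the P property: there is a countable one-dimensional subshift of finite type $Y \subseteq S^{\mathbb{Z}}$ such that every horizontal row $(x_{(i,0)})_{i \in \mathbb{Z}}$ of a point $x \in X$ belongs to $Y$; 3. for every $k \in \mathbb{N}$, the problem of deciding, given a finite pattern $P$ over $S$ (a finite domain $D \subset \mathbb{Z}^2$ together with a map $D \to S$), whether some translate of $P$ occurs in some point of the $k$-th Cantor–Bendixson derivative $X^{(k)}$ is $\Pi^0_{2k+1}$-complete with respect to many-one reductions. Here $X^{(0)} = X$, and $X^{(k+1)}$ is the set of non-isolated points of $X^{(k)}$, in the topology inherited from the product topology on $S^{\mathbb{Z}^2}$ with $S$ discrete. A predicate is $\Sigma^0_0$, equivalently $\Pi^0_0$, if it is computable; $p$ is $\Sigma^0_{n+1}$ (respectively $\Pi^0_{n+1}$) if $p(a) \iff \exists m \in \mathbb{N}\; q(a,m)$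 with $q$ in $\Pi^0_n$ (respectively $p(a) \iff \forall m \in \mathbb{N}\; q(a,m)$ with $q$ in $\Sigma^0_n$). -/

import Mathlib

namespace CountableSFT

open SymbolicDynamics.FullShift

/-! ### Shifts of finite type in dimensions one (`G = ℤ`) and two (`G = ℤ × ℤ`)

Points of `ℤ × ℤ` are written `(column, row)`; rows are horizontal and the second coordinate
increases upwards (northwards). -/

/-- `p` occurs somewhere in the configuration `x`. -/
def Occurs {A G : Type*} [Inhabited A] [AddMonoid G] (p : Pattern A G) (x : G → A) : Prop :=
  ∃ g : G, p.occursInAt x g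

/-- `p` occurs in some point of `X`. -/
def OccursInSet {A G : Type*} [Inhabited A] [AddMonoid G] (p : Pattern A G)
    (X : Set (G → A)) : Prop :=
  ∃ x ∈ X, Occurs p x

/-- `X` is a shift of finite type: the set of all configurations that avoid some finite set of
finite patterns. -/
def IsSFT {A G : Type*} [Inhabited A] [AddMonoid G] (X : Set (G → A)) : Prop :=
  ∃ F : Set (Pattern A G), F.Finite ∧ X = {x | ∀ p ∈ F, ¬ Occurs p x}

/-- The `j`-th row of a two-dimensional configuration. -/
def row {A : Type*} (x : ℤ × ℤ → A) (j : ℤ) : ℤ → A := fun i => x (i, j)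

/-- The (horizontal) projective subdynamics: the set of rows number `0` of the points of `X`. -/
def projectiveSubdynamics {A : Type*} (X : Set (ℤ × ℤ → A)) : Set (ℤ → A) :=
  {y | ∃ x ∈ X, y = row x 0}

/-- The rows of `X` lie in a countable one-dimensional SFT over the same alphabet. -/
def HasPProperty {A : Type*} [Inhabited A] (X : Set (ℤ × ℤ → A)) : Prop :=
  ∃ Y : Set (ℤ → A), IsSFT Y ∧ Y.Countable ∧ projectiveSubdynamics X ⊆ Y

/-- Southward determinism: the contents `w` of the half plane `{(a, b) | 1 ≤ b}` extend to at most
one point of `X`. -/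
def IsSouthwardDeterministic {A : Type*} (X : Set (ℤ × ℤ → A)) : Prop :=
  ∀ w : ℤ × ℤ → A,
    {y | y ∈ X ∧ ∀ a b : ℤ, 1 ≤ b → y (a, b) = w (a, b)}.Subsingleton

/-! ### Finite patterns as inputs of decision problems -/

/-- The pattern presented by a finite list of pairs (cell, symbol). The domain consists of the
cells that are listed; if a cell is listed repeatedly, its first entry counts. Thus every list
presents a pattern. -/
def patternOfList {A G : Type*} [Inhabited A] [DecidableEq G] (L : List (G × A)) :
    Pattern A G where
  config c := (L.lookup c).getD default
  support := (L.map Prod.fst).toFinset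
  condition c hc := by
    have h : L.lookup c = none := by
      rw [List.lookup_eq_none_iff]
      intro p hp
      have : c ≠ p.1 := by
        rintro rfl
        exact hc (List.mem_toFinset.2 (List.mem_map_of_mem hp))
      simpa using this
    simp [h]

/-- Every finite pattern is presented by a list. -/
theorem patternOfList_surjective {A G : Type*} [Inhabited A] [DecidableEq G] :
    Function.Surjective (patternOfList : List (G × A) → Pattern A G) := by
  intro p
  refine ⟨p.support.toList.map fun c => (c, p.config c), ?_⟩
  have key : ∀ (l : List G) (c : G),
      ((l.map fun c => (c, p.config c)).lookup c) = if c ∈ l then some (p.config c) else none := by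
    intro l c
    induction l with
    | nil => simp
    | cons a l ih =>
      by_cases h : c = a
      · subst h; simp
      · have hb : (c == a) = false := by simpa using h
        simp [List.lookup_cons, hb, ih, h]
  obtain ⟨config, support, condition⟩ := p
  simp only [patternOfList, Pattern.mk.injEq]
  constructor
  · funext c
    rw [key]
    by_cases hc : c ∈ support
    · simp [hc]
    · simp [hc, condition c hc]
  · ext c
    simp

/-! ### The arithmetical hierarchy -/

mutual

/-- `Σ⁰ₙ` predicates on a coded type: `Σ⁰₀` means computable, and `Σ⁰ₙ₊₁` means
`∃ m, q (a, m)` with `q` in `Π⁰ₙ`. -/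
def IsSigma : ℕ → ∀ (α : Type) [Primcodable α], (α → Prop) → Prop
  | 0, _, _, p => ComputablePred p
  | n + 1, α, _, p => ∃ q : α × ℕ → Prop, IsPi n (α × ℕ) q ∧ ∀ a, p a ↔ ∃ m, q (a, m)

/-- `Π⁰ₙ` predicates on a coded type: `Π⁰₀` means computable, and `Π⁰ₙ₊₁` means
`∀ m, q (a, m)` with `q` in `Σ⁰ₙ`. -/
def IsPi : ℕ → ∀ (α : Type) [Primcodable α], (α → Prop) → Prop
  | 0, _, _, p => ComputablePred p
  | n + 1, α, _, p => ∃ q : α × ℕ → Prop, IsSigma n (α × ℕ) q ∧ ∀ a, p a ↔ ∀ m, q (a, m)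

end

/-- `p` is `Π⁰ₙ`-complete: it is `Π⁰ₙ`, and every `Π⁰ₙ` set of natural numbers is many-one
reducible to it. -/
def IsPiComplete (n : ℕ) {α : Type} [Primcodable α] (p : α → Prop) : Prop :=
  IsPi n α p ∧ ∀ q : ℕ → Prop, IsPi n ℕ q → ManyOneReducible q p

end CountableSFT

/-!
The subshift consists of the space-time diagrams of a machine, time running northwards, so that
each property of the theorem becomes a property of the machine.

**Machines.** A pebble machine is a head that walks on `ℤ` among finitely many pebbles; the
registers of a program are the positions of the pebbles. A row records, for each pebble and for the
head, on which side of every cell it lies. Each of these layers is a cut of the line, `- - 0 + +`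
or constant, so a row is one of countably many (`countable_validRow`), and validity of rows is a
local condition. This gives the P property, and the diagrams form a shift of finite type
(`isSFT_diagrams`), because a step changes only cells next to the head. If the machine is
reversible, then a row determines its past (`Reversible.step_injective`), which is southward
determinism.

**The program.** Structured programs whose loops have both an entry and an exit test compile to
reversible machines, and reversible programs add the values of any primitive recursive function to
a register (`compilable_of_primrec'`); scratch registers are cleared by running the computation
backwards. The main program, started with numbers `k` and `d`, runs `k` phases, each of which
guesses a number `m` by counting up from `0` and replaces `d` by a code of `(d, m)`; then it checks
forever that the computation of a function with index `e` on `d` does not halt. The only choices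
are the decisions to stop counting. They require that fewer than `k` guesses were made, so a run has
finitely many choices, even if it starts from an arbitrary row (`Layout.Sound.finite_choices`), and
there are countably many diagrams (`countable_diagrams`).

**Hardness.** Consider the diagrams in which the machine is about to make the next guess. They form
a fan: one diagram never stops counting, and it is the limit of those that stop at `m`, as `m` grows.
If each of the branches contains at most one point of the `j`-th derivative, then the limit is the
only possible point of the `(j + 1)`-st derivative, and it is one iff infinitely many branches
contain a point of the `j`-th (`relDerivedSet_fan`). Inductively, the `k`-th derivative meets the
diagrams of the initial row for `k`, `d` iff `InfinitelyExtendable k e d` (`through_phase`), and the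
initial row is recognized by a pattern of four cells (`matches_pattern_iff`). Each `Π⁰₂ₖ₊₁`
predicate has the form `InfinitelyExtendable k e` (`IsPi.exists_infinitelyExtendable`): a statement
`∀ a, ∃ b, ∀ c` says that there are infinitely many finite sequences of canonical witnesses.

**Upper bound.** A pattern occurs in the derivative of a closed set iff for each `r` it extends to
a finite pattern that covers the first `r` cells and admits two different continuations, at one more
cell, that occur in the set. This adds two quantifiers to the case `k = 0`, which is a matter of
compactness (`isPi_exists_matches_derivative`).
-/


namespace CountableSFT

/-! ### Closure properties of the arithmetical hierarchy -/

section Hierarchy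

theorem isSigma_zero {α : Type} [Primcodable α] {p : α → Prop} :
    IsSigma 0 α p ↔ ComputablePred p := by
  rw [IsSigma]

theorem isPi_zero {α : Type} [Primcodable α] {p : α → Prop} :
    IsPi 0 α p ↔ ComputablePred p := by
  rw [IsPi]

theorem isSigma_succ {n : ℕ} {α : Type} [Primcodable α] {p : α → Prop} :
    IsSigma (n + 1) α p ↔ ∃ q : α × ℕ → Prop, IsPi n (α × ℕ) q ∧ ∀ a, p a ↔ ∃ m, q (a, m) := by
  rw [IsSigma]

theorem isPi_succ {n : ℕ} {α : Type} [Primcodable α] {p : α → Prop} :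
    IsPi (n + 1) α p ↔ ∃ q : α × ℕ → Prop, IsSigma n (α × ℕ) q ∧ ∀ a, p a ↔ ∀ m, q (a, m) := by
  rw [IsPi]

theorem ComputablePred.comp' {α β : Type} [Primcodable α] [Primcodable β] {p : β → Prop}
    (hp : ComputablePred p) {f : α → β} (hf : Computable f) : ComputablePred fun a => p (f a) := by
  obtain ⟨D, hD⟩ := hp
  exact ⟨fun a => D (f a), hD.comp hf⟩

theorem ComputablePred.and' {α : Type} [Primcodable α] {p q : α → Prop}
    (hp : ComputablePred p) (hq : ComputablePred q) : ComputablePred fun a => p a ∧ q a := by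
  obtain ⟨D, hD⟩ := hp
  obtain ⟨E, hE⟩ := hq
  exact ⟨fun a => inferInstance, (Primrec.and.to_comp.comp hD hE).of_eq fun a => by simp⟩

theorem sigma_pi_comp (n : ℕ) : ∀ (α β : Type) [Primcodable α] [Primcodable β] (f : α → β),
    Computable f → ∀ p : β → Prop, (IsSigma n β p → IsSigma n α fun a => p (f a)) ∧
      (IsPi n β p → IsPi n α fun a => p (f a)) := by
  induction n with
  | zero =>
    intro α β _ _ f hf p
    simp only [isSigma_zero, isPi_zero]
    exact ⟨fun h => ComputablePred.comp' h hf, fun h => ComputablePred.comp' h hf⟩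
  | succ n ih =>
    intro α β _ _ f hf p
    have hg : Computable fun x : α × ℕ => (f x.1, x.2) :=
      (hf.comp Computable.fst).pair Computable.snd
    simp only [isSigma_succ, isPi_succ]
    constructor
    · rintro ⟨q, hq, h⟩
      exact ⟨_, (ih _ _ _ hg q).2 hq, fun a => h (f a)⟩
    · rintro ⟨q, hq, h⟩
      exact ⟨_, (ih _ _ _ hg q).1 hq, fun a => h (f a)⟩

theorem IsSigma.comp {n : ℕ} {α β : Type} [Primcodable α] [Primcodable β] {p : β → Prop}
    (hp : IsSigma n β p) {f : α → β} (hf : Computable f) : IsSigma n α fun a => p (f a) :=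
  (sigma_pi_comp n α β f hf p).1 hp

theorem IsPi.comp {n : ℕ} {α β : Type} [Primcodable α] [Primcodable β] {p : β → Prop}
    (hp : IsPi n β p) {f : α → β} (hf : Computable f) : IsPi n α fun a => p (f a) :=
  (sigma_pi_comp n α β f hf p).2 hp

theorem IsSigma.of_eq {n : ℕ} {α : Type} [Primcodable α] {p q : α → Prop}
    (hp : IsSigma n α p) (h : ∀ a, p a ↔ q a) : IsSigma n α q := by
  rwa [← funext fun a => propext (h a)]

theorem IsPi.of_eq {n : ℕ} {α : Type} [Primcodable α] {p q : α → Prop}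
    (hp : IsPi n α p) (h : ∀ a, p a ↔ q a) : IsPi n α q := by
  rwa [← funext fun a => propext (h a)]

theorem sigma_pi_not (n : ℕ) : ∀ (α : Type) [Primcodable α] (p : α → Prop),
    (IsSigma n α p → IsPi n α fun a => ¬ p a) ∧ (IsPi n α p → IsSigma n α fun a => ¬ p a) := by
  induction n with
  | zero =>
    intro α _ p
    simp only [isSigma_zero, isPi_zero]
    exact ⟨fun h => h.not, fun h => h.not⟩
  | succ n ih =>
    intro α _ p
    simp only [isSigma_succ, isPi_succ]
    constructor
    · rintro ⟨q, hq, h⟩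
      exact ⟨_, (ih _ q).2 hq, fun a => by simp [h a]⟩
    · rintro ⟨q, hq, h⟩
      exact ⟨_, (ih _ q).1 hq, fun a => by simp [h a]⟩

theorem IsSigma.not {n : ℕ} {α : Type} [Primcodable α] {p : α → Prop} (hp : IsSigma n α p) :
    IsPi n α fun a => ¬ p a :=
  (sigma_pi_not n α p).1 hp

theorem IsPi.not {n : ℕ} {α : Type} [Primcodable α] {p : α → Prop} (hp : IsPi n α p) :
    IsSigma n α fun a => ¬ p a :=
  (sigma_pi_not n α p).2 hp

theorem sigma_pi_and (n : ℕ) : ∀ (α : Type) [Primcodable α] (p q : α → Prop),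
    (IsSigma n α p → IsSigma n α q → IsSigma n α fun a => p a ∧ q a) ∧
      (IsPi n α p → IsPi n α q → IsPi n α fun a => p a ∧ q a) := by
  induction n with
  | zero =>
    intro α _ p q
    simp only [isSigma_zero, isPi_zero]
    exact ⟨fun h h' => ComputablePred.and' h h', fun h h' => ComputablePred.and' h h'⟩
  | succ n ih =>
    intro α _ p q
    have h1 : Computable fun x : α × ℕ => (x.1, x.2.unpair.1) :=
      Computable.fst.pair (Computable.fst.comp (Computable.unpair.comp Computable.snd))
    have h2 : Computable fun x : α × ℕ => (x.1, x.2.unpair.2) :=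
      Computable.fst.pair (Computable.snd.comp (Computable.unpair.comp Computable.snd))
    simp only [isSigma_succ, isPi_succ]
    constructor
    · rintro ⟨p', hp', h⟩ ⟨q', hq', h'⟩
      refine ⟨_, (ih _ _ _).2 (hp'.comp h1) (hq'.comp h2), fun a => ?_⟩
      rw [h, h']
      constructor
      · rintro ⟨⟨m, hm⟩, k, hk⟩
        exact ⟨Nat.pair m k, by simpa using ⟨hm, hk⟩⟩
      · rintro ⟨m, hm, hk⟩
        exact ⟨⟨_, hm⟩, _, hk⟩
    · rintro ⟨p', hp', h⟩ ⟨q', hq', h'⟩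
      refine ⟨_, (ih _ _ _).1 hp' hq', fun a => ?_⟩
      rw [h, h', forall_and]

theorem IsSigma.and {n : ℕ} {α : Type} [Primcodable α] {p q : α → Prop} (hp : IsSigma n α p)
    (hq : IsSigma n α q) : IsSigma n α fun a => p a ∧ q a :=
  (sigma_pi_and n α p q).1 hp hq

theorem IsPi.and {n : ℕ} {α : Type} [Primcodable α] {p q : α → Prop} (hp : IsPi n α p)
    (hq : IsPi n α q) : IsPi n α fun a => p a ∧ q a :=
  (sigma_pi_and n α p q).2 hp hq

theorem IsPi.or {n : ℕ} {α : Type} [Primcodable α] {p q : α → Prop} (hp : IsPi n α p)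
    (hq : IsPi n α q) : IsPi n α fun a => p a ∨ q a :=
  (hp.not.and hq.not).not.of_eq fun a => by tauto

/-- A vacuous innermost quantifier does not change a predicate, so each level of the hierarchy is
contained in the next one with the same leading quantifier. -/
theorem sigma_pi_succ (n : ℕ) : ∀ (α : Type) [Primcodable α] (p : α → Prop),
    (IsSigma n α p → IsSigma (n + 1) α p) ∧ (IsPi n α p → IsPi (n + 1) α p) := by
  induction n with
  | zero =>
    intro α _ p
    simp only [isSigma_succ, isPi_succ, isSigma_zero, isPi_zero]
    exact ⟨fun h => ⟨_, ComputablePred.comp' h Computable.fst, fun a => by simp⟩,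
      fun h => ⟨_, ComputablePred.comp' h Computable.fst, fun a => by simp⟩⟩
  | succ n ih =>
    intro α _ p
    rw [isSigma_succ, isPi_succ, isSigma_succ, isPi_succ]
    exact ⟨fun ⟨q, hq, h⟩ => ⟨q, (ih _ q).2 hq, h⟩, fun ⟨q, hq, h⟩ => ⟨q, (ih _ q).1 hq, h⟩⟩

theorem IsPi.succ {n : ℕ} {α : Type} [Primcodable α] {p : α → Prop} (hp : IsPi n α p) :
    IsPi (n + 1) α p :=
  (sigma_pi_succ n α p).2 hp

theorem IsSigma.pi_succ {n : ℕ} {α : Type} [Primcodable α] {p : α → Prop} (hp : IsSigma n α p) :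
    IsPi (n + 1) α p :=
  isPi_succ.2 ⟨_, hp.comp Computable.fst, fun a => by simp⟩

theorem IsPi.sigma_succ {n : ℕ} {α : Type} [Primcodable α] {p : α → Prop} (hp : IsPi n α p) :
    IsSigma (n + 1) α p :=
  isSigma_succ.2 ⟨_, hp.comp Computable.fst, fun a => by simp⟩

theorem _root_.ComputablePred.isPi {α : Type} [Primcodable α] {p : α → Prop}
    (hp : ComputablePred p) (n : ℕ) : IsPi n α p := by
  induction n with
  | zero => exact isPi_zero.2 hp
  | succ n ih => exact ih.succ

/-- Two leading universal quantifiers contract to one. -/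
theorem IsPi.forall {n : ℕ} {α : Type} [Primcodable α] {p : α × ℕ → Prop}
    (hp : IsPi (n + 1) (α × ℕ) p) : IsPi (n + 1) α fun a => ∀ m, p (a, m) := by
  obtain ⟨q, hq, h⟩ := isPi_succ.1 hp
  have h1 : Computable fun x : α × ℕ => ((x.1, x.2.unpair.1), x.2.unpair.2) :=
    (Computable.fst.pair (Computable.fst.comp (Computable.unpair.comp Computable.snd))).pair
      (Computable.snd.comp (Computable.unpair.comp Computable.snd))
  refine isPi_succ.2 ⟨_, hq.comp h1, fun a => ?_⟩
  simp only [h]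
  constructor
  · exact fun H m => H _ _
  · intro H m k
    simpa using H (Nat.pair m k)

/-- Two leading existential quantifiers contract to one. -/
theorem IsSigma.exists {n : ℕ} {α : Type} [Primcodable α] {p : α × ℕ → Prop}
    (hp : IsSigma (n + 1) (α × ℕ) p) : IsSigma (n + 1) α fun a => ∃ m, p (a, m) :=
  (IsPi.forall hp.not).not.of_eq fun a => by simp

end Hierarchy

/-! ### A normal form for the levels `Π⁰₂ₖ₊₁` -/

section NormalForm

/-- The pairing function `(a, m) ↦ a + (1 + 2 + ⋯ + (a + m))`. Unlike `Nat.pair` it is computed by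
a single loop that only adds registers, which makes it convenient for reversible programs. -/
def triPair (a m : ℕ) : ℕ := a + (a + m) * (a + m + 1) / 2

theorem triPair_injective {a m a' m' : ℕ} (h : triPair a m = triPair a' m') : a = a' ∧ m = m' := by
  have tri : ∀ s, (s + 1) * (s + 1 + 1) / 2 = s * (s + 1) / 2 + (s + 1) := by
    intro s
    have : (s + 1) * (s + 1 + 1) = s * (s + 1) + (s + 1) * 2 := by ring
    rw [this, Nat.add_mul_div_right _ _ (by norm_num)]
  have mono : Monotone fun s : ℕ => s * (s + 1) / 2 :=
    monotone_nat_of_le_succ fun s => by rw [tri]; omega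
  have key : ∀ b s b' s' : ℕ, b ≤ s → s < s' →
      b + s * (s + 1) / 2 < b' + s' * (s' + 1) / 2 := by
    intro b s b' s' hb hs
    have := mono (show s + 1 ≤ s' from hs)
    simp only [tri] at this
    omega
  have hs : a + m = a' + m' := by
    rcases lt_trichotomy (a + m) (a' + m') with h1 | h1 | h1
    · exact absurd h (key a _ a' _ (by omega) h1).ne
    · exact h1
    · exact absurd h (key a' _ a _ (by omega) h1).ne'
  unfold triPair at h
  rw [hs] at h
  omega

theorem primrec_triPair : Primrec₂ triPair :=
  Primrec.nat_add.comp Primrec.fst (Primrec.nat_div.comp (Primrec.nat_mul.comp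
    (Primrec.nat_add.comp Primrec.fst Primrec.snd)
    (Primrec.succ.comp (Primrec.nat_add.comp Primrec.fst Primrec.snd))) (Primrec.const 2))

/-- `InfinitelyExtendable k e d` says that there are infinitely many `m₁` for which there are
infinitely many `m₂` … for which there are infinitely many `mₖ` such that the `e`-th program does
not halt on the number that codes `(((d, m₁), m₂), …, mₖ)` through `triPair`. These predicates are
the normal form of `Π⁰₂ₖ₊₁` predicates. -/
def InfinitelyExtendable : ℕ → ℕ → ℕ → Prop
  | 0, e, d => ¬ ((Denumerable.ofNat Nat.Partrec.Code e).eval d).Dom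
  | k + 1, e, d => {m | InfinitelyExtendable k e (triPair d m)}.Infinite

/-- `cs` is the list of the least counterexamples `c` to `T (b, ·)`, for `b = 0, 1, …`, up to the
first `b` without counterexample, which is the length of `cs`. -/
def IsLeastRefutation (T : ℕ → ℕ → Prop) (cs : List ℕ) : Prop :=
  (∀ c, T cs.length c) ∧
    ∀ b < cs.length, ¬ T b (cs.getD b 0) ∧ ∀ c < cs.getD b 0, T b c

theorem IsLeastRefutation.unique {T : ℕ → ℕ → Prop} {cs cs' : List ℕ}
    (h : IsLeastRefutation T cs) (h' : IsLeastRefutation T cs') : cs = cs' := by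
  have hl : cs.length = cs'.length := by
    rcases lt_trichotomy cs.length cs'.length with hlt | heq | hlt
    · exact absurd (h.1 _) (h'.2 _ hlt).1
    · exact heq
    · exact absurd (h'.1 _) (h.2 _ hlt).1
  refine List.ext_getElem hl fun b hb hb' => ?_
  have h1 := h.2 b hb
  have h2 := h'.2 b hb'
  rw [List.getD_eq_getElem _ _ hb] at h1
  rw [List.getD_eq_getElem _ _ hb'] at h2
  rcases lt_trichotomy cs[b] cs'[b] with hlt | heq | hlt
  · exact absurd (h2.2 _ hlt) h1.1
  · exact heq
  · exact absurd (h1.2 _ hlt) h2.1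

theorem exists_isLeastRefutation {T : ℕ → ℕ → Prop} :
    (∃ cs, IsLeastRefutation T cs) ↔ ∃ b, ∀ c, T b c := by
  classical
  refine ⟨fun ⟨cs, h⟩ => ⟨_, h.1⟩, fun h => ?_⟩
  have hmin : ∀ b < Nat.find h, ∃ c, ¬ T b c := fun b hb => by
    simpa using Nat.find_min h hb
  refine ⟨(List.range (Nat.find h)).map fun b => sInf {c | ¬ T b c}, ?_, ?_⟩
  · simpa using Nat.find_spec h
  · intro b hb
    rw [List.length_map, List.length_range] at hb
    have hg : ((List.range (Nat.find h)).map fun b => sInf {c | ¬ T b c}).getD b 0 =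
        sInf {c | ¬ T b c} := by
      rw [List.getD_eq_getElem _ _ (by simpa using hb)]
      simp
    rw [hg]
    exact ⟨Nat.sInf_mem (hmin b hb), fun c hc => by
      have := Nat.notMem_of_lt_sInf hc
      simpa using this⟩

/-- A statement `∀ a, ∃ b, ∀ c, T` holds iff there are infinitely many finite sequences that
consist of the canonical witnesses for `a = 0, 1, 2, …`. -/
theorem infinite_isLeastRefutation_iff (T : ℕ → ℕ → ℕ → Prop) :
    {ℓ : List (List ℕ) | ∀ a < ℓ.length, IsLeastRefutation (T a) (ℓ.getD a [])}.Infinite ↔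
      ∀ a, ∃ b, ∀ c, T a b c := by
  constructor
  · intro hinf
    by_contra hne
    push Not at hne
    obtain ⟨a, ha⟩ := hne
    refine hinf ?_
    refine Set.Finite.of_finite_image (f := List.length)
      ((Set.finite_Iic a).subset ?_) ?_
    · rintro _ ⟨ℓ, hℓ, rfl⟩
      by_contra hlt
      obtain ⟨c, hc⟩ := ha (ℓ.getD a []).length
      exact hc ((hℓ a (by simpa using hlt)).1 c)
    · intro ℓ hℓ ℓ' hℓ' hl
      refine List.ext_getElem hl fun a h1 h2 => ?_
      have e1 := hℓ a h1
      have e2 := hℓ' a h2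
      rw [List.getD_eq_getElem _ _ h1] at e1
      rw [List.getD_eq_getElem _ _ h2] at e2
      exact e1.unique e2
  · intro h
    choose G hG using fun a => exists_isLeastRefutation.2 (h a)
    refine Set.infinite_of_injective_forall_mem (f := fun A => (List.range A).map G)
      (fun A B hAB => by simpa using congrArg List.length hAB) fun A a ha => ?_
    have ha' : a < ((List.range A).map G).length := ha
    rw [List.getD_eq_getElem _ _ ha']
    simpa using hG a

/-- Every `Π⁰ₙ₊₃` predicate has the form "there are infinitely many `m` with `R`" for a `Π⁰ₙ₊₁`
relation `R`. -/
theorem IsPi.exists_infinite {n : ℕ} {q : ℕ → Prop} (hq : IsPi (n + 3) ℕ q) :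
    ∃ R : ℕ × ℕ → Prop, IsPi (n + 1) (ℕ × ℕ) R ∧ ∀ a, q a ↔ {m | R (a, m)}.Infinite := by
  obtain ⟨r, hr, hqr⟩ := isPi_succ.1 hq
  obtain ⟨s, hs, hrs⟩ := isSigma_succ.1 hr
  obtain ⟨T, hT, hsT⟩ := isPi_succ.1 hs
  let L : ℕ → List (List ℕ) := Denumerable.ofNat (List (List ℕ))
  refine ⟨fun x => ∀ a < (L x.2).length,
    IsLeastRefutation (fun b c => T (((x.1, a), b), c)) ((L x.2).getD a []), ?_, ?_⟩
  · -- the coordinates of a tuple `y = (((x, a), b), c)`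
    let Y := ((((ℕ × ℕ) × ℕ) × ℕ) × ℕ)
    have hx : Computable fun y : Y => y.1.1.1 :=
      Computable.fst.comp (Computable.fst.comp Computable.fst)
    have ha : Computable fun y : Y => y.1.1.2 :=
      Computable.snd.comp (Computable.fst.comp Computable.fst)
    have hb : Computable fun y : Y => y.1.2 := Computable.snd.comp Computable.fst
    have hc : Computable fun y : Y => y.2 := Computable.snd
    have hn : Computable fun y : Y => (y.1.1.1.1, y.1.1.2) := (Computable.fst.comp hx).pair ha
    have hL : Computable fun y : Y => L y.1.1.1.2 :=
      (Computable.ofNat _).comp (Computable.snd.comp hx)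
    have hcs : Computable fun y : Y => (L y.1.1.1.2).getD y.1.1.2 [] :=
      (Primrec.list_getD []).to_comp.comp hL ha
    have hcb : Computable fun y : Y => ((L y.1.1.1.2).getD y.1.1.2 []).getD y.1.2 0 :=
      (Primrec.list_getD 0).to_comp.comp hcs hb
    have hlt : ∀ {f g : Y → ℕ}, Computable f → Computable g →
        ComputablePred fun y : Y => ¬ f y < g y := fun hf hg =>
      (ComputablePred.comp' (p := fun z : ℕ × ℕ => z.1 < z.2)
        (PrimrecPred.computablePred Primrec.nat_lt) (hf.pair hg)).not
    have hlen : ∀ {β : Type} [Primcodable β] {f : Y → List β}, Computable f →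
        Computable fun y => (f y).length := fun hf => Primrec.list_length.to_comp.comp hf
    have main : IsPi (n + 1) Y fun y => ¬ y.1.1.2 < (L y.1.1.1.2).length ∨
        (s ((y.1.1.1.1, y.1.1.2), ((L y.1.1.1.2).getD y.1.1.2 []).length) ∧
          (¬ y.1.2 < ((L y.1.1.1.2).getD y.1.1.2 []).length ∨
            (¬ T (((y.1.1.1.1, y.1.1.2), y.1.2), ((L y.1.1.1.2).getD y.1.1.2 []).getD y.1.2 0) ∧
              (¬ y.2 < ((L y.1.1.1.2).getD y.1.1.2 []).getD y.1.2 0 ∨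
                T (((y.1.1.1.1, y.1.1.2), y.1.2), y.2))))) :=
      ((hlt ha (hlen hL)).isPi _).or ((hs.comp (hn.pair (hlen hcs))).and
        (((hlt hb (hlen hcs)).isPi _).or (((hT.comp ((hn.pair hb).pair hcb)).not.succ).and
          (((hlt hc hcb).isPi _).or (hT.comp ((hn.pair hb).pair hc)).pi_succ))))
    refine main.forall.forall.forall.of_eq fun x => ?_
    simp only [← hsT, IsLeastRefutation]
    constructor
    · intro H a ha'
      refine ⟨((H a 0 0).resolve_left (not_not.2 ha')).1, fun b hb' => ?_⟩
      have H' := fun c => ((((H a b c).resolve_left (not_not.2 ha')).2).resolve_left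
        (not_not.2 hb'))
      exact ⟨(H' 0).1, fun c hc' => (H' c).2.resolve_left (not_not.2 hc')⟩
    · intro H a b c
      by_cases ha' : a < (L x.2).length
      · refine Or.inr ⟨(H a ha').1, ?_⟩
        by_cases hb' : b < ((L x.2).getD a []).length
        · have := (H a ha').2 b hb'
          exact Or.inr ⟨this.1, (not_or_of_imp (this.2 c))⟩
        · exact Or.inl hb'
      · exact Or.inl ha'
  · intro a
    have h1 : q a ↔ ∀ i, ∃ b, ∀ c, T (((a, i), b), c) := by
      rw [hqr]
      simp only [hrs, hsT]
    rw [h1, ← infinite_isLeastRefutation_iff fun i b c => T (((a, i), b), c)]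
    have hbij : Function.Bijective L := (Denumerable.eqv (List (List ℕ))).symm.bijective
    have h2 := Set.infinite_image_iff (s := L ⁻¹' {ℓ : List (List ℕ) | ∀ i < ℓ.length,
      IsLeastRefutation (fun b c => T (((a, i), b), c)) (ℓ.getD i [])}) hbij.injective.injOn
    rwa [Set.image_preimage_eq _ hbij.surjective] at h2

/-- Every `Π⁰₂ₖ₊₁` predicate is an instance of the normal form `InfinitelyExtendable k`. -/
theorem IsPi.exists_infinitelyExtendable (k : ℕ) : ∀ {q : ℕ → Prop}, IsPi (2 * k + 1) ℕ q →
    ∃ e, ∀ a, q a ↔ InfinitelyExtendable k e a := by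
  induction k with
  | zero =>
    intro q hq
    have hnot := hq.not
    obtain ⟨r, hr, hqr⟩ := isSigma_succ.1 hnot
    obtain ⟨D, hD⟩ := isPi_zero.1 hr
    -- an unbounded search for a counterexample halts iff `q` fails
    have hpart : Partrec fun a : ℕ => Nat.rfind fun m => Part.some (decide (r (a, m))) :=
      Partrec.rfind (hD.comp Computable.id).partrec.to₂
    obtain ⟨c, hc⟩ := Nat.Partrec.Code.exists_code.1 (Partrec.nat_iff.1 hpart)
    refine ⟨Encodable.encode c, fun a => ?_⟩
    rw [InfinitelyExtendable, Denumerable.ofNat_encode, hc, ← not_iff_not, not_not, hqr]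
    refine Iff.trans ?_ Nat.rfind_dom.symm
    simp
  | succ k ih =>
    intro q hq
    obtain ⟨R, hR, hqR⟩ := IsPi.exists_infinite (n := 2 * k) hq
    -- `R` is transported to codes of pairs; non-codes are irrelevant
    let R' : ℕ → Prop := fun x => ∀ y : ℕ, ¬ triPair y.unpair.1 y.unpair.2 = x ∨ R y.unpair
    have hR' : IsPi (2 * k + 1) ℕ R' := by
      have h1 : Computable fun z : ℕ × ℕ => z.2.unpair := Computable.unpair.comp Computable.snd
      refine IsPi.forall (p := fun z : ℕ × ℕ =>
        ¬ triPair z.2.unpair.1 z.2.unpair.2 = z.1 ∨ R z.2.unpair) ?_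
      refine IsPi.or (ComputablePred.isPi (ComputablePred.not ?_) _) (hR.comp h1)
      refine ComputablePred.comp' (p := fun z : ℕ × ℕ => z.1 = z.2)
        (PrimrecPred.computablePred Primrec.eq) (f := fun z : ℕ × ℕ =>
          (triPair z.2.unpair.1 z.2.unpair.2, z.1)) ?_
      exact (primrec_triPair.to_comp.comp (Computable.fst.comp h1) (Computable.snd.comp h1)).pair
        Computable.fst
    obtain ⟨e, he⟩ := ih hR'
    refine ⟨e, fun a => ?_⟩
    rw [hqR, InfinitelyExtendable]
    have : ∀ m, R (a, m) ↔ InfinitelyExtendable k e (triPair a m) := by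
      intro m
      rw [← he]
      constructor
      · intro h y
        refine (em _).symm.imp id fun hy => ?_
        obtain ⟨h1, h2⟩ := triPair_injective hy
        rwa [← Prod.mk.eta (p := y.unpair), h1, h2]
      · intro h
        simpa using (h (Nat.pair a m)).resolve_left (by simp)
    simp only [this]

end NormalForm

/-! ### Occurrence of patterns in shift-invariant closed sets -/

section Occurrence

variable {A : Type}

/-- Cells are compared through their decidable equality, as in `patternOfList`. -/
local instance cellBEq : BEq (ℤ × ℤ) := instBEqOfDecidableEq

/-- The configuration `x` agrees with the pattern presented by `L`, placed at the origin. -/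
def Matches (L : List ((ℤ × ℤ) × A)) (x : ℤ × ℤ → A) : Prop :=
  ∀ c a, L.lookup c = some a → x c = a

theorem matches_of_forall_mem {L : List ((ℤ × ℤ) × A)} {x : ℤ × ℤ → A}
    (h : ∀ p ∈ L, x p.1 = p.2) : Matches L x := by
  intro c a hc
  obtain ⟨l₁, l₂, rfl, -⟩ := List.lookup_eq_some_iff.1 hc
  exact h (c, a) (by simp)

theorem Matches.append {L M : List ((ℤ × ℤ) × A)} {x : ℤ × ℤ → A} (hL : Matches L x)
    (hM : Matches M x) : Matches (L ++ M) x := by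
  intro c a hc
  rw [List.lookup_append] at hc
  rcases h : L.lookup c with - | b
  · rw [h, Option.none_or] at hc
    exact hM c a hc
  · rw [h, Option.some_or] at hc
    exact hL c a (h.trans hc)

theorem Matches.of_append {L M : List ((ℤ × ℤ) × A)} {x : ℤ × ℤ → A} (h : Matches (L ++ M) x) :
    Matches L x := by
  intro c a hc
  refine h c a ?_
  rw [List.lookup_append, hc, Option.some_or]

theorem occursInAt_patternOfList [Inhabited A] {L : List ((ℤ × ℤ) × A)} {x : ℤ × ℤ → A}
    {g : ℤ × ℤ} :
    (patternOfList L).occursInAt x g ↔ Matches L fun h => x (g + h) := by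
  constructor
  · intro h c a hc
    have hm : c ∈ (patternOfList L).support := by
      obtain ⟨l₁, l₂, rfl, -⟩ := List.lookup_eq_some_iff.1 hc
      simp [patternOfList]
    have := h c hm
    simpa [patternOfList, hc] using this
  · intro h c hc
    have hne : L.lookup c ≠ none := by
      intro hn
      rw [List.lookup_eq_none_iff] at hn
      simp only [patternOfList, List.mem_toFinset, List.mem_map] at hc
      obtain ⟨p, hp, rfl⟩ := hc
      simpa using hn p hp
    obtain ⟨a, ha⟩ := Option.ne_none_iff_exists'.1 hne
    simpa [patternOfList, ha] using h c a ha

/-- The cells of the plane, enumerated by the natural numbers. -/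
def cell (i : ℕ) : ℤ × ℤ := Denumerable.ofNat (ℤ × ℤ) i

theorem cell_encode (c : ℤ × ℤ) : cell (Encodable.encode c) = c := Denumerable.ofNat_encode c

/-- `D` is closed under translations of configurations. -/
def ShiftInvariant (D : Set (ℤ × ℤ → A)) : Prop :=
  ∀ x ∈ D, ∀ g : ℤ × ℤ, (fun h => x (g + h)) ∈ D

theorem ShiftInvariant.occursInSet_iff [Inhabited A] {D : Set (ℤ × ℤ → A)} (hD : ShiftInvariant D)
    {L : List ((ℤ × ℤ) × A)} : OccursInSet (patternOfList L) D ↔ ∃ x ∈ D, Matches L x := by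
  constructor
  · rintro ⟨x, hx, g, hg⟩
    exact ⟨_, hD x hx g, occursInAt_patternOfList.1 hg⟩
  · rintro ⟨x, hx, h⟩
    exact ⟨x, hx, 0, occursInAt_patternOfList.2 (by simpa using h)⟩

theorem IsSFT.shiftInvariant [Inhabited A] {X : Set (ℤ × ℤ → A)} (hX : IsSFT X) :
    ShiftInvariant X := by
  obtain ⟨F, -, rfl⟩ := hX
  rintro x hx g p hp ⟨h, hh⟩
  exact hx p hp ⟨g + h, fun c hc => by simpa [add_assoc] using hh c hc⟩

variable [TopologicalSpace A]

theorem ShiftInvariant.relDerivedSet {D : Set (ℤ × ℤ → A)} (hD : ShiftInvariant D) :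
    ShiftInvariant (relDerivedSet D) := by
  rintro x ⟨hx, hxD⟩ g
  refine ⟨?_, hD x hxD g⟩
  have hcont : Continuous fun (y : ℤ × ℤ → A) (h : ℤ × ℤ) => y (g + h) :=
    continuous_pi fun h => continuous_apply _
  have hinj : Function.Injective fun (y : ℤ × ℤ → A) (h : ℤ × ℤ) => y (g + h) := by
    intro y z hyz
    funext h
    simpa using congrFun hyz (-g + h)
  have := AccPt.map hx hcont.continuousAt hinj
  refine this.mono ?_
  rw [Filter.map_principal, Filter.principal_mono]
  rintro _ ⟨y, hy, rfl⟩
  exact hD y hy g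

theorem ShiftInvariant.iteratedDerivedSet {D : Set (ℤ × ℤ → A)} (hD : ShiftInvariant D) (k : ℕ) :
    ShiftInvariant (CantorBendixson.iteratedDerivedSet D (k : Ordinal.{0})) := by
  induction k with
  | zero => simpa using hD
  | succ k ih =>
    rw [Nat.cast_succ, CantorBendixson.iteratedDerivedSet_succ]
    exact ih.relDerivedSet

/-- The sets of configurations that agree with `x` on an initial segment of the enumerated plane form
a neighbourhood basis. -/
theorem exists_agree_subset {x : ℤ × ℤ → A} {U : Set (ℤ × ℤ → A)} (hU : U ∈ nhds x) :
    ∃ r, ∀ y, (∀ i < r, y (cell i) = x (cell i)) → y ∈ U := by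
  rw [nhds_pi, Filter.mem_pi'] at hU
  obtain ⟨I, t, ht, hsub⟩ := hU
  refine ⟨I.sup Encodable.encode + 1, fun y hy => hsub fun c hc => ?_⟩
  have h1 := hy (Encodable.encode c) (Nat.lt_succ_of_le (Finset.le_sup (f := Encodable.encode) hc))
  rw [cell_encode] at h1
  rw [h1]
  exact mem_of_mem_nhds (ht c)

variable [DiscreteTopology A]

theorem isClopen_agree (c : ℤ × ℤ) (a : A) : IsClopen {x : ℤ × ℤ → A | x c = a} :=
  (isClopen_discrete {a}).preimage (continuous_apply (A := fun _ : ℤ × ℤ => A) c)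

theorem isClosed_matches (L : List ((ℤ × ℤ) × A)) : IsClosed {x | Matches L x} := by
  have : {x | Matches L x} = ⋂ c, ⋂ a, ⋂ (_ : L.lookup c = some a), {x | x c = a} := by
    ext x
    simp [Matches]
  rw [this]
  exact isClosed_iInter fun c => isClosed_iInter fun a => isClosed_iInter fun _ =>
    (isClopen_agree c a).1

theorem IsSFT.isClosed [Inhabited A] {X : Set (ℤ × ℤ → A)} (hX : IsSFT X) : IsClosed X := by
  obtain ⟨F, -, rfl⟩ := hX
  have : {x : ℤ × ℤ → A | ∀ p ∈ F, ¬ Occurs p x} =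
      ⋂ p ∈ F, ⋂ g : ℤ × ℤ, (⋂ h ∈ p.support, {x | x (g + h) = p.config h})ᶜ := by
    ext x
    simp [Occurs, SymbolicDynamics.FullShift.Pattern.occursInAt]
  rw [this]
  refine isClosed_biInter fun p _ => isClosed_iInter fun g => IsOpen.isClosed_compl ?_
  exact isOpen_biInter_finset fun h _ => (isClopen_agree _ _).2

theorem eventually_agree (x : ℤ × ℤ → A) (s : Set (ℤ × ℤ)) (hs : s.Finite) :
    {y | ∀ c ∈ s, y c = x c} ∈ nhds x := by
  have : {y : ℤ × ℤ → A | ∀ c ∈ s, y c = x c} = ⋂ c ∈ s, {y | y c = x c} := by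
    ext y
    simp
  rw [this]
  exact (hs.isOpen_biInter fun c _ => (isClopen_agree c (x c)).2).mem_nhds (by simp)

variable [Finite A]

/-- A pattern occurs in the derived set iff arbitrarily large extensions of it can be continued
in two different ways. -/
theorem exists_relDerivedSet_matches_iff {D : Set (ℤ × ℤ → A)} (hD : IsClosed D)
    (L : List ((ℤ × ℤ) × A)) :
    (∃ x ∈ relDerivedSet D, Matches L x) ↔
      ∀ r : ℕ, ∃ (B : List ((ℤ × ℤ) × A)) (c : ℤ × ℤ) (a b : A),
        (∀ i < r, ((L ++ B).lookup (cell i)).isSome) ∧ (L ++ B).lookup c = none ∧ a ≠ b ∧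
        (∃ x ∈ D, Matches (L ++ B ++ [(c, a)]) x) ∧ ∃ x ∈ D, Matches (L ++ B ++ [(c, b)]) x := by
  constructor
  · rintro ⟨x, ⟨hx, hxD⟩, hL⟩ r
    let B : List ((ℤ × ℤ) × A) := (List.range r).map fun i => (cell i, x (cell i))
    have hB : ∀ z : ℤ × ℤ → A, (∀ i < r, z (cell i) = x (cell i)) → Matches B z := by
      intro z hz
      refine matches_of_forall_mem fun p hp => ?_
      simp only [B, List.mem_map, List.mem_range] at hp
      obtain ⟨i, hi, rfl⟩ := hp
      exact hz i hi
    have hcov : ∀ i < r, ((L ++ B).lookup (cell i)).isSome := by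
      intro i hi
      rw [List.lookup_append, Option.isSome_or, Bool.or_eq_true]
      right
      rw [Option.isSome_iff_ne_none]
      intro hn
      rw [List.lookup_eq_none_iff] at hn
      simpa using hn (cell i, x (cell i)) (List.mem_map.2 ⟨i, List.mem_range.2 hi, rfl⟩)
    have hfin : ({c | ((L ++ B).lookup c) ≠ none} : Set (ℤ × ℤ)).Finite := by
      refine ((L ++ B).map Prod.fst).toFinset.finite_toSet.subset fun c hc => ?_
      obtain ⟨a, ha⟩ := Option.ne_none_iff_exists'.1 hc
      obtain ⟨l₁, l₂, h, -⟩ := List.lookup_eq_some_iff.1 ha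
      rw [h]
      simp
    obtain ⟨z, ⟨hz, hzD⟩, hne⟩ := accPt_iff_nhds.1 hx _ (eventually_agree x _ hfin)
    obtain ⟨c, hc⟩ := Function.ne_iff.1 hne
    have hxLB : Matches (L ++ B) x := hL.append (hB x fun _ _ => rfl)
    have hzLB : Matches (L ++ B) z := fun c a hca => by
      rw [hz c (by rw [Set.mem_ofPred_eq, hca]; simp), hxLB c a hca]
    refine ⟨B, c, x c, z c, hcov, ?_, Ne.symm hc, ⟨x, hxD, hxLB.append ?_⟩, z, hzD,
      hzLB.append ?_⟩
    · by_contra hn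
      exact hc (hz c hn)
    · exact matches_of_forall_mem (by simp)
    · exact matches_of_forall_mem (by simp)
  · intro h
    choose B c a b hcov hc hab hya hzb using h
    choose y hyD hyM using hya
    choose z hzD hzM using hzb
    have hcomp : IsCompact (D ∩ {x | Matches L x}) := (hD.inter (isClosed_matches L)).isCompact
    obtain ⟨x, ⟨hxD, hxM⟩, hcl⟩ := hcomp.exists_mapClusterPt (f := Filter.atTop) (u := y)
      (by
        rw [Filter.le_principal_iff, Filter.mem_map]
        exact Filter.Eventually.of_forall fun r => ⟨hyD r, (hyM r).of_append.of_append⟩)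
    refine ⟨x, ⟨?_, hxD⟩, hxM⟩
    rw [mem_derivedSet, accPt_iff_nhds]
    intro U hU
    obtain ⟨R, hR⟩ := exists_agree_subset hU
    have hfr := (mapClusterPt_iff_frequently.1 hcl) _
      (eventually_agree x ((Finset.range R).image cell) (Finset.finite_toSet _))
    obtain ⟨r, hr, hRr⟩ := (hfr.and_eventually (Filter.eventually_ge_atTop R)).exists
    have hyx : ∀ i < R, y r (cell i) = x (cell i) := fun i hi =>
      hr _ (by simpa using ⟨i, hi, rfl⟩)
    have hzx : ∀ i < R, z r (cell i) = x (cell i) := fun i hi => by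
      rw [← hyx i hi]
      obtain ⟨a', ha'⟩ := Option.isSome_iff_exists.1 (hcov r i (hi.trans_le hRr))
      rw [(hyM r).of_append _ _ ha', (hzM r).of_append _ _ ha']
    have hyc : y r (c r) = a r := hyM r _ _ (by rw [List.lookup_append, hc r]; simp)
    have hzc : z r (c r) = b r := hzM r _ _ (by rw [List.lookup_append, hc r]; simp)
    by_cases hyr : y r = x
    · refine ⟨z r, ⟨hR _ hzx, hzD r⟩, fun hzr => hab r ?_⟩
      rw [← hyc, ← hzc, hyr, hzr]
    · exact ⟨y r, ⟨hR _ hyx, hyD r⟩, hyr⟩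

/-- By compactness, a pattern occurs in a shift of finite type iff it extends to locally
admissible assignments of arbitrarily long initial segments of the enumerated plane. -/
theorem exists_matches_sft_iff [Inhabited A]
    (F : Set (SymbolicDynamics.FullShift.Pattern A (ℤ × ℤ))) (L : List ((ℤ × ℤ) × A)) :
    (∃ x ∈ {x | ∀ p ∈ F, ¬ Occurs p x}, Matches L x) ↔
      ∀ r : ℕ, ∃ w : List A, w.length = r ∧
        (∀ i < r, L.lookup (cell i) = none ∨ L.lookup (cell i) = w[i]?) ∧
        ∀ i < r, ∀ p ∈ F, ¬ ∀ h ∈ p.support,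
          w[Encodable.encode (cell i + h)]? = some (p.config h) := by
  constructor
  · rintro ⟨x, hx, hL⟩ r
    refine ⟨(List.range r).map fun i => x (cell i), by simp, fun i hi => ?_, fun i hi p hp h => ?_⟩
    · rcases hlk : L.lookup (cell i) with - | a
      · exact Or.inl rfl
      · right
        rw [List.getElem?_map, List.getElem?_range hi, Option.map_some, hL _ _ hlk]
    · refine hx p hp ⟨cell i, fun c hc => ?_⟩
      have := h c hc
      rw [List.getElem?_map, Option.map_eq_some_iff] at this
      obtain ⟨j, hj, hj'⟩ := this
      have hj2 : j = Encodable.encode (cell i + c) := by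
        rw [List.getElem?_eq_some_iff] at hj
        obtain ⟨_, hj⟩ := hj
        simpa using hj.symm
      rw [← hj', hj2, cell_encode]
  · intro h
    choose w hlen hL hF using h
    let y : ℕ → ℤ × ℤ → A := fun r c => ((w r)[Encodable.encode c]?).getD default
    obtain ⟨x, -, hcl⟩ := (isCompact_univ (X := ℤ × ℤ → A)).exists_mapClusterPt
      (f := Filter.atTop) (u := y) (by simp)
    have key : ∀ s : Finset (ℤ × ℤ), ∀ R, ∃ r, R ≤ r ∧ (∀ c ∈ s, Encodable.encode c < r) ∧
        ∀ c ∈ s, (w r)[Encodable.encode c]? = some (x c) := by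
      intro s R
      have hfr := (mapClusterPt_iff_frequently.1 hcl) _
        (eventually_agree x (s : Set (ℤ × ℤ)) s.finite_toSet)
      obtain ⟨r, hr, hRr⟩ := (hfr.and_eventually
        (Filter.eventually_ge_atTop (max R (s.sup Encodable.encode + 1)))).exists
      have hlt : ∀ c ∈ s, Encodable.encode c < r := fun c hc =>
        (Nat.lt_succ_of_le (Finset.le_sup (f := Encodable.encode) hc)).trans_le
          ((le_max_right _ _).trans hRr)
      refine ⟨r, (le_max_left _ _).trans hRr, hlt, fun c hc => ?_⟩
      rw [← hr c hc, List.getElem?_eq_getElem (by rw [hlen]; exact hlt c hc)]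
      simp only [y]
      rw [List.getElem?_eq_getElem (by rw [hlen]; exact hlt c hc), Option.getD_some]
    refine ⟨x, ?_, ?_⟩
    · rintro p hp ⟨g, hg⟩
      obtain ⟨r, hr, -, hw⟩ := key (p.support.image fun h => g + h) (Encodable.encode g + 1)
      refine hF r (Encodable.encode g) hr p hp fun h hh => ?_
      rw [cell_encode, hw _ (Finset.mem_image_of_mem _ hh), hg h hh]
    · intro c a hc
      obtain ⟨r, -, hr, hw⟩ := key {c} 0
      have h1 := hL r _ (hr c (by simp))
      rw [cell_encode, hc, hw c (by simp)] at h1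
      exact (Option.some.inj (h1.resolve_left (by simp))).symm

end Occurrence

/-! ### The occurrence problem of the `k`-th derivative is `Π⁰₂ₖ₊₁` -/

section UpperBound

theorem int_encode_ofNat (m : ℕ) : Encodable.encode (m : ℤ) = 2 * m := rfl

theorem int_encode_negSucc (m : ℕ) : Encodable.encode (Int.negSucc m) = 2 * m + 1 := rfl

theorem primrec_int_natCast : Primrec fun m : ℕ => (m : ℤ) :=
  Primrec.encode_iff.1 (Primrec.nat_double.of_eq fun m => (int_encode_ofNat m).symm)

/-- A function on integers is primitive recursive if it corresponds to a primitive recursive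
function on codes. -/
theorem primrec_int_of_encode {f : ℤ → ℤ} {g : ℕ → ℕ} (hg : Primrec g)
    (h : ∀ z, Encodable.encode (f z) = g (Encodable.encode z)) : Primrec f :=
  Primrec.encode_iff.1 ((hg.comp Primrec.encode).of_eq fun z => (h z).symm)

theorem primrec_int_add_one : Primrec fun z : ℤ => z + 1 := by
  refine primrec_int_of_encode
    (g := fun n => if n % 2 = 0 then n + 2 else if n = 1 then 0 else n - 2) ?_ ?_
  · exact Primrec.ite (Primrec.eq.comp (Primrec.nat_mod.comp Primrec.id (Primrec.const 2))
      (Primrec.const 0)) (Primrec.nat_add.comp Primrec.id (Primrec.const 2))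
      (Primrec.ite (Primrec.eq.comp Primrec.id (Primrec.const 1)) (Primrec.const 0)
        (Primrec.nat_sub.comp Primrec.id (Primrec.const 2)))
  · rintro (m | _ | m)
    · change Encodable.encode (((m + 1 : ℕ)) : ℤ) = _
      rw [Int.ofNat_eq_natCast, int_encode_ofNat, int_encode_ofNat]
      simp [Nat.mul_add]
    · rfl
    · change Encodable.encode (Int.negSucc m) = _
      rw [int_encode_negSucc, int_encode_negSucc, if_neg (by omega), if_neg (by omega)]
      omega

theorem primrec_int_sub_one : Primrec fun z : ℤ => z - 1 := by
  refine primrec_int_of_encode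
    (g := fun n => if n % 2 = 1 then n + 2 else if n = 0 then 1 else n - 2) ?_ ?_
  · exact Primrec.ite (Primrec.eq.comp (Primrec.nat_mod.comp Primrec.id (Primrec.const 2))
      (Primrec.const 1)) (Primrec.nat_add.comp Primrec.id (Primrec.const 2))
      (Primrec.ite (Primrec.eq.comp Primrec.id (Primrec.const 0)) (Primrec.const 1)
        (Primrec.nat_sub.comp Primrec.id (Primrec.const 2)))
  · rintro ((_ | m) | m)
    · rfl
    · have : Int.ofNat (m + 1) - 1 = (m : ℤ) := by simp
      rw [this, Int.ofNat_eq_natCast, int_encode_ofNat, int_encode_ofNat, if_neg (by omega),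
        if_neg (by omega)]
      omega
    · have : Int.negSucc m - 1 = Int.negSucc (m + 1) := rfl
      rw [this, int_encode_negSucc, int_encode_negSucc, if_pos (by omega)]
      omega

theorem primrec_int_add_const (c : ℤ) : Primrec fun z : ℤ => z + c := by
  induction c using Int.induction_on with
  | zero => exact Primrec.id.of_eq fun z => by simp
  | succ i ih => exact (primrec_int_add_one.comp ih).of_eq fun z => by ring
  | pred i ih => exact (primrec_int_sub_one.comp ih).of_eq fun z => by ring

theorem primrec_cell : Primrec cell :=
  Primrec.encode_iff.1 (Primrec.id.of_eq fun i => (Denumerable.encode_ofNat i).symm)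

theorem primrec_cell_add (c : ℤ × ℤ) : Primrec fun i => cell i + c :=
  ((primrec_int_add_const c.1).comp (Primrec.fst.comp primrec_cell)).pair
    ((primrec_int_add_const c.2).comp (Primrec.snd.comp primrec_cell))

/-- All words of length `r` over a finite alphabet that is listed by `s`. -/
def wordsOfLength {A : Type} (s : List A) (r : ℕ) : List (List A) :=
  (fun W => W.flatMap fun w => s.map fun a => a :: w)^[r] [[]]

theorem mem_wordsOfLength {A : Type} {s : List A} (hs : ∀ a, a ∈ s) (r : ℕ) (w : List A) :
    w ∈ wordsOfLength s r ↔ w.length = r := by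
  unfold wordsOfLength
  induction r generalizing w with
  | zero => simp
  | succ r ih =>
    rw [Function.iterate_succ_apply', List.mem_flatMap]
    constructor
    · rintro ⟨v, hv, hw⟩
      obtain ⟨a, -, rfl⟩ := List.mem_map.1 hw
      simpa using (ih v).1 hv
    · intro hw
      obtain - | ⟨a, v⟩ := w
      · simp at hw
      · exact ⟨v, (ih v).2 (by simpa using hw), List.mem_map.2 ⟨a, hs a, rfl⟩⟩

theorem primrec_wordsOfLength {A : Type} [Primcodable A] (s : List A) :
    Primrec (wordsOfLength s) :=
  Primrec.nat_iterate Primrec.id (Primrec.const _) <| Primrec.to₂ <|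
    Primrec.list_flatMap Primrec.snd <| Primrec.to₂ <|
      Primrec.list_map (Primrec.const s) <| Primrec.to₂ <|
        Primrec.list_cons.comp Primrec.snd (Primrec.snd.comp Primrec.fst)

theorem primrecPred_forall_mem_list {α β : Type} [Primcodable α] {p : β → α → Prop} (l : List β)
    (h : ∀ b ∈ l, PrimrecPred (p b)) : PrimrecPred fun a => ∀ b ∈ l, p b a := by
  induction l with
  | nil => exact PrimrecPred.of_eq (Primrec.eq.comp (Primrec.const 0) (Primrec.const 0)) (by simp)
  | cons b l ih =>
    exact ((h b (by simp)).and (ih fun b hb => h b (by simp [hb]))).of_eq fun a => by simp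

theorem primrecPred_forall_mem_finite {α β : Type} [Primcodable α] {p : β → α → Prop} {s : Set β}
    (hs : s.Finite) (h : ∀ b ∈ s, PrimrecPred (p b)) : PrimrecPred fun a => ∀ b ∈ s, p b a :=
  (primrecPred_forall_mem_list hs.toFinset.toList fun b hb => h b (by simpa using hb)).of_eq
    fun a => by simp

theorem primrecRel_forall_lt {β : Type} [Primcodable β] {R : ℕ → β → Prop} (h : PrimrecRel R) :
    PrimrecRel fun n y => ∀ i < n, R i y :=
  (h.forall_mem_list.comp (Primrec.list_range.comp Primrec.fst) Primrec.snd).of_eq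
    fun z => by simp

variable {A : Type} [Inhabited A] [Primcodable A] [Finite A]

local instance : BEq (ℤ × ℤ) := instBEqOfDecidableEq

/-- The case `k = 0`: by `exists_matches_sft_iff`, for each `r` one searches the finitely many words
of length `r`. -/
theorem isPi_exists_matches_sft {X : Set (ℤ × ℤ → A)} (hX : IsSFT X) :
    IsPi 1 (List ((ℤ × ℤ) × A)) fun L => ∃ x ∈ X, Matches L x := by
  obtain ⟨F, hF, rfl⟩ := hX
  let _ : TopologicalSpace A := ⊥
  have : DiscreteTopology A := ⟨rfl⟩
  cases nonempty_fintype A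
  let Y := List A × (List ((ℤ × ℤ) × A) × ℕ)
  -- local admissibility of a word
  have hlook : PrimrecRel fun (i : ℕ) (y : Y) =>
      y.2.1.lookup (cell i) = none ∨ y.2.1.lookup (cell i) = y.1[i]? := by
    have h1 : Primrec fun z : ℕ × Y => z.2.2.1.lookup (cell z.1) :=
      Primrec.listLookup.comp (primrec_cell.comp Primrec.fst)
        (Primrec.fst.comp (Primrec.snd.comp Primrec.snd))
    exact (Primrec.eq.comp h1 (Primrec.const none)).or (Primrec.eq.comp h1
      (Primrec.list_getElem?.comp (Primrec.fst.comp Primrec.snd) Primrec.fst))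
  have hforb : PrimrecRel fun (i : ℕ) (y : Y) => ∀ p ∈ F, ¬ ∀ h ∈ p.support,
      y.1[Encodable.encode (cell i + h)]? = some (p.config h) := by
    refine primrecPred_forall_mem_finite (α := ℕ × Y) (p := fun p z => ¬ ∀ h ∈ p.support,
      z.2.1[Encodable.encode (cell z.1 + h)]? = some (p.config h)) hF fun p _ => ?_
    refine PrimrecPred.not (PrimrecPred.of_eq (primrecPred_forall_mem_list (α := ℕ × Y)
      (p := fun h z => z.2.1[Encodable.encode (cell z.1 + h)]? = some (p.config h))
      p.support.toList fun h _ => ?_) fun z => by simp)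
    exact Primrec.eq.comp (Primrec.list_getElem?.comp (Primrec.fst.comp Primrec.snd)
      (Primrec.encode.comp ((primrec_cell_add h).comp Primrec.fst))) (Primrec.const _)
  have hall : PrimrecRel fun (w : List A) (z : List ((ℤ × ℤ) × A) × ℕ) =>
      (∀ i < z.2, z.1.lookup (cell i) = none ∨ z.1.lookup (cell i) = w[i]?) ∧
        ∀ i < z.2, ∀ p ∈ F, ¬ ∀ h ∈ p.support,
          w[Encodable.encode (cell i + h)]? = some (p.config h) :=
    PrimrecPred.and
      ((primrecRel_forall_lt hlook).comp (Primrec.snd.comp Primrec.snd) (Primrec.id (α := Y)))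
      ((primrecRel_forall_lt hforb).comp (Primrec.snd.comp Primrec.snd) (Primrec.id (α := Y)))
  refine isPi_succ.2 ⟨_, isSigma_zero.2 (PrimrecPred.computablePred
    ((hall.exists_mem_list).comp ((primrec_wordsOfLength (Finset.univ (α := A)).toList).comp
      Primrec.snd) Primrec.id)), fun L => ?_⟩
  rw [exists_matches_sft_iff]
  simp [mem_wordsOfLength]

/-- For a shift of finite type `X`, the patterns of the `k`-th derivative form a `Π⁰₂ₖ₊₁` set. -/
theorem isPi_exists_matches_derivative [TopologicalSpace A] [DiscreteTopology A]
    {X : Set (ℤ × ℤ → A)} (hX : IsSFT X) (k : ℕ) :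
    IsPi (2 * k + 1) (List ((ℤ × ℤ) × A)) fun L =>
      ∃ x ∈ CantorBendixson.iteratedDerivedSet X (k : Ordinal.{0}), Matches L x := by
  induction k with
  | zero => simpa using isPi_exists_matches_sft hX
  | succ k ih =>
    have hcl := CantorBendixson.isClosed_iteratedDerivedSet hX.isClosed (k : Ordinal.{0})
    simp only [Nat.cast_succ, CantorBendixson.iteratedDerivedSet_succ,
      exists_relDerivedSet_matches_iff hcl]
    refine isPi_succ.2 ⟨fun z => ∃ (B : List ((ℤ × ℤ) × A)) (c : ℤ × ℤ) (a b : A),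
      (∀ i < z.2, ((z.1 ++ B).lookup (cell i)).isSome) ∧ (z.1 ++ B).lookup c = none ∧ a ≠ b ∧
      (∃ x ∈ CantorBendixson.iteratedDerivedSet X (k : Ordinal.{0}),
        Matches (z.1 ++ B ++ [(c, a)]) x) ∧
      ∃ x ∈ CantorBendixson.iteratedDerivedSet X (k : Ordinal.{0}),
        Matches (z.1 ++ B ++ [(c, b)]) x, ?_, fun L => Iff.rfl⟩
    let E := List ((ℤ × ℤ) × A) × (ℤ × ℤ) × A × A
    let Z := (List ((ℤ × ℤ) × A) × ℕ) × ℕ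
    -- natural numbers present all choices of `B`, `c`, `a`, `b`
    let f : ℕ → E := fun m => (Encodable.decode (α := E) m).getD default
    have hf : Computable fun z : Z => f z.2 :=
      (Primrec.option_getD.comp Primrec.decode (Primrec.const _)).to_comp.comp Computable.snd
    have hfsurj : Function.Surjective f := fun e => ⟨Encodable.encode e, by simp [f]⟩
    have hB : Computable fun z : Z => z.1.1 ++ (f z.2).1 :=
      Primrec.list_append.to_comp.comp (Computable.fst.comp Computable.fst)
        (Computable.fst.comp hf)
    have hc : Computable fun z : Z => (f z.2).2.1 := Computable.fst.comp (Computable.snd.comp hf)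
    have ha : Computable fun z : Z => (f z.2).2.2.1 :=
      Computable.fst.comp (Computable.snd.comp (Computable.snd.comp hf))
    have hb : Computable fun z : Z => (f z.2).2.2.2 :=
      Computable.snd.comp (Computable.snd.comp (Computable.snd.comp hf))
    have hext : ∀ {g : Z → A}, Computable g → Computable fun z : Z =>
        z.1.1 ++ (f z.2).1 ++ [((f z.2).2.1, g z)] := fun hg =>
      Primrec.list_append.to_comp.comp hB
        (Primrec.list_cons.to_comp.comp (hc.pair hg) (Computable.const []))
    have h1 : PrimrecRel fun (i : ℕ) (M : List ((ℤ × ℤ) × A)) => (M.lookup (cell i)).isSome :=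
      Primrec.eq.comp (Primrec.option_isSome.comp (Primrec.listLookup.comp
        (primrec_cell.comp Primrec.fst) Primrec.snd)) (Primrec.const true)
    have hcov : ComputablePred fun z : Z =>
        ∀ i < z.1.2, ((z.1.1 ++ (f z.2).1).lookup (cell i)).isSome :=
      ComputablePred.comp' (PrimrecPred.computablePred (primrecRel_forall_lt h1))
        ((Computable.snd.comp Computable.fst).pair hB)
    have hnone : ComputablePred fun z : Z => (z.1.1 ++ (f z.2).1).lookup (f z.2).2.1 = none :=
      ComputablePred.comp' (PrimrecPred.computablePred Primrec.eq)
        ((Primrec.listLookup.to_comp.comp hc hB).pair (Computable.const none))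
    have hne : ComputablePred fun z : Z => (f z.2).2.2.1 ≠ (f z.2).2.2.2 :=
      ComputablePred.not (ComputablePred.comp' (PrimrecPred.computablePred Primrec.eq)
        (ha.pair hb))
    refine IsSigma.of_eq (((hcov.isPi _).and ((hnone.isPi _).and ((hne.isPi _).and
      ((ih.comp (hext ha)).and (ih.comp (hext hb)))))).sigma_succ.exists) fun z => ?_
    constructor
    · rintro ⟨m, h⟩
      exact ⟨(f m).1, (f m).2.1, (f m).2.2.1, (f m).2.2.2, h⟩
    · rintro ⟨B, c, a, b, h⟩
      obtain ⟨m, hm⟩ := hfsurj (B, c, a, b)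
      refine ⟨m, ?_⟩
      simp only [hm]
      exact h

end UpperBound

/-! ### Local rules and cuts of the line -/

section LocalRules

/-- A configuration space that is defined by one rule on a finite window is of finite type. -/
theorem isSFT_of_local {A G : Type*} [Inhabited A] [Finite A] [AddMonoid G]
    (W : Finset G) (P : (G → A) → Prop) (hP : ∀ u v, (∀ h ∈ W, u h = v h) → P u → P v) :
    IsSFT {x : G → A | ∀ g, P fun h => x (g + h)} := by
  classical
  refine ⟨{p | p.support = W ∧ ¬ P p.config}, ?_, ?_⟩
  · let f : (W → A) → SymbolicDynamics.FullShift.Pattern A G := fun u =>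
      { config := fun h => if hh : h ∈ W then u ⟨h, hh⟩ else default
        support := W
        condition := fun h hh => by simp [hh] }
    refine (Set.finite_range f).subset ?_
    rintro ⟨c, s, hcond⟩ ⟨rfl, -⟩
    refine ⟨fun h => c h, ?_⟩
    simp only [f, SymbolicDynamics.FullShift.Pattern.mk.injEq, and_true]
    funext h
    by_cases hh : h ∈ s
    · simp [hh]
    · simp [hh, hcond h hh]
  · ext x
    constructor
    · rintro hx p ⟨hs, hp⟩ ⟨g, hg⟩
      exact hp (hP _ _ (fun h hh => hg h (hs ▸ hh)) (hx g))
    · intro hx g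
      by_contra hg
      refine hx ⟨fun h => if h ∈ W then x (g + h) else default, W, fun h hh => by simp [hh]⟩
        ⟨rfl, fun hp => hg (hP _ _ (fun h hh => by simp [hh]) hp)⟩ ⟨g, fun h hh => ?_⟩
      have hh' : h ∈ W := hh
      simp [hh']

/-- `s` is of the form `… - - 0 + + …`, or constantly `-`, or constantly `+`: the signs of the
differences `i - p` for a point `p` of the line extended by `±∞`. -/
def IsCut (s : ℤ → SignType) : Prop :=
  ∀ i, (s i = -1 ∧ s (i + 1) ≠ 1) ∨ (s i ≠ -1 ∧ s (i + 1) = 1)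

/-- The signs of the differences `i - p`. -/
noncomputable def cut (p : ℤ) (i : ℤ) : SignType := SignType.sign (i - p)

theorem cut_self (p : ℤ) : cut p p = 0 := by simp [cut]

theorem cut_eq_zero {p i : ℤ} : cut p i = 0 ↔ i = p := by
  rw [cut, sign_eq_zero_iff, sub_eq_zero]

theorem cut_of_lt {p i : ℤ} (h : i < p) : cut p i = -1 := by
  rw [cut, sign_eq_neg_one_iff]; omega

theorem cut_of_gt {p i : ℤ} (h : p < i) : cut p i = 1 := by
  rw [cut, sign_eq_one_iff]; omega

theorem isCut_cut (p : ℤ) : IsCut (cut p) := by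
  intro i
  rcases lt_trichotomy i p with h | rfl | h
  · left
    refine ⟨cut_of_lt h, ?_⟩
    rcases (show i + 1 < p ∨ i + 1 = p by omega) with h' | h'
    · rw [cut_of_lt h']; decide
    · rw [h', cut_self]; decide
  · right
    rw [cut_self, cut_of_gt (by omega)]
    decide
  · right
    rw [cut_of_gt h, cut_of_gt (by omega)]
    decide

theorem IsCut.eq_one_of_lt {s : ℤ → SignType} (hs : IsCut s) {i j : ℤ} (h : s i ≠ -1)
    (hij : i < j) : s j = 1 := by
  induction j, (show i + 1 ≤ j from hij) using Int.leInduction with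
  | base => exact ((hs i).resolve_left fun h' => h h'.1).2
  | succ j hj ih =>
    have := ih (by omega)
    exact ((hs j).resolve_left fun h' => by simp [this] at h').2

theorem IsCut.eq_neg_one_of_lt {s : ℤ → SignType} (hs : IsCut s) {i j : ℤ} (h : s i ≠ 1)
    (hij : j < i) : s j = -1 := by
  by_contra hj
  exact h (hs.eq_one_of_lt hj hij)

theorem IsCut.eq_cut {s : ℤ → SignType} (hs : IsCut s) {p : ℤ} (h : s p = 0) : s = cut p := by
  funext i
  rcases lt_trichotomy i p with hi | rfl | hi
  · rw [cut_of_lt hi, hs.eq_neg_one_of_lt (by simp [h]) hi]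
  · rw [h, cut_self]
  · rw [cut_of_gt hi, hs.eq_one_of_lt (by simp [h]) hi]

/-- A cut is given by a point of the line extended by `±∞`. -/
theorem IsCut.trichotomy {s : ℤ → SignType} (hs : IsCut s) :
    (∃ p, s = cut p) ∨ s = (fun _ => 1) ∨ s = fun _ => -1 := by
  by_cases h0 : ∃ p, s p = 0
  · exact Or.inl ⟨_, hs.eq_cut h0.choose_spec⟩
  push Not at h0
  right
  have h1 : ∀ i, s i = 1 ∨ s i = -1 := fun i => by
    have := h0 i
    revert this
    cases s i <;> decide
  rcases h1 0 with h | h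
  · left
    funext i
    rcases lt_trichotomy i 0 with hi | rfl | hi
    · refine (h1 i).resolve_right fun hi' => ?_
      -- the least index with sign `+` would have no admissible left neighbour
      have : ∀ n : ℕ, s (i + n) = -1 := by
        intro n
        induction n with
        | zero => simpa using hi'
        | succ n ih =>
          rw [Nat.cast_succ, ← add_assoc]
          exact (h1 _).resolve_left ((hs (i + n)).resolve_right fun h' => h'.1 ih).2
      have h2 := this (-i).toNat
      rw [show i + ((-i).toNat : ℤ) = 0 by omega, h] at h2
      exact absurd h2 (by decide)
    · exact h
    · exact hs.eq_one_of_lt (by simp [h]) hi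
  · right
    funext i
    rcases lt_trichotomy i 0 with hi | rfl | hi
    · exact hs.eq_neg_one_of_lt (by rw [h]; decide) hi
    · exact h
    · refine (h1 i).resolve_left fun hi' => ?_
      have : ∀ n : ℕ, s n = -1 := by
        intro n
        induction n with
        | zero => simpa using h
        | succ n ih =>
          rw [Nat.cast_succ]
          exact (h1 _).resolve_left ((hs n).resolve_right fun h' => h'.1 ih).2
      have h2 := this i.toNat
      rw [Int.toNat_of_nonneg hi.le, hi'] at h2
      exact absurd h2 (by decide)

theorem countable_isCut : {s | IsCut s}.Countable := by
  refine ((Set.countable_range cut).union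
    (Set.countable_singleton (fun _ => 1))).union (Set.countable_singleton (fun _ => -1)) |>.mono ?_
  intro s hs
  rcases IsCut.trichotomy hs with ⟨p, rfl⟩ | rfl | rfl
  · exact Or.inl (Or.inl ⟨p, rfl⟩)
  · exact Or.inl (Or.inr rfl)
  · exact Or.inr rfl

end LocalRules

/-! ### Pebble machines and their space-time diagrams -/

section PebbleMachine

/-- The head layer of a cell: the cell lies to the left or to the right of the head, or carries
the head in state `w`. -/
inductive HeadMark (W : Type) : Type
  | left : HeadMark W
  | right : HeadMark W
  | here (w : W) : HeadMark W

/-- The position of a cell relative to the head, as a sign. -/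
def HeadMark.sign {W : Type} : HeadMark W → SignType
  | left => -1
  | right => 1
  | here _ => 0

/-- A symbol records the position of the cell relative to each pebble of `ι`, and relative to the
head. -/
abbrev Symbol (ι W : Type) : Type := (ι → SignType) × HeadMark W

/-- The row with layers `s` in which the head is at position `h` in state `w`. -/
def headRow {ι W : Type} (s : ι → ℤ → SignType) (h : ℤ) (w : W) (i : ℤ) : Symbol ι W :=
  (fun l => s l i, if i < h then .left else if i = h then .here w else .right)

/-- Each layer of the row is a cut of the line. -/
def ValidRow {ι W : Type} (r : ℤ → Symbol ι W) : Prop :=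
  (∀ l, IsCut fun i => (r i).1 l) ∧ IsCut fun i => (r i).2.sign

/-- The actions of a pebble machine when its head has arrived at its goal: move the pebble of that
cell, together with the head, by one cell to the right or left; or check the position of the cell
relative to another pebble. -/
inductive Action (κ : Type) : Type
  | push (up : Bool) : Action κ
  | check (a : κ) (S : Set SignType) : Action κ

/-- The displacement of a push. -/
def shiftBy (up : Bool) : ℤ := if up then 1 else -1

/-- A pebble machine with pebbles `Option κ` and states `W`. In state `w` the head walks from the
pebble `src w` to the pebble `dst w`, where one of the rules of state `w` is applied. The pebble
`none` is never a goal. -/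
structure PebbleMachine (κ W : Type) where
  /-- The pebble from which the head comes. -/
  src : W → Option κ
  /-- The pebble to which the head goes. -/
  dst : W → κ
  /-- `rule w a w'` says that the action `a` may lead from state `w` to state `w'`. -/
  rule : W → Action κ → W → Prop
  /-- A new walk starts where the previous one ended. -/
  src_eq : ∀ {w a w'}, rule w a w' → src w' = some (dst w)

variable {κ W : Type} [DecidableEq κ]

/-- One step of a pebble machine, as a relation between consecutive rows. A walk is possible only
between the source and the goal, which makes walks reversible. -/
inductive PebbleMachine.Step (M : PebbleMachine κ W) :
    (ℤ → Symbol (Option κ) W) → (ℤ → Symbol (Option κ) W) → Prop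
  | idle (r : ℤ → Symbol (Option κ) W) (h : ∀ i, (r i).2.sign ≠ 0) : Step M r r
  | walk (s : Option κ → ℤ → SignType) (h : ℤ) (w : W) (h1 : s (some (M.dst w)) h ≠ 0)
      (h2 : s (M.src w) h ≠ s (some (M.dst w)) h) :
      Step M (headRow s h w) (headRow s (h - (s (some (M.dst w)) h : ℤ)) w)
  | check (s : Option κ → ℤ → SignType) (h : ℤ) (w : W) (a : κ) (S : Set SignType) (w' : W)
      (h1 : s (some (M.dst w)) h = 0) (h2 : M.rule w (.check a S) w') (h3 : s (some a) h ∈ S) :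
      Step M (headRow s h w) (headRow s h w')
  | push (s : Option κ → ℤ → SignType) (h : ℤ) (w : W) (b : Bool) (w' : W)
      (h1 : s (some (M.dst w)) h = 0) (h2 : M.rule w (.push b) w') :
      Step M (headRow s h w)
        (headRow (Function.update s (some (M.dst w)) (cut (h + shiftBy b))) (h + shiftBy b) w')

section Rows

variable {ι : Type}

theorem headRow_snd_eq_here {s : ι → ℤ → SignType} {h i : ℤ} {w w' : W} :
    (headRow s h w i).2 = .here w' ↔ i = h ∧ w = w' := by
  unfold headRow
  rcases lt_trichotomy i h with hi | rfl | hi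
  · simp [hi, hi.ne]
  · simp
  · simp [hi.not_gt, hi.ne']

theorem sign_headRow (s : ι → ℤ → SignType) (h i : ℤ) (w : W) :
    (headRow s h w i).2.sign = cut h i := by
  unfold headRow
  rcases lt_trichotomy i h with hi | rfl | hi
  · simp [hi, cut_of_lt, HeadMark.sign]
  · simp [cut_self, HeadMark.sign]
  · simp [hi.not_gt, hi.ne', cut_of_gt hi, HeadMark.sign]

theorem headRow_inj {s s' : ι → ℤ → SignType} {h h' : ℤ} {w w' : W} :
    headRow s h w = headRow s' h' w' ↔ s = s' ∧ h = h' ∧ w = w' := by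
  constructor
  · intro H
    have h1 : h = h' ∧ w' = w := by
      have := headRow_snd_eq_here.1 ((congrArg Prod.snd (congrFun H h)).symm.trans
        (headRow_snd_eq_here.2 ⟨rfl, rfl⟩))
      exact this
    refine ⟨?_, h1.1, h1.2.symm⟩
    funext l i
    exact congrFun (congrArg Prod.fst (congrFun H i)) l
  · rintro ⟨rfl, rfl, rfl⟩
    rfl

theorem HeadMark.sign_eq_zero {m : HeadMark W} : m.sign = 0 ↔ ∃ w, m = .here w := by
  cases m <;> simp [HeadMark.sign]

theorem ValidRow.eq_headRow {r : ℤ → Symbol ι W} (hr : ValidRow r) {h : ℤ} {w : W}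
    (hw : (r h).2 = .here w) : r = headRow (fun l i => (r i).1 l) h w := by
  funext i
  refine Prod.ext rfl ?_
  have h0 := hr.2.eq_cut (p := h) (by simp [hw, HeadMark.sign])
  have hi := congrFun h0 i
  rcases lt_trichotomy i h with hlt | rfl | hlt
  · rw [cut_of_lt hlt] at hi
    simp only [headRow, hlt, if_true]
    revert hi
    cases (r i).2 <;> simp [HeadMark.sign]
  · simp [headRow, hw]
  · rw [cut_of_gt hlt] at hi
    simp only [headRow, hlt.not_gt, hlt.ne', if_false]
    revert hi
    cases (r i).2 <;> simp [HeadMark.sign]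

theorem validRow_headRow {s : ι → ℤ → SignType} {h : ℤ} {w : W} :
    ValidRow (headRow s h w) ↔ ∀ l, IsCut (s l) := by
  constructor
  · exact fun H => H.1
  · intro H
    refine ⟨H, ?_⟩
    simp only [sign_headRow]
    exact isCut_cut h

theorem headRow_congr {s s' : ι → ℤ → SignType} {h h' i i' : ℤ} {w : W}
    (hs : ∀ l, s l i = s' l i') (hh : h - i = h' - i') :
    headRow s h w i = headRow s' h' w i' := by
  have h1 : i < h ↔ i' < h' := by omega
  have h2 : i = h ↔ i' = h' := by omega
  simp [headRow, hs, h1, h2]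

theorem ValidRow.cases_head {r : ℤ → Symbol ι W} (hr : ValidRow r) :
    (∃ s h w, r = headRow s h w ∧ ∀ l, IsCut (s l)) ∨
      (∀ i, (r i).2 = .left) ∨ ∀ i, (r i).2 = .right := by
  rcases hr.2.trichotomy with ⟨p, hp⟩ | hp | hp
  · left
    have := congrFun hp p
    rw [cut_self] at this
    obtain ⟨w, hw⟩ := HeadMark.sign_eq_zero.1 this
    exact ⟨_, p, w, hr.eq_headRow hw, hr.1⟩
  · right; right
    intro i
    have := congrFun hp i
    revert this
    cases (r i).2 <;> simp [HeadMark.sign]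
  · right; left
    intro i
    have := congrFun hp i
    revert this
    cases (r i).2 <;> simp [HeadMark.sign]

theorem countable_validRow [Finite ι] [Countable W] :
    {r : ℤ → Symbol ι W | ValidRow r}.Countable := by
  have : Countable {s | IsCut s} := countable_isCut.to_subtype
  let C := ι → {s | IsCut s}
  refine (((Set.countable_range fun p : C × ℤ × W =>
    headRow (fun l i => (p.1 l).1 i) p.2.1 p.2.2).union
    (Set.countable_range fun (p : C) (i : ℤ) => ((fun l => (p l).1 i, HeadMark.left) :
      Symbol ι W))).union (Set.countable_range fun (p : C) (i : ℤ) =>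
        ((fun l => (p l).1 i, HeadMark.right) : Symbol ι W))).mono ?_
  intro r hr
  rcases ValidRow.cases_head hr with ⟨s, h, w, rfl, hs⟩ | h | h
  · exact Or.inl (Or.inl ⟨(fun l => ⟨s l, hs l⟩, h, w), rfl⟩)
  · exact Or.inl (Or.inr ⟨fun l => ⟨_, hr.1 l⟩, funext fun i => Prod.ext rfl (h i).symm⟩)
  · exact Or.inr ⟨fun l => ⟨_, hr.1 l⟩, funext fun i => Prod.ext rfl (h i).symm⟩

end Rows

end PebbleMachine

section PebbleMachine

variable {κ W : Type} [DecidableEq κ]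

theorem headRow_congr_of_ne {ι : Type} {s s' : ι → ℤ → SignType} {h h' i : ℤ} {w w' : W}
    (hs : ∀ l, s l i = s' l i) (h1 : i < h ↔ i < h') (h2 : i ≠ h) (h3 : i ≠ h') :
    headRow s h w i = headRow s' h' w' i := by
  simp [headRow, hs, h1, h2, h3]

theorem SignType.coe_int_of_ne_zero {a : SignType} (h : a ≠ 0) :
    (a = 1 ∧ (a : ℤ) = 1) ∨ (a = -1 ∧ (a : ℤ) = -1) := by
  cases a
  · exact absurd rfl h
  · exact Or.inr ⟨rfl, rfl⟩
  · exact Or.inl ⟨rfl, rfl⟩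

theorem shiftBy_eq (b : Bool) : shiftBy b = 1 ∨ shiftBy b = -1 := by
  cases b <;> simp [shiftBy]

namespace PebbleMachine

variable {M : PebbleMachine κ W}

/-- A step changes the row only next to the head. -/
theorem Step.eq_of_far {r r' : ℤ → Symbol (Option κ) W} (h : M.Step r r') (hr : ValidRow r) {i : ℤ}
    (hi : ∀ k, i - 1 ≤ k → k ≤ i + 1 → (r k).2.sign ≠ 0) : r' i = r i := by
  have hfar : ∀ {s : Option κ → ℤ → SignType} {h : ℤ} {w : W},
      (∀ k, i - 1 ≤ k → k ≤ i + 1 → (headRow s h w k).2.sign ≠ 0) → h < i - 1 ∨ i + 1 < h := by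
    intro s h w H
    by_contra hcon
    exact H h (by omega) (by omega) (by rw [sign_headRow, cut_self])
  cases h with
  | idle _ _ => rfl
  | walk s h w h1 h2 =>
    have := hfar hi
    rcases SignType.coe_int_of_ne_zero h1 with ⟨-, h3⟩ | ⟨-, h3⟩ <;> rw [h3] <;>
      exact headRow_congr_of_ne (fun _ => rfl) (by omega) (by omega) (by omega)
  | check s h w a S w' h1 h2 h3 =>
    have := hfar hi
    exact headRow_congr_of_ne (fun _ => rfl) Iff.rfl (by omega) (by omega)
  | push s h w b w' h1 h2 =>
    have hlt := hfar hi
    have hb := shiftBy_eq b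
    refine headRow_congr_of_ne (fun l => ?_) (by omega) (by omega) (by omega)
    by_cases hl : l = some (M.dst w)
    · subst hl
      rw [Function.update_self, (validRow_headRow.1 hr _).eq_cut h1]
      rcases hlt with hlt | hlt
      · rw [cut_of_gt (by omega), cut_of_gt (by omega)]
      · rw [cut_of_lt (by omega), cut_of_lt (by omega)]
    · rw [Function.update_of_ne hl]

theorem Step.validRow {r r' : ℤ → Symbol (Option κ) W} (h : M.Step r r') (hr : ValidRow r) :
    ValidRow r' := by
  cases h with
  | idle _ _ => exact hr
  | walk s h w h1 h2 => exact validRow_headRow.2 (validRow_headRow.1 hr)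
  | check s h w a S w' h1 h2 h3 => exact validRow_headRow.2 (validRow_headRow.1 hr)
  | push s h w b w' h1 h2 =>
    refine validRow_headRow.2 fun l => ?_
    by_cases hl : l = some (M.dst w)
    · subst hl
      rw [Function.update_self]
      exact isCut_cut _
    · rw [Function.update_of_ne hl]
      exact validRow_headRow.1 hr l

/-- The window rule: three adjacent cells `u` and the cells `v` to the north of them occur in
some pair of valid rows that are related by a step. -/
def LocalStep (M : PebbleMachine κ W) (u v : ℤ → Symbol (Option κ) W) : Prop :=
  ∃ (i : ℤ) (r r' : ℤ → Symbol (Option κ) W), ValidRow r ∧ M.Step r r' ∧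
    ∀ k, -1 ≤ k → k ≤ 1 → u k = r (i + k) ∧ v k = r' (i + k)

/-- Being a cut is a condition on adjacent cells, so it may be checked in windows. -/
theorem validRow_of_localStep {r r' : ℤ → Symbol (Option κ) W}
    (h : ∀ i, M.LocalStep (fun k => r (i + k)) fun k => r' (i + k)) : ValidRow r := by
  constructor
  · intro l i
    obtain ⟨j, q, q', hq, -, hu⟩ := h i
    have h0 := (hu 0 (by omega) (by omega)).1
    have h1 := (hu 1 (by omega) (by omega)).1
    simp only [add_zero] at h0
    beta_reduce at h1 ⊢
    rw [h0, h1]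
    exact hq.1 l j
  · intro i
    obtain ⟨j, q, q', hq, -, hu⟩ := h i
    have h0 := (hu 0 (by omega) (by omega)).1
    have h1 := (hu 1 (by omega) (by omega)).1
    simp only [add_zero] at h0
    beta_reduce at h1 ⊢
    rw [h0, h1]
    exact hq.2 j

/-- If the window rule holds at every cell, then the upper row arises from the lower one by a step: the
window around the head shows the step, and the other windows show that nothing else changes. -/
theorem step_of_localStep {r r' : ℤ → Symbol (Option κ) W}
    (h : ∀ i, M.LocalStep (fun k => r (i + k)) fun k => r' (i + k)) : M.Step r r' := by
  have hr := validRow_of_localStep h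
  -- away from the head nothing changes
  have hfar : ∀ i, (∀ k, i - 1 ≤ k → k ≤ i + 1 → (r k).2.sign ≠ 0) → r' i = r i := by
    intro i hi
    obtain ⟨j, q, q', hq, hs, hu⟩ := h i
    have h0 := hu 0 (by omega) (by omega)
    simp only [add_zero] at h0
    rw [h0.1, h0.2]
    refine hs.eq_of_far hq fun k hk1 hk2 => ?_
    have := hi (i + (k - j)) (by omega) (by omega)
    have hk := (hu (k - j) (by omega) (by omega)).1
    beta_reduce at hk
    rw [hk] at this
    simpa using this
  rcases hr.cases_head with ⟨s, p, w, rfl, hs⟩ | hn | hn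
  · -- it suffices to find a step whose result agrees with `r'` near the head
    suffices H : ∃ t, M.Step (headRow s p w) t ∧
        ∀ k, -1 ≤ k → k ≤ 1 → r' (p + k) = t (p + k) by
      obtain ⟨t, ht, hk⟩ := H
      convert ht
      funext i
      by_cases hi : -1 ≤ i - p ∧ i - p ≤ 1
      · simpa using hk (i - p) hi.1 hi.2
      · have : ∀ k, i - 1 ≤ k → k ≤ i + 1 → (headRow s p w k).2.sign ≠ 0 := by
          intro k hk1 hk2
          rw [sign_headRow, ne_eq, cut_eq_zero]
          omega
        rw [hfar i this, ht.eq_of_far hr this]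
    obtain ⟨j, q, q', hq, hst, hu⟩ := h p
    have hsnd : (headRow s p w p).2 = .here w := headRow_snd_eq_here.2 ⟨rfl, rfl⟩
    have h0 := (hu 0 (by omega) (by omega)).1
    simp only [add_zero] at h0
    have hqj : (q j).2 = .here w := by rw [← h0, hsnd]
    have hlay : ∀ k, -1 ≤ k → k ≤ 1 → ∀ l, (q (j + k)).1 l = s l (p + k) := by
      intro k hk1 hk2 l
      rw [← (hu k hk1 hk2).1]
      rfl
    have hlay0 : ∀ l, (q j).1 l = s l p := by simpa using hlay 0 (by omega) (by omega)
    cases hst with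
    | idle _ hno =>
      exact absurd (by rw [hqj]; rfl) (hno j)
    | walk s' h' w' h1 h2 =>
      obtain ⟨rfl, rfl⟩ := headRow_snd_eq_here.1 hqj
      have e := hlay0
      simp only [headRow] at e
      rw [e] at h1 h2
      rw [e] at h2
      refine ⟨_, .walk s p w' h1 h2, fun k hk1 hk2 => ?_⟩
      refine (hu k hk1 hk2).2.trans ?_
      exact headRow_congr (hlay k hk1 hk2) (by rw [e]; ring)
    | check s' h' w' a S w'' h1 h2 h3 =>
      obtain ⟨rfl, rfl⟩ := headRow_snd_eq_here.1 hqj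
      have e := hlay0
      simp only [headRow] at e
      rw [e] at h1 h3
      refine ⟨_, .check s p w' a S w'' h1 h2 h3, fun k hk1 hk2 => ?_⟩
      refine (hu k hk1 hk2).2.trans ?_
      exact headRow_congr (hlay k hk1 hk2) (by ring)
    | push s' h' w' b w'' h1 h2 =>
      obtain ⟨rfl, rfl⟩ := headRow_snd_eq_here.1 hqj
      have e := hlay0
      simp only [headRow] at e
      rw [e] at h1
      refine ⟨_, .push s p w' b w'' h1 h2, fun k hk1 hk2 => ?_⟩
      refine (hu k hk1 hk2).2.trans ?_
      refine headRow_congr (fun l => ?_) (by ring)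
      by_cases hl : l = some (M.dst w')
      · subst hl
        rw [Function.update_self, Function.update_self, cut, cut]
        congr 1
        ring
      · rw [Function.update_of_ne hl, Function.update_of_ne hl]
        exact hlay k hk1 hk2 l
  · have : r' = r := funext fun i => hfar i fun k _ _ => by simp [hn, HeadMark.sign]
    rw [this]
    exact .idle r fun i => by simp [hn, HeadMark.sign]
  · have : r' = r := funext fun i => hfar i fun k _ _ => by simp [hn, HeadMark.sign]
    rw [this]
    exact .idle r fun i => by simp [hn, HeadMark.sign]

/-- The `j`-th row of a configuration, read through the coding `φ` of symbols. -/
def decodedRow {A ι : Type} (φ : A → Symbol ι W) (x : ℤ × ℤ → A) (j : ℤ) : ℤ → Symbol ι W :=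
  fun i => φ (x (i, j))

/-- The space-time diagrams of a pebble machine, time running northwards. -/
def diagrams {A : Type} (M : PebbleMachine κ W) (φ : A → Symbol (Option κ) W) :
    Set (ℤ × ℤ → A) :=
  {x | ∀ j, ValidRow (decodedRow φ x j) ∧ M.Step (decodedRow φ x j) (decodedRow φ x (j + 1))}

theorem isSFT_diagrams {A : Type} [Finite A] [Inhabited A] (M : PebbleMachine κ W)
    (φ : A → Symbol (Option κ) W) : IsSFT (M.diagrams φ) := by
  have key := isSFT_of_local (A := A) (G := ℤ × ℤ) (Finset.Icc (-1) 1 ×ˢ {0, 1})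
    (fun u => M.LocalStep (fun k => φ (u (k, 0))) fun k => φ (u (k, 1))) (by
      rintro u v huv ⟨i, r, r', hr, hs, hk⟩
      refine ⟨i, r, r', hr, hs, fun k hk1 hk2 => ?_⟩
      beta_reduce
      rw [← huv (k, 0) (by simp [hk1, hk2]), ← huv (k, 1) (by simp [hk1, hk2])]
      exact hk k hk1 hk2)
  convert key using 1
  ext x
  constructor
  · rintro hx ⟨i, j⟩
    refine ⟨i, decodedRow φ x j, decodedRow φ x (j + 1), (hx j).1, (hx j).2, fun k _ _ => ?_⟩
    simp [decodedRow]
  · intro hx j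
    have : ∀ i, M.LocalStep (fun k => decodedRow φ x j (i + k))
        fun k => decodedRow φ x (j + 1) (i + k) := fun i => by
      simpa [decodedRow] using hx (i, j)
    exact ⟨validRow_of_localStep this, step_of_localStep this⟩

theorem hasPProperty_diagrams {A : Type} [Finite A] [Inhabited A] [Finite κ] [Finite W]
    (M : PebbleMachine κ W) {φ : A → Symbol (Option κ) W} (hφ : Function.Injective φ) :
    HasPProperty (M.diagrams φ) := by
  refine ⟨{y | ValidRow fun i => φ (y i)}, ?_, ?_, ?_⟩
  · have key := isSFT_of_local (A := A) (G := ℤ) {0, 1}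
      (fun u => (∀ l, ((φ (u 0)).1 l = -1 ∧ (φ (u 1)).1 l ≠ 1) ∨
        ((φ (u 0)).1 l ≠ -1 ∧ (φ (u 1)).1 l = 1)) ∧
        (((φ (u 0)).2.sign = -1 ∧ (φ (u 1)).2.sign ≠ 1) ∨
          ((φ (u 0)).2.sign ≠ -1 ∧ (φ (u 1)).2.sign = 1))) (by
      rintro u v huv h
      rw [← huv 0 (by simp), ← huv 1 (by simp)]
      exact h)
    convert key using 1
    ext y
    simp only [Set.mem_ofPred_eq, ValidRow, IsCut, add_zero]
    exact ⟨fun h g => ⟨fun l => h.1 l g, h.2 g⟩, fun h => ⟨fun l g => (h g).1 l, fun g => (h g).2⟩⟩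
  · have : Countable W := Finite.to_countable
    refine Set.Countable.preimage_of_injOn (s := {r : ℤ → Symbol (Option κ) W | ValidRow r})
      (f := fun (y : ℤ → A) i => φ (y i)) countable_validRow ?_
    intro y _ z _ h
    funext i
    exact hφ (congrFun h i)
  · rintro y ⟨x, hx, rfl⟩
    exact (hx 0).1

/-- Reversibility: the action and its outcome determine the rule by which a state was entered. -/
def Reversible (M : PebbleMachine κ W) : Prop :=
  ∀ ⦃w₁ a₁ w₂ a₂ w'⦄, M.rule w₁ a₁ w' → M.rule w₂ a₂ w' → (w₁ = w₂ ∧ a₁ = a₂) ∨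
    ∃ c S₁ S₂, a₁ = .check c S₁ ∧ a₂ = .check c S₂ ∧ Disjoint S₁ S₂

theorem Step.eq_headRow {s : Option κ → ℤ → SignType} {h : ℤ} {w : W}
    {r : ℤ → Symbol (Option κ) W} (hst : M.Step r (headRow s h w)) :
    ∃ s' h' w', r = headRow s' h' w' := by
  generalize hr' : headRow s h w = r' at hst
  cases hst with
  | idle _ hno =>
    subst hr'
    exact absurd (by rw [sign_headRow, cut_self]) (hno h)
  | walk s' h' w' _ _ => exact ⟨_, _, _, rfl⟩
  | check s' h' w' _ _ _ _ _ _ => exact ⟨_, _, _, rfl⟩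
  | push s' h' w' _ _ _ _ => exact ⟨_, _, _, rfl⟩

/-- A configuration has moved by walking iff its head is not at the source of its walk, and then
it came from the side of the source. -/
theorem Step.walk_iff {s : Option κ → ℤ → SignType} {h : ℤ} {w : W}
    (hs : ∀ l, IsCut (s l)) {s₁ : Option κ → ℤ → SignType} {h₁ : ℤ} {w₁ : W}
    (hs₁ : ∀ l, IsCut (s₁ l)) (hst : M.Step (headRow s₁ h₁ w₁) (headRow s h w)) :
    (s (M.src w) h ≠ 0 ∧ s₁ = s ∧ w₁ = w ∧ h₁ = h - (s (M.src w) h : ℤ) ∧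
      s (some (M.dst w)) h₁ = - s (M.src w) h) ∨
    (s (M.src w) h = 0 ∧ s₁ (some (M.dst w₁)) h₁ = 0 ∧ ((∃ a S, M.rule w₁ (.check a S) w ∧
      s (some a) h ∈ S ∧ s₁ = s ∧ h₁ = h) ∨ ∃ b, M.rule w₁ (.push b) w ∧ h₁ = h - shiftBy b ∧
      s = Function.update s₁ (some (M.dst w₁)) (cut h))) := by
  generalize hr : headRow s₁ h₁ w₁ = r at hst
  generalize hr' : headRow s h w = r' at hst
  cases hst with
  | idle _ hno =>
    subst hr
    exact absurd (by rw [sign_headRow, cut_self]) (hno h₁)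
  | walk s₂ h₂ w₂ hd hne =>
    left
    obtain ⟨rfl, rfl, rfl⟩ := headRow_inj.1 hr
    obtain ⟨rfl, rfl, rfl⟩ := headRow_inj.1 hr'
    have hsrc := hs (M.src w)
    rcases SignType.coe_int_of_ne_zero hd with ⟨e1, e2⟩ | ⟨e1, e2⟩
    · rw [e1] at hne
      have h3 := hsrc.eq_neg_one_of_lt hne (show h₁ - 1 < h₁ by omega)
      rw [e2, h3, e1]
      exact ⟨by decide, rfl, rfl, by norm_num, by decide⟩
    · rw [e1] at hne
      have h3 := hsrc.eq_one_of_lt hne (show h₁ < h₁ - -1 by omega)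
      rw [e2, h3, e1]
      exact ⟨by decide, rfl, rfl, by norm_num, rfl⟩
  | check s₂ h₂ w₂ a S w' h1 h2 h3 =>
    right
    obtain ⟨rfl, rfl, rfl⟩ := headRow_inj.1 hr
    obtain ⟨rfl, rfl, rfl⟩ := headRow_inj.1 hr'
    refine ⟨by rw [M.src_eq h2, h1], h1, Or.inl ⟨a, S, h2, h3, rfl, rfl⟩⟩
  | push s₂ h₂ w₂ b w' h1 h2 =>
    right
    obtain ⟨rfl, rfl, rfl⟩ := headRow_inj.1 hr
    obtain ⟨rfl, rfl, rfl⟩ := headRow_inj.1 hr'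
    refine ⟨by rw [M.src_eq h2, Function.update_self, cut_self], h1,
      Or.inr ⟨b, h2, by ring, rfl⟩⟩

/-- The space-time diagrams of a reversible machine are deterministic into the past. -/
theorem Reversible.step_injective (hM : M.Reversible) {r₁ r₂ r' : ℤ → Symbol (Option κ) W}
    (v₁ : ValidRow r₁) (v₂ : ValidRow r₂) (h₁ : M.Step r₁ r') (h₂ : M.Step r₂ r') : r₁ = r₂ := by
  rcases (h₁.validRow v₁).cases_head with ⟨s, h, w, rfl, hs⟩ | hn | hn
  · obtain ⟨s₁, p₁, w₁, rfl⟩ := h₁.eq_headRow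
    obtain ⟨s₂, p₂, w₂, rfl⟩ := h₂.eq_headRow
    have c₁ := validRow_headRow.1 v₁
    have c₂ := validRow_headRow.1 v₂
    rcases h₁.walk_iff hs c₁ with ⟨n₁, rfl, rfl, rfl, -⟩ | ⟨z₁, d₁, R₁⟩ <;>
    rcases h₂.walk_iff hs c₂ with ⟨n₂, rfl, rfl, rfl, -⟩ | ⟨z₂, d₂, R₂⟩
    · rfl
    · exact absurd z₂ n₁
    · exact absurd z₁ n₂
    · rcases R₁ with ⟨a₁, S₁, ru₁, m₁, rfl, rfl⟩ | ⟨b₁, ru₁, rfl, e₁⟩ <;>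
      rcases R₂ with ⟨a₂, S₂, ru₂, m₂, rfl, rfl⟩ | ⟨b₂, ru₂, rfl, e₂⟩ <;>
      rcases hM ru₁ ru₂ with ⟨rfl, ha⟩ | ⟨c, T₁, T₂, ha₁, ha₂, hd⟩ <;>
      first
      | rfl
      | cases ha
        rw [headRow_inj]
        refine ⟨?_, rfl, rfl⟩
        funext l
        by_cases hl : l = some (M.dst w₁)
        · subst hl
          rw [(c₁ _).eq_cut d₁, (c₂ _).eq_cut d₂]
        · have := congrFun (e₁.symm.trans e₂) l
          rwa [Function.update_of_ne hl, Function.update_of_ne hl] at this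
      | cases ha₁
        cases ha₂
        exact absurd m₂ (Set.disjoint_left.1 hd m₁)
      | (cases ha)
      | (cases ha₁; done)
      | (cases ha₂)
  all_goals
    have key : ∀ {r}, M.Step r r' → r = r' := by
      intro r hst
      cases hst with
      | idle _ _ => rfl
      | walk s h w _ _ =>
        have := hn (h - (s (some (M.dst w)) h : ℤ))
        rw [headRow_snd_eq_here.2 ⟨rfl, rfl⟩] at this
        cases this
      | check s h w _ _ w' _ _ _ =>
        have := hn h
        rw [headRow_snd_eq_here.2 ⟨rfl, rfl⟩] at this
        cases this
      | push s h w b w' _ _ =>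
        have := hn (h + shiftBy b)
        rw [headRow_snd_eq_here.2 ⟨rfl, rfl⟩] at this
        cases this
    rw [key h₁, key h₂]

end PebbleMachine

end PebbleMachine

/-! ### Runs of pebble machines between goals -/

section Runs

variable {κ W : Type}

/-- The position of pebble `b` relative to pebble `a`, as a sign. -/
noncomputable def relSign (σ : κ → ℤ) (b a : κ) : SignType := SignType.sign (σ b - σ a)

/-- The layers of a row whose pebble `none` is at `-∞` and whose other pebbles are at `σ`. -/
noncomputable def layers (σ : κ → ℤ) : Option κ → ℤ → SignType
  | none => fun _ => 1
  | some l => cut (σ l)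

theorem isCut_layers (σ : κ → ℤ) (l : Option κ) : IsCut (layers σ l) := by
  cases l with
  | none => exact fun i => Or.inr ⟨by simp [layers], rfl⟩
  | some l => exact isCut_cut _

variable [DecidableEq κ]

theorem layers_update (σ : κ → ℤ) (d : κ) (v : ℤ) :
    layers (Function.update σ d v) = Function.update (layers σ) (some d) (cut v) := by
  funext l
  cases l with
  | none => simp [layers]
  | some l =>
    by_cases h : l = d
    · subst h; simp [layers]
    · rw [Function.update_of_ne (by simpa using h)]
      simp [layers, h]

/-- The effect of an action on the positions of the pebbles, when the head is at pebble `d`. -/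
def Action.Fires (a : Action κ) (d : κ) (σ τ : κ → ℤ) : Prop :=
  match a with
  | .push b => τ = Function.update σ d (σ d + shiftBy b)
  | .check c S => relSign σ d c ∈ S ∧ τ = σ

namespace PebbleMachine

variable (M : PebbleMachine κ W)

/-- The row in which the head has arrived at the goal of state `w`. -/
noncomputable def arrived (w : W) (σ : κ → ℤ) : ℤ → Symbol (Option κ) W :=
  headRow (layers σ) (σ (M.dst w)) w

/-- `n` steps lead from `r` to `r'`. -/
def Steps : ℕ → (ℤ → Symbol (Option κ) W) → (ℤ → Symbol (Option κ) W) → Prop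
  | 0, r, r' => r = r'
  | n + 1, r, r' => ∃ q, M.Step r q ∧ Steps n q r'

/-- `n` steps lead from `r` to `r'`, and none of them has an alternative. -/
def DetSteps : ℕ → (ℤ → Symbol (Option κ) W) → (ℤ → Symbol (Option κ) W) → Prop
  | 0, r, r' => r = r'
  | n + 1, r, r' => ∃ q, M.Step r q ∧ (∀ q', M.Step r q' → q' = q) ∧ DetSteps n q r'

variable {M}

theorem DetSteps.steps {n : ℕ} : ∀ {r r'}, M.DetSteps n r r' → M.Steps n r r' := by
  induction n with
  | zero => exact fun h => h
  | succ n ih => exact fun ⟨q, h, _, h'⟩ => ⟨q, h, ih h'⟩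

theorem Steps.trans {m n : ℕ} {r r' r'' : ℤ → Symbol (Option κ) W} (h : M.Steps m r r')
    (h' : M.Steps n r' r'') : M.Steps (m + n) r r'' := by
  induction m generalizing r with
  | zero => cases h; rwa [zero_add]
  | succ m ih =>
    obtain ⟨q, hq, h⟩ := h
    rw [Nat.succ_add]
    exact ⟨q, hq, ih h⟩

theorem DetSteps.trans {m n : ℕ} {r r' r'' : ℤ → Symbol (Option κ) W} (h : M.DetSteps m r r')
    (h' : M.DetSteps n r' r'') : M.DetSteps (m + n) r r'' := by
  induction m generalizing r with
  | zero => cases h; rwa [zero_add]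
  | succ m ih =>
    obtain ⟨q, hq, hu, h⟩ := h
    rw [Nat.succ_add]
    exact ⟨q, hq, hu, ih h⟩

theorem DetSteps.eq_of_chain {n : ℕ} {r r' : ℤ → Symbol (Option κ) W} (h : M.DetSteps n r r')
    {R : ℤ → ℤ → Symbol (Option κ) W} (hR : ∀ j, M.Step (R j) (R (j + 1))) {t : ℤ}
    (ht : R t = r) : R (t + n) = r' := by
  induction n generalizing r t with
  | zero =>
    have h' : r = r' := h
    simpa [ht] using h'
  | succ n ih =>
    obtain ⟨q, -, hu, h⟩ := h
    have := ih h (t := t + 1) (hu _ (ht ▸ hR t))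
    rwa [Nat.cast_succ, add_comm (n : ℤ), ← add_assoc]

theorem Step.forward_cases {s : Option κ → ℤ → SignType} {h : ℤ} {w : W}
    {r : ℤ → Symbol (Option κ) W} (hst : M.Step (headRow s h w) r) :
    (s (some (M.dst w)) h ≠ 0 ∧ s (M.src w) h ≠ s (some (M.dst w)) h ∧
      r = headRow s (h - (s (some (M.dst w)) h : ℤ)) w) ∨
    (s (some (M.dst w)) h = 0 ∧ ((∃ a S w', M.rule w (.check a S) w' ∧ s (some a) h ∈ S ∧
      r = headRow s h w') ∨ ∃ b w', M.rule w (.push b) w' ∧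
        r = headRow (Function.update s (some (M.dst w)) (cut (h + shiftBy b)))
          (h + shiftBy b) w')) := by
  generalize hr : headRow s h w = q at hst
  cases hst with
  | idle _ hno =>
    subst hr
    exact absurd (by rw [sign_headRow, cut_self]) (hno h)
  | walk s' h' w' h1 h2 =>
    obtain ⟨rfl, rfl, rfl⟩ := headRow_inj.1 hr
    exact Or.inl ⟨h1, h2, rfl⟩
  | check s' h' w' a S w'' h1 h2 h3 =>
    obtain ⟨rfl, rfl, rfl⟩ := headRow_inj.1 hr
    exact Or.inr ⟨h1, Or.inl ⟨a, S, w'', h2, h3, rfl⟩⟩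
  | push s' h' w' b w'' h1 h2 =>
    obtain ⟨rfl, rfl, rfl⟩ := headRow_inj.1 hr
    exact Or.inr ⟨h1, Or.inr ⟨b, w'', h2, rfl⟩⟩

/-- When the head has arrived at its goal, the next row is determined by a rule that fires. -/
theorem step_arrived_iff {w : W} {σ : κ → ℤ} {r : ℤ → Symbol (Option κ) W} :
    M.Step (M.arrived w σ) r ↔ ∃ a w' τ, M.rule w a w' ∧ a.Fires (M.dst w) σ τ ∧
      r = headRow (layers τ) (τ (M.dst w)) w' := by
  constructor
  · intro h
    rcases h.forward_cases with ⟨h1, -⟩ | ⟨-, ⟨a, S, w', h2, h3, rfl⟩ | ⟨b, w', h2, rfl⟩⟩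
    · exact absurd (cut_self _) h1
    · exact ⟨_, _, σ, h2, ⟨h3, rfl⟩, rfl⟩
    · refine ⟨_, _, _, h2, rfl, ?_⟩
      rw [layers_update, Function.update_self]
  · rintro ⟨a, w', τ, h2, h3, rfl⟩
    cases a with
    | check a S =>
      obtain ⟨h3, rfl⟩ := h3
      exact .check _ _ _ _ _ _ (cut_self _) h2 h3
    | push b =>
      cases h3
      rw [layers_update, Function.update_self]
      exact .push _ _ _ _ _ (cut_self _) h2

/-- The walk from the source to the goal is forced. -/
theorem detSteps_walk {w : W} {l : κ} (hw : M.src w = some l) (σ : κ → ℤ) :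
    ∃ n, M.DetSteps n (headRow (layers σ) (σ l) w) (M.arrived w σ) := by
  -- the head stays between source and goal, and its distance from the goal decreases
  have key : ∀ (n : ℕ) (h : ℤ), (h - σ (M.dst w)).natAbs = n →
      ((σ l ≤ h ∧ h ≤ σ (M.dst w)) ∨ (σ (M.dst w) ≤ h ∧ h ≤ σ l)) →
      M.DetSteps n (headRow (layers σ) h w) (M.arrived w σ) := by
    intro n
    induction n with
    | zero =>
      intro h h0 _
      have : h = σ (M.dst w) := by omega
      rw [this]
      rfl
    | succ n ih =>
      intro h hn hb
      have hne : h ≠ σ (M.dst w) := by rintro rfl; simp at hn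
      have hz : layers σ (some (M.dst w)) h ≠ 0 := by
        simpa [layers, cut_eq_zero] using hne
      have hsd : layers σ (M.src w) h ≠ layers σ (some (M.dst w)) h := by
        rw [hw]
        simp only [layers]
        rcases lt_or_gt_of_ne hne with hlt | hlt
        · rw [cut_of_lt hlt]
          rcases (show σ l < h ∨ h = σ l by omega) with h1 | rfl
          · rw [cut_of_gt h1]; decide
          · rw [cut_self]; decide
        · rw [cut_of_gt hlt]
          rcases (show h < σ l ∨ h = σ l by omega) with h1 | rfl
          · rw [cut_of_lt h1]; decide
          · rw [cut_self]; decide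
      refine ⟨_, .walk _ _ _ hz hsd, ?_, ?_⟩
      · intro q hq
        rcases hq.forward_cases with ⟨-, -, rfl⟩ | ⟨h1, -⟩
        · rfl
        · exact absurd h1 hz
      · simp only [layers]
        rcases lt_or_gt_of_ne hne with hlt | hlt
        · rw [cut_of_lt hlt]
          refine ih (h - (-1)) ?_ ?_ <;> omega
        · rw [cut_of_gt hlt]
          refine ih (h - 1) ?_ ?_ <;> omega
  exact ⟨_, key _ (σ l) rfl (by omega)⟩

theorem Action.Fires.unique {a : Action κ} {d : κ} {σ τ τ' : κ → ℤ} (h : a.Fires d σ τ)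
    (h' : a.Fires d σ τ') : τ = τ' := by
  cases a with
  | push b => exact Eq.trans h (Eq.symm h')
  | check c S => exact h.2.trans h'.2.symm

theorem detSteps_of_fires {w w' : W} {a : Action κ} {σ τ : κ → ℤ} (hr : M.rule w a w')
    (ha : a.Fires (M.dst w) σ τ)
    (huniq : ∀ a' w'' τ', M.rule w a' w'' → a'.Fires (M.dst w) σ τ' → a' = a ∧ w'' = w') :
    ∃ n, M.DetSteps (n + 1) (M.arrived w σ) (M.arrived w' τ) := by
  obtain ⟨n, hn⟩ := detSteps_walk (M.src_eq hr) τ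
  refine ⟨n, _, step_arrived_iff.2 ⟨a, w', τ, hr, ha, rfl⟩, ?_, hn⟩
  intro q hq
  obtain ⟨a', w'', τ', hr', ha', rfl⟩ := step_arrived_iff.1 hq
  obtain ⟨rfl, rfl⟩ := huniq _ _ _ hr' ha'
  rw [Action.Fires.unique ha ha']

end PebbleMachine

end Runs

/-! ### Structured reversible programs -/

section Programs

/-- Structured programs on registers `κ`. Register values are positions of pebbles; tests compare
two of them. -/
inductive Prog (κ : Type) : Type
  /-- Increment or decrement register `i`. -/
  | push (i : κ) (up : Bool) : Prog κ
  /-- Continue only if the position of `b` relative to `a` is in `S`. -/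
  | check (b a : κ) (S : Set SignType) : Prog κ
  | seq (P Q : Prog κ) : Prog κ
  /-- A reversible loop with body `P`. At its head, `b` is compared with `a`: the outcome must be
  in `S` when the loop is entered, and in `T` after a run of the body. Then `d` is compared with
  `c`: the body may be run if the outcome is in `U`, the loop may be left if it is in `V`. -/
  | loop (b a : κ) (S T : Set SignType) (d c : κ) (U V : Set SignType) (P : Prog κ) : Prog κ

/-- The edges of a loop outside its body. -/
inductive LoopEdge : Type
  | entry : LoopEdge
  | mid : LoopEdge
  | exit : LoopEdge

instance : Finite LoopEdge :=
  Finite.of_injective (β := Fin 3) (fun | .entry => 0 | .mid => 1 | .exit => 2) (by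
    rintro (_ | _ | _) (_ | _ | _) h <;> first | rfl | cases h)

namespace Prog

variable {κ : Type}

/-- The states of the pebble machine of a program are the edges of its flow chart. -/
def Edge : Prog κ → Type
  | push _ _ => Bool
  | check _ _ _ => Bool
  | seq P Q => P.Edge ⊕ Q.Edge
  | loop _ _ _ _ _ _ _ _ P => LoopEdge ⊕ P.Edge

/-- The edge by which a program is entered. -/
def first : (P : Prog κ) → P.Edge
  | push _ _ => false
  | check _ _ _ => false
  | seq P _ => .inl P.first
  | loop _ _ _ _ _ _ _ _ _ => .inl .entry

/-- The edge by which a program is left. -/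
def last : (P : Prog κ) → P.Edge
  | push _ _ => true
  | check _ _ _ => true
  | seq _ Q => .inr Q.last
  | loop _ _ _ _ _ _ _ _ _ => .inl .exit

/-- The register that a program visits first. -/
def start : Prog κ → κ
  | push i _ => i
  | check b _ _ => b
  | seq P _ => P.start
  | loop b _ _ _ _ _ _ _ _ => b

/-- The sources of the edges, given the source of the first edge. -/
def src : (P : Prog κ) → Option κ → P.Edge → Option κ
  | push i _, s => fun e => match e with
    | false => s
    | true => some i
  | check b _ _, s => fun e => match e with
    | false => s
    | true => some b
  | seq P Q, s => fun e => match e with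
    | .inl u => P.src s u
    | .inr v => Q.src (some Q.start) v
  | loop b _ _ _ d _ _ _ P, s => fun e => match e with
    | .inl .entry => s
    | .inl .mid => some b
    | .inl .exit => some d
    | .inr u => P.src (some d) u

/-- The goals of the edges, given the goal of the last edge. -/
def dst : (P : Prog κ) → κ → P.Edge → κ
  | push i _, o => fun e => match e with
    | false => i
    | true => o
  | check b _ _, o => fun e => match e with
    | false => b
    | true => o
  | seq P Q, o => fun e => match e with
    | .inl u => P.dst Q.start u
    | .inr v => Q.dst o v
  | loop b _ _ _ d _ _ _ P, o => fun e => match e with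
    | .inl .entry => b
    | .inl .mid => d
    | .inl .exit => o
    | .inr u => P.dst b u

/-- The rules of the pebble machine of a program. -/
def Rule : (P : Prog κ) → P.Edge → Action κ → P.Edge → Prop
  | push _ up => fun e a e' => e = false ∧ a = .push up ∧ e' = true
  | check _ a S => fun e a' e' => e = false ∧ a' = .check a S ∧ e' = true
  | seq P Q => fun e a e' => match e, e' with
    | .inl u, .inl u' => P.Rule u a u'
    | .inr v, .inr v' => Q.Rule v a v'
    | .inl u, .inr v => u = P.last ∧ a = .check Q.start Set.univ ∧ v = Q.first
    | .inr _, .inl _ => False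
  | loop _ a S T _ c U V P => fun e a' e' => match e, e' with
    | .inl .entry, .inl .mid => a' = .check a S
    | .inr u, .inl .mid => u = P.last ∧ a' = .check a T
    | .inl .mid, .inr u => a' = .check c U ∧ u = P.first
    | .inl .mid, .inl .exit => a' = .check c V
    | .inr u, .inr u' => P.Rule u a' u'
    | _, _ => False

theorem src_first (P : Prog κ) (s : Option κ) : P.src s P.first = s := by
  induction P generalizing s with
  | push i up => rfl
  | check b a S => rfl
  | seq P Q ihP ihQ => exact ihP s
  | loop b a S T d c U V P ih => rfl

theorem dst_last (P : Prog κ) (o : κ) : P.dst o P.last = o := by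
  induction P generalizing o with
  | push i up => rfl
  | check b a S => rfl
  | seq P Q ihP ihQ => exact ihQ o
  | loop b a S T d c U V P ih => rfl

/-- A program cannot return to its first edge; hence the head of an initial row has come from `-∞`. -/
theorem not_rule_first (P : Prog κ) (e : P.Edge) (a : Action κ) : ¬ P.Rule e a P.first := by
  induction P with
  | push i up => rintro ⟨-, -, h⟩; cases h
  | check b a S => rintro ⟨-, -, h⟩; cases h
  | seq P Q ihP ihQ =>
    rcases e with u | v
    · exact ihP u
    · exact fun h => h
  | loop b a S T d c U V P ih =>
    rcases e with (_ | _ | _) | u <;> exact fun h => h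

theorem not_rule_last (P : Prog κ) (e : P.Edge) (a : Action κ) : ¬ P.Rule P.last a e := by
  induction P with
  | push i up => rintro ⟨h, -, -⟩; cases h
  | check b a S => rintro ⟨h, -, -⟩; cases h
  | seq P Q ihP ihQ =>
    rcases e with u | v
    · exact fun h => h
    · exact ihQ v
  | loop b a S T d c U V P ih =>
    rcases e with (_ | _ | _) | u <;> exact fun h => h

theorem src_eq_of_rule (P : Prog κ) (s : Option κ) (o : κ) {e e' : P.Edge} {a : Action κ}
    (h : P.Rule e a e') : P.src s e' = some (P.dst o e) := by
  induction P generalizing s o with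
  | push i up => obtain ⟨rfl, -, rfl⟩ := h; rfl
  | check b a S => obtain ⟨rfl, -, rfl⟩ := h; rfl
  | seq P Q ihP ihQ =>
    rcases e with u | v <;> rcases e' with u' | v'
    · exact ihP _ _ h
    · obtain ⟨rfl, -, rfl⟩ := h
      change Q.src _ Q.first = some (P.dst Q.start P.last)
      rw [src_first, dst_last]
    · exact h.elim
    · exact ihQ _ _ h
  | loop b a S T d c U V P ih =>
    rcases e with (_ | _ | _) | u <;> rcases e' with (_ | _ | _) | u' <;>
      first
      | exact h.elim
      | rfl
      | (obtain ⟨-, rfl⟩ := h; exact P.src_first _)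
      | (obtain ⟨rfl, -⟩ := h; exact congrArg some (P.dst_last b).symm)
      | exact ih _ _ h

/-- The pebble machine of a program. Its initial head comes from `-∞`. -/
def machine (P : Prog κ) : PebbleMachine κ P.Edge where
  src := P.src none
  dst := P.dst P.start
  rule := P.Rule
  src_eq h := P.src_eq_of_rule _ _ h

instance finite_edge (P : Prog κ) : Finite P.Edge := by
  induction P with
  | push i up => exact inferInstanceAs (Finite Bool)
  | check b a S => exact inferInstanceAs (Finite Bool)
  | seq P Q ihP ihQ => exact inferInstanceAs (Finite (P.Edge ⊕ Q.Edge))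
  | loop b a S T d c U V P ih => exact inferInstanceAs (Finite (LoopEdge ⊕ P.Edge))

/-- In every loop, the test at the head distinguishes whether the loop was just entered. -/
def EntryDisjoint : Prog κ → Prop
  | push _ _ => True
  | check _ _ _ => True
  | seq P Q => P.EntryDisjoint ∧ Q.EntryDisjoint
  | loop _ _ S T _ _ _ _ P => Disjoint S T ∧ P.EntryDisjoint

/-- In every loop, the exit test decides whether the loop is left. -/
def ExitDisjoint : Prog κ → Prop
  | push _ _ => True
  | check _ _ _ => True
  | seq P Q => P.ExitDisjoint ∧ Q.ExitDisjoint
  | loop _ _ _ _ _ _ U V P => Disjoint U V ∧ P.ExitDisjoint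

/-- Two rules that lead to the same edge are told apart by disjoint checks against one pebble. -/
theorem EntryDisjoint.rule {P : Prog κ} (hP : P.EntryDisjoint) {e₁ e₂ e' : P.Edge}
    {a₁ a₂ : Action κ} (h₁ : P.Rule e₁ a₁ e') (h₂ : P.Rule e₂ a₂ e') : (e₁ = e₂ ∧ a₁ = a₂) ∨
    ∃ c S₁ S₂, a₁ = .check c S₁ ∧ a₂ = .check c S₂ ∧ Disjoint S₁ S₂ := by
  induction P with
  | push i up =>
    obtain ⟨rfl, rfl, -⟩ := h₁
    obtain ⟨rfl, rfl, -⟩ := h₂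
    exact Or.inl ⟨rfl, rfl⟩
  | check b a S =>
    obtain ⟨rfl, rfl, -⟩ := h₁
    obtain ⟨rfl, rfl, -⟩ := h₂
    exact Or.inl ⟨rfl, rfl⟩
  | seq P Q ihP ihQ =>
    rcases e' with u | v <;> rcases e₁ with u₁ | v₁ <;> rcases e₂ with u₂ | v₂
    · exact (ihP hP.1 h₁ h₂).imp (fun h => ⟨congrArg Sum.inl h.1, h.2⟩) id
    · exact h₂.elim
    · exact h₁.elim
    · exact h₁.elim
    · obtain ⟨rfl, rfl, rfl⟩ := h₁
      obtain ⟨rfl, rfl, -⟩ := h₂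
      exact Or.inl ⟨rfl, rfl⟩
    · obtain ⟨rfl, rfl, rfl⟩ := h₁
      exact absurd h₂ (not_rule_first _ _ _)
    · obtain ⟨rfl, rfl, rfl⟩ := h₂
      exact absurd h₁ (not_rule_first _ _ _)
    · exact (ihQ hP.2 h₁ h₂).imp (fun h => ⟨congrArg Sum.inr h.1, h.2⟩) id
  | loop b a S T d c U V P ih =>
    rcases e' with (_ | _ | _) | u <;> rcases e₁ with (_ | _ | _) | u₁ <;>
      rcases e₂ with (_ | _ | _) | u₂ <;>
      first
      | exact h₁.elim
      | exact h₂.elim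
      | (cases h₁; cases h₂; exact Or.inl ⟨rfl, rfl⟩)
      | (cases h₁; obtain ⟨rfl, rfl⟩ := h₂; exact Or.inr ⟨_, _, _, rfl, rfl, hP.1⟩)
      | (cases h₂; obtain ⟨rfl, rfl⟩ := h₁; exact Or.inr ⟨_, _, _, rfl, rfl, hP.1.symm⟩)
      | (obtain ⟨rfl, rfl⟩ := h₁; obtain ⟨rfl, rfl⟩ := h₂; exact Or.inl ⟨rfl, rfl⟩)
      | (obtain ⟨rfl, rfl⟩ := h₁; obtain ⟨rfl, -⟩ := h₂; exact Or.inl ⟨rfl, rfl⟩)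
      | (obtain ⟨rfl, rfl⟩ := h₁; exact absurd h₂ (not_rule_first _ _ _))
      | (obtain ⟨rfl, rfl⟩ := h₂; exact absurd h₁ (not_rule_first _ _ _))
      | exact (ih hP.2 h₁ h₂).imp (fun h => ⟨congrArg Sum.inr h.1, h.2⟩) id

theorem EntryDisjoint.reversible {P : Prog κ} (hP : P.EntryDisjoint) : P.machine.Reversible :=
  fun _ _ _ _ _ h₁ h₂ => hP.rule h₁ h₂

/-- The relation between register contents before and after a run of a program. -/
def Exec [DecidableEq κ] : Prog κ → (κ → ℤ) → (κ → ℤ) → Prop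
  | push i up => fun σ τ => τ = Function.update σ i (σ i + shiftBy up)
  | check b a S => fun σ τ => relSign σ b a ∈ S ∧ τ = σ
  | seq P Q => fun σ τ => ∃ ρ, P.Exec σ ρ ∧ Q.Exec ρ τ
  | loop b a S T d c U V P => fun σ τ => relSign σ b a ∈ S ∧
      Relation.ReflTransGen
        (fun σ τ => relSign σ d c ∈ U ∧ P.Exec σ τ ∧ relSign τ b a ∈ T) σ τ ∧
      relSign τ d c ∈ V

/-- The program that undoes `P`. -/
def inv : Prog κ → Prog κ
  | push i up => push i !up
  | check b a S => check b a S
  | seq P Q => seq Q.inv P.inv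
  | loop b a S T d c U V P => loop d c V U b a T S P.inv

theorem Exec.inv [DecidableEq κ] {P : Prog κ} {σ τ : κ → ℤ} (h : P.Exec σ τ) :
    P.inv.Exec τ σ := by
  induction P generalizing σ τ with
  | push i up =>
    cases h
    simp only [Prog.inv, Exec, Function.update_self, Function.update_idem]
    rw [show σ i + shiftBy up + shiftBy (!up) = σ i by cases up <;> simp [shiftBy],
      Function.update_eq_self]
  | check b a S => obtain ⟨h, rfl⟩ := h; exact ⟨h, rfl⟩
  | seq P Q ihP ihQ => obtain ⟨ρ, h1, h2⟩ := h; exact ⟨ρ, ihQ h2, ihP h1⟩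
  | loop b a S T d c U V P ih =>
    obtain ⟨h1, h2, h3⟩ := h
    refine ⟨h3, ?_, h1⟩
    clear h1 h3
    induction h2 with
    | refl => exact .refl
    | tail _ h ih' => exact .head ⟨h.2.2, ih h.2.1, h.1⟩ ih'

theorem EntryDisjoint.inv_exitDisjoint {P : Prog κ} (h : P.EntryDisjoint) :
    P.inv.ExitDisjoint := by
  induction P with
  | push i up => trivial
  | check b a S => trivial
  | seq P Q ihP ihQ => exact ⟨ihQ h.2, ihP h.1⟩
  | loop b a S T d c U V P ih => exact ⟨h.1.symm, ih h.2⟩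

theorem ExitDisjoint.inv_entryDisjoint {P : Prog κ} (h : P.ExitDisjoint) :
    P.inv.EntryDisjoint := by
  induction P with
  | push i up => trivial
  | check b a S => trivial
  | seq P Q ihP ihQ => exact ⟨ihQ h.2, ihP h.1⟩
  | loop b a S T d c U V P ih => exact ⟨h.1.symm, ih h.2⟩

/-- A run of a program without ambiguous exit tests is simulated by deterministic steps of any
machine `M` that contains the flow chart of the program. -/
theorem Exec.detSteps [DecidableEq κ] {W : Type} {M : PebbleMachine κ W} {P : Prog κ}
    (φ : P.Edge → W) (o : κ) (hrule : ∀ e a e', P.Rule e a e' → M.rule (φ e) a (φ e'))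
    (hcl : ∀ e a w, e ≠ P.last → M.rule (φ e) a w → ∃ e', w = φ e' ∧ P.Rule e a e')
    (hdst : ∀ e, e ≠ P.last → M.dst (φ e) = P.dst o e) (hP : P.ExitDisjoint) {σ τ : κ → ℤ}
    (h : P.Exec σ τ) :
    ∃ n, M.DetSteps (n + 1) (M.arrived (φ P.first) σ) (M.arrived (φ P.last) τ) := by
  induction P generalizing o σ τ with
  | push i up =>
    refine PebbleMachine.detSteps_of_fires (hrule _ _ _ ⟨rfl, rfl, rfl⟩) ?_ ?_
    · have hd : M.dst (φ false) = _ := hdst false (by rintro ⟨⟩)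
      change Action.Fires _ (M.dst (φ false)) _ _
      rw [hd]
      exact h
    · intro a' w'' τ' hr _
      obtain ⟨e', rfl, -, rfl, rfl⟩ := hcl _ _ _ (by rintro ⟨⟩) hr
      exact ⟨rfl, rfl⟩
  | check b a S =>
    refine PebbleMachine.detSteps_of_fires (hrule _ _ _ ⟨rfl, rfl, rfl⟩) ?_ ?_
    · have hd : M.dst (φ false) = _ := hdst false (by rintro ⟨⟩)
      change Action.Fires _ (M.dst (φ false)) _ _
      rw [hd]
      exact h
    · intro a' w'' τ' hr _
      obtain ⟨e', rfl, -, rfl, rfl⟩ := hcl _ _ _ (by rintro ⟨⟩) hr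
      exact ⟨rfl, rfl⟩
  | seq P Q ihP ihQ =>
    obtain ⟨ρ, h1, h2⟩ := h
    obtain ⟨n₁, s₁⟩ := ihP (φ ∘ Sum.inl) Q.start (fun e a e' he => hrule _ _ _ he) (by
      intro e a w he hr
      obtain ⟨e' | e', rfl, h'⟩ := hcl (.inl e) a w (by rintro ⟨⟩) hr
      · exact ⟨e', rfl, h'⟩
      · exact absurd h'.1 he) (fun e _ => hdst (.inl e) (by rintro ⟨⟩)) hP.1 h1
    obtain ⟨n₂, s₂⟩ := ihQ (φ ∘ Sum.inr) o (fun e a e' he => hrule _ _ _ he) (by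
      intro e a w he hr
      obtain ⟨e' | e', rfl, h'⟩ := hcl (.inr e) a w (by rintro ⟨⟩; exact he rfl) hr
      · exact h'.elim
      · exact ⟨e', rfl, h'⟩) (fun e he => hdst (.inr e) (by rintro ⟨⟩; exact he rfl)) hP.2 h2
    obtain ⟨n₃, s₃⟩ := PebbleMachine.detSteps_of_fires (M := M) (σ := ρ) (τ := ρ)
      (hrule (.inl P.last) (.check Q.start Set.univ) (.inr Q.first) ⟨rfl, rfl, rfl⟩)
      ⟨trivial, rfl⟩ (by
        intro a' w'' τ' hr _
        obtain ⟨e' | e', rfl, h'⟩ := hcl (.inl P.last) _ _ (by rintro ⟨⟩) hr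
        · exact absurd h' (not_rule_last _ _ _)
        · obtain ⟨-, rfl, rfl⟩ := h'
          exact ⟨rfl, rfl⟩)
    have t : M.DetSteps (n₁ + 1 + (n₃ + 1) + (n₂ + 1)) (M.arrived (φ (.inl P.first)) σ)
        (M.arrived (φ (.inr Q.last)) τ) := (s₁.trans s₃).trans s₂
    exact ⟨_, t⟩
  | loop b a S T d c U V P ih =>
    obtain ⟨hS, hiter, hV⟩ := h
    have hentry : M.dst (φ (.inl .entry)) = b := hdst (.inl .entry) (by rintro ⟨⟩)
    have hmid : M.dst (φ (.inl .mid)) = d := hdst (.inl .mid) (by rintro ⟨⟩)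
    have hback : M.dst (φ (.inr P.last)) = b := by
      rw [hdst (.inr P.last) (by rintro ⟨⟩)]
      exact P.dst_last b
    have rmid : ∀ a' w'', M.rule (φ (.inl .mid)) a' w'' →
        (a' = .check c U ∧ w'' = φ (.inr P.first)) ∨ (a' = .check c V ∧ w'' = φ (.inl .exit)) := by
      intro a' w'' hr
      obtain ⟨(_ | _ | _) | e', rfl, h'⟩ := hcl (.inl .mid) _ _ (by rintro ⟨⟩) hr
      · exact h'.elim
      · exact h'.elim
      · exact Or.inr ⟨h', rfl⟩
      · obtain ⟨rfl, rfl⟩ := h'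
        exact Or.inl ⟨rfl, rfl⟩
    obtain ⟨n₁, s₁⟩ := PebbleMachine.detSteps_of_fires (M := M) (σ := σ) (τ := σ)
      (hrule (.inl .entry) (.check a S) (.inl .mid) rfl) ⟨by rwa [hentry], rfl⟩ (by
        intro a' w'' τ' hr _
        obtain ⟨(_ | _ | _) | e', rfl, h'⟩ := hcl (.inl .entry) _ _ (by rintro ⟨⟩) hr
        · exact h'.elim
        · exact ⟨h', rfl⟩
        · exact h'.elim
        · exact h'.elim)
    have body : ∀ σ τ, relSign σ d c ∈ U → P.Exec σ τ → relSign τ b a ∈ T →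
        ∃ n, M.DetSteps (n + 1) (M.arrived (φ (.inl .mid)) σ) (M.arrived (φ (.inl .mid)) τ) := by
      intro σ τ hU hE hT
      obtain ⟨m₁, t₁⟩ := PebbleMachine.detSteps_of_fires (M := M) (σ := σ) (τ := σ)
        (hrule (.inl .mid) (.check c U) (.inr P.first) ⟨rfl, rfl⟩) ⟨by rwa [hmid], rfl⟩ (by
          intro a' w'' τ' hr hf
          refine (rmid _ _ hr).resolve_right ?_
          rintro ⟨rfl, rfl⟩
          rw [hmid] at hf
          exact Set.disjoint_left.1 hP.1 hU hf.1)
      obtain ⟨m₂, t₂⟩ := ih (φ ∘ Sum.inr) b (fun e a e' he => hrule _ _ _ he) (by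
        intro e a w he hr
        obtain ⟨(_ | _ | _) | e', rfl, h'⟩ := hcl (.inr e) a w (by rintro ⟨⟩) hr
        · exact h'.elim
        · exact absurd h'.1 he
        · exact h'.elim
        · exact ⟨e', rfl, h'⟩) (fun e _ => hdst (.inr e) (by rintro ⟨⟩)) hP.2 hE
      obtain ⟨m₃, t₃⟩ := PebbleMachine.detSteps_of_fires (M := M) (σ := τ) (τ := τ)
        (hrule (.inr P.last) (.check a T) (.inl .mid) ⟨rfl, rfl⟩) ⟨by rwa [hback], rfl⟩ (by
          intro a' w'' τ' hr _
          obtain ⟨(_ | _ | _) | e', rfl, h'⟩ := hcl (.inr P.last) _ _ (by rintro ⟨⟩) hr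
          · exact h'.elim
          · exact ⟨h'.2, rfl⟩
          · exact h'.elim
          · exact absurd h' (not_rule_last _ _ _))
      have t : M.DetSteps (m₁ + 1 + (m₂ + 1) + (m₃ + 1)) (M.arrived (φ (.inl .mid)) σ)
        (M.arrived (φ (.inl .mid)) τ) := (t₁.trans t₂).trans t₃
      exact ⟨_, t⟩
    have iter : ∃ n, M.DetSteps n (M.arrived (φ (.inl .mid)) σ) (M.arrived (φ (.inl .mid)) τ) := by
      clear hV
      induction hiter with
      | refl => exact ⟨0, rfl⟩
      | tail _ hlast ih' =>
        obtain ⟨n, hn⟩ := ih'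
        obtain ⟨m, hm⟩ := body _ _ hlast.1 hlast.2.1 hlast.2.2
        exact ⟨_, hn.trans hm⟩
    obtain ⟨n₂, s₂⟩ := iter
    obtain ⟨n₃, s₃⟩ := PebbleMachine.detSteps_of_fires (M := M) (σ := τ) (τ := τ)
      (hrule (.inl .mid) (.check c V) (.inl .exit) rfl) ⟨by rwa [hmid], rfl⟩ (by
        intro a' w'' τ' hr hf
        refine (rmid _ _ hr).resolve_left ?_
        rintro ⟨rfl, rfl⟩
        rw [hmid] at hf
        exact Set.disjoint_left.1 hP.1 hf.1 hV)
    have t : M.DetSteps (n₁ + 1 + n₂ + (n₃ + 1)) (M.arrived (φ (.inl .entry)) σ)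
        (M.arrived (φ (.inl .exit)) τ) := (s₁.trans s₂).trans s₃
    exact ⟨_, t⟩

end Prog

end Programs

/-! ### Reversible programs for primitive recursive functions -/

namespace Prog

section Registers

variable {κ κ' : Type}

/-- Renaming of registers. -/
def map (f : κ → κ') : Prog κ → Prog κ'
  | push i up => push (f i) up
  | check b a S => check (f b) (f a) S
  | seq P Q => seq (P.map f) (Q.map f)
  | loop b a S T d c U V P => loop (f b) (f a) S T (f d) (f c) U V (P.map f)

/-- The registers that occur in a program. -/
def regs : Prog κ → Set κ
  | push i _ => {i}
  | check b a _ => {b, a}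
  | seq P Q => P.regs ∪ Q.regs
  | loop b a _ _ d c _ _ P => {b, a, d, c} ∪ P.regs

/-- The registers that a program may change. -/
def pushes : Prog κ → Set κ
  | push i _ => {i}
  | check _ _ _ => ∅
  | seq P Q => P.pushes ∪ Q.pushes
  | loop _ _ _ _ _ _ _ _ P => P.pushes

theorem finite_regs (P : Prog κ) : P.regs.Finite := by
  induction P with
  | push i up => exact Set.finite_singleton i
  | check b a S => exact Set.toFinite {b, a}
  | seq P Q ihP ihQ => exact ihP.union ihQ
  | loop b a S T d c U V P ih => exact (Set.toFinite {b, a, d, c}).union ih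

theorem pushes_inv (P : Prog κ) : P.inv.pushes = P.pushes := by
  induction P with
  | push i up => rfl
  | check b a S => rfl
  | seq P Q ihP ihQ =>
    change Q.inv.pushes ∪ P.inv.pushes = P.pushes ∪ Q.pushes
    rw [ihP, ihQ, Set.union_comm]
  | loop b a S T d c U V P ih => exact ih

theorem pushes_map (f : κ → κ') (P : Prog κ) : (P.map f).pushes = f '' P.pushes := by
  induction P with
  | push i up => exact Set.image_singleton.symm
  | check b a S => exact (Set.image_empty f).symm
  | seq P Q ihP ihQ =>
    change (P.map f).pushes ∪ (Q.map f).pushes = f '' (P.pushes ∪ Q.pushes)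
    rw [ihP, ihQ, Set.image_union]
  | loop b a S T d c U V P ih => exact ih

theorem EntryDisjoint.map (f : κ → κ') {P : Prog κ} (h : P.EntryDisjoint) :
    (P.map f).EntryDisjoint := by
  induction P with
  | push i up => trivial
  | check b a S => trivial
  | seq P Q ihP ihQ => exact ⟨ihP h.1, ihQ h.2⟩
  | loop b a S T d c U V P ih => exact ⟨h.1, ih h.2⟩

theorem ExitDisjoint.map (f : κ → κ') {P : Prog κ} (h : P.ExitDisjoint) :
    (P.map f).ExitDisjoint := by
  induction P with
  | push i up => trivial
  | check b a S => trivial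
  | seq P Q ihP ihQ => exact ⟨ihP h.1, ihQ h.2⟩
  | loop b a S T d c U V P ih => exact ⟨h.1, ih h.2⟩

/-- Renaming registers along `f`, with the register contents read back through an injection `g` that
is inverse to `f` on the registers of the program. -/
theorem Exec.map [DecidableEq κ] [DecidableEq κ'] {f : κ → κ'} {g : κ' → κ}
    (hg : Function.Injective g) {P : Prog κ} (hP : ∀ i ∈ P.regs, g (f i) = i) {σ τ : κ → ℤ}
    (h : P.Exec σ τ) : (P.map f).Exec (σ ∘ g) (τ ∘ g) := by
  induction P generalizing σ τ with
  | push i up =>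
    have hi : g (f i) = i := hP i rfl
    cases h
    change _ = Function.update (σ ∘ g) (f i) (σ (g (f i)) + shiftBy up)
    rw [← Function.update_comp_eq_of_injective _ hg, hi]
  | check b a S =>
    obtain ⟨h, rfl⟩ := h
    refine ⟨?_, rfl⟩
    simpa only [relSign, Function.comp, hP b (Or.inl rfl), hP a (Or.inr rfl)] using h
  | seq P Q ihP ihQ =>
    obtain ⟨ρ, h1, h2⟩ := h
    exact ⟨ρ ∘ g, ihP (fun i hi => hP i (Or.inl hi)) h1, ihQ (fun i hi => hP i (Or.inr hi)) h2⟩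
  | loop b a S T d c U V P ih =>
    have hb : ∀ σ : κ → ℤ, relSign (σ ∘ g) (f b) (f a) = relSign σ b a := fun σ => by
      simp only [relSign, Function.comp, hP b (Or.inl (by simp)), hP a (Or.inl (by simp))]
    have hd : ∀ σ : κ → ℤ, relSign (σ ∘ g) (f d) (f c) = relSign σ d c := fun σ => by
      simp only [relSign, Function.comp, hP d (Or.inl (by simp)), hP c (Or.inl (by simp))]
    obtain ⟨h1, h2, h3⟩ := h
    refine ⟨by rwa [hb], ?_, by rwa [hd]⟩
    clear h1 h3
    induction h2 with
    | refl => exact .refl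
    | tail _ h ih' =>
      exact ih'.tail ⟨by rw [hd]; exact h.1, ih (fun i hi => hP i (Or.inr hi)) h.2.1,
        by rw [hb]; exact h.2.2⟩

/-- Both the entry tests and the exit tests of `P` are unambiguous, and `P` changes only registers
of `s`. -/
structure Tidy (P : Prog κ) (s : Set κ) : Prop where
  entry : P.EntryDisjoint
  exit : P.ExitDisjoint
  pushes : P.pushes ⊆ s

theorem Tidy.seq {P Q : Prog κ} {s : Set κ} (hP : P.Tidy s) (hQ : Q.Tidy s) :
    (P.seq Q).Tidy s :=
  ⟨⟨hP.entry, hQ.entry⟩, ⟨hP.exit, hQ.exit⟩, Set.union_subset hP.pushes hQ.pushes⟩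

theorem Tidy.inv {P : Prog κ} {s : Set κ} (hP : P.Tidy s) : P.inv.Tidy s :=
  ⟨hP.exit.inv_entryDisjoint, hP.entry.inv_exitDisjoint, P.pushes_inv.trans_subset hP.pushes⟩

theorem Tidy.mono {P : Prog κ} {s s' : Set κ} (hP : P.Tidy s) (h : s ⊆ s') : P.Tidy s' :=
  ⟨hP.entry, hP.exit, hP.pushes.trans h⟩

theorem Tidy.loop {P : Prog κ} {s : Set κ} (hP : P.Tidy s) {b a d c : κ} {S T U V : Set SignType}
    (h1 : Disjoint S T) (h2 : Disjoint U V) : (Prog.loop b a S T d c U V P).Tidy s :=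
  ⟨⟨h1, hP.entry⟩, ⟨h2, hP.exit⟩, hP.pushes⟩

theorem tidy_push {i : κ} {up : Bool} {s : Set κ} (h : i ∈ s) : (push i up).Tidy s :=
  ⟨trivial, trivial, Set.singleton_subset_iff.2 h⟩

theorem tidy_check {a b : κ} {S : Set SignType} {s : Set κ} : (check b a S).Tidy s :=
  ⟨trivial, trivial, Set.empty_subset s⟩

end Registers

/-! Programs on the registers `0, 1, 2, …`, where register `0` holds the number `0`. -/

/-- Run `B` while `t`, initially `0`, differs from `v`. The body `B` has to increment `t`. -/
def forLoop (t v : ℕ) (B : Prog ℕ) : Prog ℕ := loop t 0 {0} {0}ᶜ t v {0}ᶜ {0} B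

theorem Tidy.forLoop {B : Prog ℕ} {s : Set ℕ} (hB : B.Tidy s) (t v : ℕ) :
    (B.forLoop t v).Tidy s :=
  hB.loop disjoint_compl_right disjoint_compl_left

theorem relSign_eq_zero {κ : Type} {σ : κ → ℤ} {b a : κ} : relSign σ b a = 0 ↔ σ b = σ a := by
  rw [relSign, sign_eq_zero_iff, sub_eq_zero]

/-- A loop that counts `t` from `0` up to the value `n` of `v` runs through given states `ρ 0, …, ρ n`. -/
theorem exec_forLoop {t v : ℕ} {B : Prog ℕ} {n : ℕ} (ρ : ℕ → ℕ → ℤ) (hz : ∀ j ≤ n, ρ j 0 = 0)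
    (ht : ∀ j ≤ n, ρ j t = j) (hv : ∀ j ≤ n, ρ j v = n)
    (hB : ∀ j < n, B.Exec (ρ j) (ρ (j + 1))) : (B.forLoop t v).Exec (ρ 0) (ρ n) := by
  refine ⟨relSign_eq_zero.2 ?_, ?_, relSign_eq_zero.2 ?_⟩
  · rw [ht 0 (by omega), hz 0 (by omega)]; rfl
  · have key : ∀ j ≤ n, Relation.ReflTransGen (fun σ τ => relSign σ t v ∈ ({0}ᶜ : Set SignType) ∧
        B.Exec σ τ ∧ relSign τ t 0 ∈ ({0}ᶜ : Set SignType)) (ρ 0) (ρ j) := by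
      intro j
      induction j with
      | zero => exact fun _ => .refl
      | succ j ih =>
        intro hj
        refine (ih (by omega)).tail ⟨?_, hB j (by omega), ?_⟩
        · rw [Set.mem_compl_singleton_iff, ne_eq, relSign_eq_zero, ht j (by omega),
            hv j (by omega)]
          omega
        · rw [Set.mem_compl_singleton_iff, ne_eq, relSign_eq_zero, ht _ hj, hz _ hj]
          omega
    exact key n le_rfl
  · rw [ht n le_rfl, hv n le_rfl]

theorem exec_push {κ : Type} [DecidableEq κ] {i : κ} {up : Bool} {σ τ : κ → ℤ}
    (hi : τ i = σ i + shiftBy up) (h : ∀ r, r ≠ i → τ r = σ r) : (push i up).Exec σ τ := by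
  refine funext fun r => ?_
  by_cases hr : r = i
  · subst hr; rw [hi, Function.update_self]
  · rw [h r hr, Function.update_of_ne hr]

/-- `y += v`, with a scratch register `t`. -/
def add (v y t : ℕ) : Prog ℕ :=
  seq (forLoop t v (seq (push y true) (push t true))) (forLoop t v (push t true)).inv

theorem tidy_add (v y t : ℕ) : (add v y t).Tidy {y, t} :=
  Tidy.seq (((tidy_push (by simp)).seq (tidy_push (by simp))).forLoop _ _)
    (((tidy_push (by simp)).forLoop _ _).inv)

theorem exec_add {v y t : ℕ} (hvy : v ≠ y) (htv : t ≠ v) (hty : t ≠ y) (ht0 : t ≠ 0) (hy0 : y ≠ 0)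
    {σ : ℕ → ℤ} (h0 : σ 0 = 0) (ht : σ t = 0) {n : ℕ} (hv : σ v = n) :
    (add v y t).Exec σ (Function.update σ y (σ y + n)) := by
  refine ⟨Function.update (Function.update σ y (σ y + n)) t n, ?_, Exec.inv ?_⟩
  · convert exec_forLoop (t := t) (v := v) (n := n)
      (fun j => Function.update (Function.update σ y (σ y + j)) t j) ?_ ?_ ?_ ?_ using 1
    · funext r
      simp only [Function.update_apply]
      grind
    · simp [h0, ht0.symm, hy0.symm]
    · simp
    · simp [hv, htv.symm, hvy]
    · intro j _
      refine ⟨Function.update (Function.update σ y (σ y + (j + 1))) t j, exec_push ?_ ?_,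
        exec_push ?_ ?_⟩ <;> simp only [Function.update_apply, shiftBy] <;> grind
  · convert exec_forLoop (t := t) (v := v) (n := n)
      (fun j => Function.update (Function.update σ y (σ y + n)) t j) ?_ ?_ ?_ ?_ using 1
    · funext r
      simp only [Function.update_apply]
      grind
    · simp [h0, ht0.symm, hy0.symm]
    · simp
    · simp [hv, htv.symm, hvy]
    · intro j _
      refine exec_push ?_ ?_ <;> simp only [Function.update_apply, shiftBy] <;> grind

/-- `d := triPair d m` and `m := 0`, with a scratch register `t`: after `m += d`, the numbers
`m, m - 1, …, 1` are added to `d`. -/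
def pushTri (d m t : ℕ) : Prog ℕ :=
  seq (add d m t) (loop d m {0, -1} {1} m 0 {0}ᶜ {0} (seq (add m d t) (push m false)))

theorem tidy_pushTri (d m t : ℕ) : (pushTri d m t).Tidy {d, m, t} := by
  refine Tidy.seq ((tidy_add d m t).mono (by grind)) (Tidy.loop (((tidy_add m d t).mono ?_).seq
    (tidy_push (by simp))) (by simp) disjoint_compl_left)
  grind

theorem exec_pushTri {d m t : ℕ} (hdm : d ≠ m) (htd : t ≠ d) (htm : t ≠ m) (ht0 : t ≠ 0)
    (hd0 : d ≠ 0) (hm0 : m ≠ 0) {σ : ℕ → ℤ} (h0 : σ 0 = 0) (ht : σ t = 0) {a x : ℕ}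
    (hd : σ d = a) (hm : σ m = x) :
    (pushTri d m t).Exec σ
      (Function.update (Function.update σ d (triPair a x : ℕ)) m 0) := by
  refine ⟨_, exec_add hdm htd htm ht0 hm0 h0 ht hd, ?_, ?_, ?_⟩
  · simp only [relSign, Function.update_self, Function.update_of_ne hdm, hd, hm]
    rcases Nat.eq_zero_or_pos x with rfl | hx
    · simp
    · right
      rw [Set.mem_singleton_iff, sign_eq_neg_one_iff]
      omega
  · have key : ∀ (x a : ℕ) (ρ : ℕ → ℤ), ρ 0 = 0 → ρ t = 0 → ρ d = a → ρ m = x →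
        Relation.ReflTransGen (fun σ τ => relSign σ m 0 ∈ ({0}ᶜ : Set SignType) ∧
          ((add m d t).seq (push m false)).Exec σ τ ∧ relSign τ d m ∈ ({1} : Set SignType)) ρ
          (Function.update (Function.update ρ d ((a + x * (x + 1) / 2 : ℕ) : ℤ)) m 0) := by
      intro x
      induction x with
      | zero =>
        intro a ρ _ _ hd hm
        convert Relation.ReflTransGen.refl using 1
        funext r
        simp only [Function.update_apply]
        grind
      | succ x ih =>
        intro a ρ h0 ht hd hm
        have ih' := ih (a + (x + 1))
          (Function.update (Function.update ρ d ((a + (x + 1) : ℕ) : ℤ)) m x)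
          (by simp [h0, hd0.symm, hm0.symm])
          (by simp [ht, htd, htm]) (by simp [hdm]) (by simp)
        have hT : (x + 1) * (x + 1 + 1) / 2 = x * (x + 1) / 2 + (x + 1) := by
          rw [show (x + 1) * (x + 1 + 1) = x * (x + 1) + (x + 1) * 2 by ring,
            Nat.add_mul_div_right _ _ (by norm_num)]
        refine Relation.ReflTransGen.head ⟨?_, ⟨_, exec_add hdm.symm htm htd ht0 hd0 h0 ht hm,
          exec_push ?_ ?_⟩, ?_⟩ (ih'.trans (Eq.subst ?_ Relation.ReflTransGen.refl))
        · rw [Set.mem_compl_singleton_iff, ne_eq, relSign_eq_zero, hm, h0]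
          omega
        · simp [shiftBy, hdm.symm, hm]
        · intro r hr
          simp only [Function.update_apply, hr, hd, if_false]
          split_ifs <;> simp
        · simp only [relSign, Function.update_self, Function.update_of_ne hdm]
          rw [Set.mem_singleton_iff, sign_eq_one_iff]
          push_cast
          omega
        · funext r
          simp only [Function.update_apply]
          rw [hT]
          split_ifs <;> first | rfl | (push_cast; ring)
    convert key (a + x) a (Function.update σ m (σ m + a)) (by simp [h0, hm0.symm])
      (by simp [ht, htm]) (by simp [hd, hdm]) (by simp [hm, add_comm]) using 1
    funext r
    simp only [Function.update_apply, triPair]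
    grind
  · simp [relSign, h0, hm0.symm, hd0.symm]

end Prog

namespace Prog

/-- `c` is moved to the empty register `a`. -/
def move (c a : ℕ) : Prog ℕ :=
  loop a 0 {0} {0}ᶜ c 0 {0}ᶜ {0} (seq (push c false) (push a true))

theorem tidy_move (c a : ℕ) : (move c a).Tidy {c, a} :=
  ((tidy_push (by simp)).seq (tidy_push (by simp))).loop disjoint_compl_right disjoint_compl_left

theorem exec_move {c a : ℕ} (hca : c ≠ a) (hc0 : c ≠ 0) (ha0 : a ≠ 0) {σ : ℕ → ℤ} (h0 : σ 0 = 0)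
    (ha : σ a = 0) {n : ℕ} (hc : σ c = n) :
    (move c a).Exec σ (Function.update (Function.update σ c 0) a n) := by
  refine ⟨relSign_eq_zero.2 (ha.trans h0.symm), ?_, relSign_eq_zero.2 ?_⟩
  · have key : ∀ j ≤ n, Relation.ReflTransGen (fun σ τ => relSign σ c 0 ∈ ({0}ᶜ : Set SignType) ∧
        (seq (push c false) (push a true)).Exec σ τ ∧ relSign τ a 0 ∈ ({0}ᶜ : Set SignType)) σ
        (Function.update (Function.update σ c ((n : ℤ) - j)) a j) := by
      intro j
      induction j with
      | zero =>
        intro _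
        convert Relation.ReflTransGen.refl using 1
        funext r
        simp only [Function.update_apply]
        grind
      | succ j ih =>
        intro hj
        refine (ih (by omega)).tail ⟨?_, ⟨Function.update (Function.update σ c ((n : ℤ) - (j + 1)))
          a j, exec_push ?_ ?_, exec_push ?_ ?_⟩, ?_⟩
        · rw [Set.mem_compl_singleton_iff, ne_eq, relSign_eq_zero]
          simp [hca, hc0.symm, ha0.symm, h0]
          omega
        · simp [hca, shiftBy]
          ring
        · intro r hr
          simp only [Function.update_apply]
          grind
        · simp [shiftBy]
        · intro r hr
          simp only [Function.update_apply]
          grind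
        · rw [Set.mem_compl_singleton_iff, ne_eq, relSign_eq_zero]
          simp [hc0.symm, ha0.symm, h0]
          omega
    simpa using key n le_rfl
  · simp [hca, hc0.symm, ha0.symm, h0]

/-- `P` adds `f v` to register `o`, where the inputs `v` are in the registers `ins`, and the
registers from `b` on serve as scratch space. -/
def Adds {n : ℕ} (P : Prog ℕ) (f : List.Vector ℕ n → ℕ) (ins : Fin n → ℕ) (o b : ℕ) : Prop :=
  ∀ (σ : ℕ → ℤ) (v : List.Vector ℕ n), σ 0 = 0 → (∀ r, b ≤ r → σ r = 0) →
    (∀ i, σ (ins i) = v.get i) → P.Exec σ (Function.update σ o (σ o + f v))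

/-- A function is compilable if there are reversible programs that add its values to a register. -/
def Compilable {n : ℕ} (f : List.Vector ℕ n → ℕ) : Prop :=
  ∀ (ins : Fin n → ℕ) (o b : ℕ), (∀ i, ins i < b) → o < b → o ≠ 0 → (∀ i, ins i ≠ o) →
    ∃ P : Prog ℕ, P.Tidy (insert o (Set.Ici b)) ∧ P.Adds f ins o b

theorem compilable_get {n : ℕ} (i : Fin n) : Compilable fun v => v.get i := by
  intro ins o b hins ho ho0 hio
  refine ⟨add (ins i) o b, (tidy_add _ _ _).mono ?_, fun σ v h0 hb hv => ?_⟩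
  · rintro r (rfl | rfl) <;> simp
  · exact exec_add (hio i) (hins i).ne' ho.ne' (by omega) ho0 h0 (hb b le_rfl) (hv i)

theorem compilable_succ : Compilable (n := 1) fun v => Nat.succ v.head := by
  intro ins o b hins ho ho0 hio
  obtain ⟨P, hP, hE⟩ := compilable_get 0 ins o b hins ho ho0 hio
  refine ⟨P.seq (push o true), hP.seq (tidy_push (by simp)), fun σ v h0 hb hv => ?_⟩
  refine ⟨_, hE σ v h0 hb hv, exec_push ?_ fun r hr => ?_⟩
  · simp [shiftBy, add_assoc]
  · simp [hr]

theorem compilable_zero : Compilable (n := 0) fun _ => 0 := fun _ o _ _ _ _ _ =>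
  ⟨check 0 0 Set.univ, tidy_check, fun _ _ _ _ _ => ⟨trivial, by simp⟩⟩

/-- Intermediate results in the registers from `b` on are computed, used, and then erased by
running their computation backwards. -/
theorem Tidy.use {G F : Prog ℕ} {o b : ℕ} (hG : G.Tidy (Set.Ici b))
    (hF : F.Tidy (insert o (Set.Ici b))) : (G.seq (F.seq G.inv)).Tidy (insert o (Set.Ici b)) :=
  (hG.mono (Set.subset_insert _ _)).seq (hF.seq (hG.inv.mono (Set.subset_insert _ _)))

theorem Compilable.comp {m n : ℕ} {f : List.Vector ℕ n → ℕ} {g : Fin n → List.Vector ℕ m → ℕ}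
    (hf : Compilable f) (hg : ∀ i, Compilable (g i)) :
    Compilable fun v => f (List.Vector.ofFn fun i => g i v) := by
  intro ins o b hins ho ho0 hio
  -- the state in which the first `j` intermediate results are in the registers from `b` on
  let st (σ : ℕ → ℤ) (v : List.Vector ℕ m) (j : ℕ) : ℕ → ℤ := fun r =>
    if h : r - b < n then if b ≤ r ∧ r < b + j then g ⟨r - b, h⟩ v else σ r else σ r
  have key : ∀ j ≤ n, ∃ G : Prog ℕ, G.Tidy (Set.Ici b) ∧ ∀ (σ : ℕ → ℤ) (v : List.Vector ℕ m),
      σ 0 = 0 → (∀ r, b ≤ r → σ r = 0) → (∀ i, σ (ins i) = v.get i) → G.Exec σ (st σ v j) := by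
    intro j
    induction j with
    | zero =>
      refine fun _ => ⟨check 0 0 Set.univ, tidy_check, fun σ v _ _ _ => ⟨trivial, ?_⟩⟩
      funext r
      simp only [st]
      split_ifs <;> first | rfl | omega
    | succ j ih =>
      intro hj
      obtain ⟨G, hG, hGE⟩ := ih (by omega)
      obtain ⟨P, hP, hPE⟩ := hg ⟨j, hj⟩ ins (b + j) (b + n) (fun i => (hins i).trans_le (by omega))
        (by omega) (by omega) fun i => by have := hins i; omega
      refine ⟨G.seq P, hG.seq (hP.mono ?_), fun σ v h0 hb hv => ⟨_, hGE σ v h0 hb hv, ?_⟩⟩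
      · rintro r (rfl | hr)
        · simp
        · exact Set.Ici_subset_Ici.2 (by omega) hr
      · convert hPE (st σ v j) v ?_ ?_ ?_ using 1
        · funext r
          by_cases hr : r = b + j
          · subst hr
            simp [st, show j < n by omega, hb]
          · simp only [st, Function.update_of_ne hr]
            split_ifs <;> first | rfl | omega
        · simp only [st]
          split_ifs <;> first | exact h0 | omega
        · intro r hr
          simp only [st]
          split_ifs <;> first | exact hb r (by omega) | omega
        · intro i
          rw [← hv i]
          have := hins i
          simp only [st]
          split_ifs <;> first | rfl | omega
  obtain ⟨G, hG, hGE⟩ := key n le_rfl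
  obtain ⟨F, hF, hFE⟩ := hf (fun i => b + i) o (b + n) (fun i => by omega) (by omega) ho0
    fun i => by omega
  refine ⟨G.seq (F.seq G.inv), hG.use (hF.mono ?_), fun σ v h0 hb hv => ?_⟩
  · rintro r (rfl | hr)
    · simp
    · exact Or.inr (Set.Ici_subset_Ici.2 (by omega) hr)
  · refine ⟨_, hGE σ v h0 hb hv, _, hFE _ (List.Vector.ofFn fun i => g i v) ?_ ?_ ?_, Exec.inv ?_⟩
    · simp only [st]
      split_ifs <;> first | exact h0 | omega
    · intro r hr
      simp only [st]
      split_ifs <;> first | exact hb r (by omega) | omega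
    · intro i
      simp [st]
    · convert hGE (Function.update σ o (σ o + f (List.Vector.ofFn fun i => g i v))) v ?_ ?_ ?_
        using 1
      · funext r
        by_cases hr : r = o
        · subst hr
          simp only [st, Function.update_self]
          split_ifs <;> first | rfl | omega
        · simp only [st, Function.update_of_ne hr]
      · rw [Function.update_of_ne ho0.symm, h0]
      · intro r hr
        rw [Function.update_of_ne (show r ≠ o by omega), hb r hr]
      · intro i
        rw [Function.update_of_ne (hio i), hv i]

/-- Primitive recursion: a loop replaces the accumulator by the next value. Since that value cannot
be recomputed from the new accumulator, the old one is kept in a history register, into which it is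
pushed by `triPair`; afterwards the whole loop is undone. -/
theorem Compilable.prec {n : ℕ} {f : List.Vector ℕ n → ℕ} {g : List.Vector ℕ (n + 2) → ℕ}
    (hf : Compilable f) (hg : Compilable g) :
    Compilable fun v : List.Vector ℕ (n + 1) =>
      v.head.rec (f v.tail) fun y IH => g (y ::ᵥ IH ::ᵥ v.tail) := by
  intro ins o b hins ho ho0 hio
  -- registers: `b` accumulator, `b + 1` counter, `b + 2` new value, `b + 3` history
  obtain ⟨F, hF, hFE⟩ := hf (fun i => ins i.succ) b (b + 4) (fun i => (hins _).trans_le (by omega))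
    (by omega) (by omega) fun i => (hins _).ne
  obtain ⟨H, hH, hHE⟩ := hg (Fin.cons (b + 1) (Fin.cons b fun i => ins i.succ)) (b + 2) (b + 4)
    (fun i => by
      refine Fin.cases ?_ (fun i => Fin.cases ?_ (fun i => ?_) i) i
      · simp
      · simp
      · have := hins i.succ
        simp only [Fin.cons_succ]
        omega) (by omega) (by omega) (fun i => by
      refine Fin.cases ?_ (fun i => Fin.cases ?_ (fun i => ?_) i) i
      · simp
      · simp
      · have := hins i.succ
        simp only [Fin.cons_succ]
        omega)
  let B : Prog ℕ :=
    H.seq ((pushTri (b + 3) b (b + 4)).seq ((move (b + 2) b).seq (push (b + 1) true)))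
  let G : Prog ℕ := F.seq (B.forLoop (b + 1) (ins 0))
  have hB : B.Tidy (Set.Ici b) := by
    refine Tidy.seq (hH.mono ?_) (((tidy_pushTri _ _ _).mono ?_).seq
      (((tidy_move _ _).mono ?_).seq (tidy_push (by simp))))
    · rintro r (rfl | hr)
      · simp
      · exact Set.Ici_subset_Ici.2 (by omega) hr
    · rintro r (rfl | rfl | rfl) <;> simp
    · rintro r (rfl | rfl) <;> simp
  have hG : G.Tidy (Set.Ici b) := by
    refine Tidy.seq (hF.mono ?_) (hB.forLoop _ _)
    rintro r (rfl | hr)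
    · simp
    · exact Set.Ici_subset_Ici.2 (by omega) hr
  obtain ⟨acc, hacc⟩ : ∃ acc : List.Vector ℕ (n + 1) → ℕ → ℕ, ∀ v j, acc v j =
    j.rec (f v.tail) fun y IH => g (y ::ᵥ IH ::ᵥ v.tail) := ⟨_, fun _ _ => rfl⟩
  have hacc0 : ∀ v, acc v 0 = f v.tail := fun v => hacc v 0
  have haccS : ∀ v j, acc v (j + 1) = g (j ::ᵥ acc v j ::ᵥ v.tail) := fun v j => by
    rw [hacc, hacc]
  obtain ⟨hist, hhist0, hhistS⟩ : ∃ hist : List.Vector ℕ (n + 1) → ℕ → ℕ, (∀ v, hist v 0 = 0) ∧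
      ∀ v j, hist v (j + 1) = triPair (hist v j) (acc v j) :=
    ⟨fun v j => j.rec 0 fun y h => triPair h (acc v y), fun _ => rfl, fun _ _ => rfl⟩
  simp only [← hacc]
  let st (σ : ℕ → ℤ) (v : List.Vector ℕ (n + 1)) (j : ℕ) : ℕ → ℤ := fun r =>
    if r = b then (acc v j : ℤ) else if r = b + 1 then (j : ℤ) else
      if r = b + 3 then (hist v j : ℤ) else σ r
  have hGE : ∀ (σ : ℕ → ℤ) (v : List.Vector ℕ (n + 1)), σ 0 = 0 → (∀ r, b ≤ r → σ r = 0) →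
      (∀ i, σ (ins i) = v.get i) → G.Exec σ (st σ v v.head) := by
    intro σ v h0 hb hv
    have hst : ∀ j r, r < b → st σ v j r = σ r := by
      intro j r hr
      simp only [st]
      split_ifs <;> first | rfl | omega
    refine ⟨st σ v 0, ?_, exec_forLoop (st σ v) ?_ ?_ ?_ ?_⟩
    · convert hFE σ v.tail h0 (fun r hr => hb r (by omega)) ?_ using 1
      · funext r
        simp only [st, Function.update_apply, hb b le_rfl]
        split_ifs with h1 h2 h3 <;> first | rfl | skip
        · simp [hacc0]
        · rw [h2, hb _ (by omega)]; rfl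
        · rw [h3, hb _ (by omega), hhist0]; rfl
      · intro i
        rw [hv, List.Vector.get_tail_succ]
    · exact fun j _ => (hst j 0 (by omega)).trans h0
    · intro j _
      simp [st]
    · intro j _
      rw [hst j _ (hins 0), hv 0, List.Vector.get_zero]
    · intro j _
      refine ⟨_, hHE (st σ v j) (j ::ᵥ acc v j ::ᵥ v.tail) ?_ ?_ ?_, _,
        exec_pushTri (a := hist v j) (x := acc v j) (by omega) (by omega) (by omega) (by omega)
          (by omega) (by omega) ?_ ?_ ?_ ?_, _,
        exec_move (n := acc v (j + 1)) (by omega) (by omega) (by omega) ?_ ?_ ?_,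
        exec_push ?_ fun r hr => ?_⟩
      · rw [hst j 0 (by omega), h0]
      · intro r hr
        simp only [st]
        split_ifs <;> first | exact hb r (by omega) | omega
      · intro i
        refine Fin.cases ?_ (fun i => Fin.cases ?_ (fun i => ?_) i) i
        · simp [st]
        · simp only [Fin.cons_succ, Fin.cons_zero]
          simp [st]
          rfl
        · simp only [Fin.cons_succ]
          rw [hst j _ (hins _), hv]
          simp
      all_goals
        have s0 : st σ v j 0 = 0 := (hst j 0 (by omega)).trans h0
        have s1 : st σ v j b = acc v j := by simp [st]
        have s3 : st σ v j (b + 2) = 0 := by simp [st, hb]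
        have s4 : st σ v j (b + 3) = hist v j := by simp [st]
        have s5 : st σ v j (b + 4) = 0 := by simp [st, hb]
        have hb0 : 0 ≠ b := by omega
      · simp [s0]
      · simp [s5]
      · simp [s4]
      · simp [s1]
      · simp [s0, hb0]
      · simp
      · simp [s3, haccS]
      · simp [shiftBy, st]
      · have hr' : r = b ∨ r = b + 2 ∨ r = b + 3 ∨ (r ≠ b ∧ r ≠ b + 2 ∧ r ≠ b + 3) := by omega
        rcases hr' with rfl | rfl | rfl | ⟨h1, h2, h3⟩
        · simp [st]
        · simp [st, hb]
        · simp [st, hhistS]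
        · simp [st, h1, h2, h3, hr]
  refine ⟨G.seq ((add b o (b + 4)).seq G.inv), hG.use ((tidy_add _ _ _).mono ?_),
    fun σ v h0 hb hv => ⟨_, hGE σ v h0 hb hv, _, exec_add (n := acc v v.head) (by omega) (by omega)
      (by omega) (by omega) ho0 ?_ ?_ ?_, Exec.inv ?_⟩⟩
  · rintro r (rfl | rfl) <;> simp
  · simp [st, h0, show 0 ≠ b by omega]
  · simp [st, hb]
  · simp [st]
  · convert hGE (Function.update σ o (σ o + acc v v.head)) v ?_ ?_ ?_ using 1
    · funext r
      by_cases hr : r = o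
      · simp [hr, st, ho.ne, show o ≠ b + 1 by omega, show o ≠ b + 3 by omega]
      · simp only [st, Function.update_of_ne hr]
    · rw [Function.update_of_ne ho0.symm, h0]
    · intro r hr
      rw [Function.update_of_ne (show r ≠ o by omega), hb r hr]
    · intro i
      rw [Function.update_of_ne (hio i), hv i]

/-- Every primitive recursive function is computed by reversible programs. -/
theorem compilable_of_primrec' {n : ℕ} {f : List.Vector ℕ n → ℕ} (hf : Nat.Primrec' f) :
    Compilable f := by
  induction hf with
  | zero => exact compilable_zero
  | succ => exact compilable_succ
  | get i => exact compilable_get i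
  | comp g _ _ ihf ihg => exact ihf.comp ihg
  | prec _ _ ihf ihg => exact ihf.prec ihg

end Prog

/-! ### Determinism and countability of space-time diagrams -/

section Diagrams

variable {ι κ W : Type}

/-- The head goes from a state `w` to a state `w'` with `C w w'`. -/
def Chooses (C : W → W → Prop) (r r' : ℤ → Symbol ι W) : Prop :=
  ∃ s h w s' h' w', r = headRow s h w ∧ r' = headRow s' h' w' ∧ C w w'

theorem chooses_headRow {C : W → W → Prop} {s s' : ι → ℤ → SignType} {h h' : ℤ} {w w' : W} :
    Chooses C (headRow s h w) (headRow s' h' w') ↔ C w w' := by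
  constructor
  · rintro ⟨s₁, h₁, w₁, s₂, h₂, w₂, e₁, e₂, hC⟩
    obtain ⟨-, -, rfl⟩ := headRow_inj.1 e₁
    obtain ⟨-, -, rfl⟩ := headRow_inj.1 e₂
    exact hC
  · exact fun hC => ⟨_, _, _, _, _, _, rfl, rfl, hC⟩

variable [DecidableEq κ]

namespace PebbleMachine

/-- A bi-infinite run: a space-time diagram, row by row. -/
def IsRun (M : PebbleMachine κ W) (R : ℤ → ℤ → Symbol (Option κ) W) : Prop :=
  ∀ j, ValidRow (R j) ∧ M.Step (R j) (R (j + 1))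

variable {M : PebbleMachine κ W}

theorem IsRun.eq_of_le (hM : M.Reversible) {R R' : ℤ → ℤ → Symbol (Option κ) W} (hR : M.IsRun R)
    (hR' : M.IsRun R') {T : ℤ} (hT : R T = R' T) {j : ℤ} (hj : j ≤ T) : R j = R' j := by
  obtain ⟨n, rfl⟩ : ∃ n : ℕ, j = T - n := ⟨(T - j).toNat, by omega⟩
  clear hj
  induction n with
  | zero => simpa using hT
  | succ n ih =>
    have e : T - ((n + 1 : ℕ) : ℤ) + 1 = T - n := by push_cast; ring
    refine hM.step_injective (hR _).1 (hR' _).1 (e ▸ (hR (T - ((n + 1 : ℕ) : ℤ))).2) ?_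
    rw [ih]
    exact e ▸ (hR' (T - ((n + 1 : ℕ) : ℤ))).2

/-- If `n` steps lead from `r` to a row of a run, then this run passed through `r`. -/
theorem IsRun.eq_of_steps (hM : M.Reversible) {R : ℤ → ℤ → Symbol (Option κ) W} (hR : M.IsRun R)
    {n : ℕ} {r r' : ℤ → Symbol (Option κ) W} (hr : ValidRow r) (h : M.Steps n r r') {T : ℤ}
    (hT : R (T + n) = r') : R T = r := by
  induction n generalizing r T with
  | zero =>
    have h' : r = r' := h
    simpa [h'] using hT
  | succ n ih =>
    obtain ⟨q, hq, h⟩ := h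
    have h1 : R (T + 1) = q := ih (hq.validRow hr) h (T := T + 1) (by
      rw [← hT]; push_cast; congr 1; ring)
    exact hM.step_injective (hR T).1 hr (h1 ▸ (hR T).2) hq

theorem isSouthwardDeterministic_diagrams (hM : M.Reversible) {A : Type}
    {φ : A → Symbol (Option κ) W} (hφ : Function.Injective φ) :
    IsSouthwardDeterministic (M.diagrams φ) := by
  rintro w y ⟨hy, hyw⟩ z ⟨hz, hzw⟩
  have key : ∀ j, decodedRow φ y j = decodedRow φ z j := by
    intro j
    rcases le_total 1 j with hj | hj
    · funext i
      simp only [decodedRow, hyw i j hj, hzw i j hj]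
    · refine IsRun.eq_of_le hM hy hz (T := 1) ?_ hj
      funext i
      simp only [decodedRow, hyw i 1 le_rfl, hzw i 1 le_rfl]
  funext c
  exact hφ (congrFun (key c.2) c.1)

/-- The alternatives between rules are resolved by checks or by the relation `C`. -/
def Resolves (M : PebbleMachine κ W) (C : W → W → Prop) : Prop :=
  ∀ ⦃w a₁ w₁ a₂ w₂⦄, M.rule w a₁ w₁ → M.rule w a₂ w₂ → (a₁ = a₂ ∧ w₁ = w₂) ∨
    (∃ c S₁ S₂, a₁ = .check c S₁ ∧ a₂ = .check c S₂ ∧ Disjoint S₁ S₂) ∨ ¬ (C w w₁ ↔ C w w₂)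

theorem Resolves.step_unique {C : W → W → Prop} (hC : M.Resolves C)
    {r r₁ r₂ : ℤ → Symbol (Option κ) W} (hr : ValidRow r) (h₁ : M.Step r r₁) (h₂ : M.Step r r₂)
    (h : Chooses C r r₁ ↔ Chooses C r r₂) : r₁ = r₂ := by
  have hidle : (∀ i, (r i).2.sign ≠ 0) → ∀ {q}, M.Step r q → q = r := by
    intro hn q hq
    cases hq with
    | idle _ _ => rfl
    | walk s h w _ _ => exact absurd (by rw [sign_headRow, cut_self]) (hn _)
    | check s h w _ _ w' _ _ _ => exact absurd (by rw [sign_headRow, cut_self]) (hn _)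
    | push s h w b w' _ _ => exact absurd (by rw [sign_headRow, cut_self]) (hn _)
  rcases hr.cases_head with ⟨s, p, w, rfl, -⟩ | hn | hn
  · rcases h₁.forward_cases with ⟨n₁, -, rfl⟩ | ⟨z₁, R₁⟩ <;>
    rcases h₂.forward_cases with ⟨n₂, -, rfl⟩ | ⟨z₂, R₂⟩
    · rfl
    · exact absurd z₂ n₁
    · exact absurd z₁ n₂
    · rcases R₁ with ⟨a₁, S₁, w₁, ru₁, m₁, rfl⟩ | ⟨b₁, w₁, ru₁, rfl⟩ <;>
      rcases R₂ with ⟨a₂, S₂, w₂, ru₂, m₂, rfl⟩ | ⟨b₂, w₂, ru₂, rfl⟩ <;>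
      rw [chooses_headRow, chooses_headRow] at h <;>
      rcases hC ru₁ ru₂ with ⟨ha, rfl⟩ | ⟨c, T₁, T₂, ha₁, ha₂, hd⟩ | hne <;>
      first
      | exact absurd h hne
      | (cases ha; rfl)
      | (cases ha₁; cases ha₂; exact absurd m₂ (Set.disjoint_left.1 hd m₁))
      | (cases ha)
      | (cases ha₁; done)
      | (cases ha₂)
  · rw [hidle (fun i => by simp [hn, HeadMark.sign]) h₁,
      hidle (fun i => by simp [hn, HeadMark.sign]) h₂]
  · rw [hidle (fun i => by simp [hn, HeadMark.sign]) h₁,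
      hidle (fun i => by simp [hn, HeadMark.sign]) h₂]

/-- If every run of a reversible machine makes only finitely many choices in the future, then
there are only countably many runs: a run is determined by one row and the times of the
choices. -/
theorem countable_diagrams [Finite κ] [Finite W] (hM : M.Reversible) {C : W → W → Prop}
    (hC : M.Resolves C)
    (hfin : ∀ R, M.IsRun R → {n : ℕ | Chooses C (R n) (R (n + 1))}.Finite) {A : Type}
    {φ : A → Symbol (Option κ) W} (hφ : Function.Injective φ) : (M.diagrams φ).Countable := by
  have : Countable W := Finite.to_countable
  have hcount : ({r : ℤ → Symbol (Option κ) W | ValidRow r} ×ˢ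
      {E : Set ℕ | E.Finite}).Countable :=
    countable_validRow.prod Set.Countable.ofPred_finite
  refine Set.MapsTo.countable_of_injOn (f := fun x => (decodedRow φ x 0,
    {n : ℕ | Chooses C (decodedRow φ x n) (decodedRow φ x (n + 1))})) ?_ ?_ hcount
  · exact fun x hx => ⟨(hx 0).1, hfin _ hx⟩
  · intro x hx y hy hxy
    obtain ⟨h0, hE⟩ := Prod.mk.inj hxy
    have fut : ∀ n : ℕ, decodedRow φ x n = decodedRow φ y n := by
      intro n
      induction n with
      | zero => exact h0
      | succ n ih =>
        have hn := Set.ext_iff.1 hE n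
        simp only [Set.mem_ofPred_eq] at hn
        push_cast
        refine hC.step_unique (hx n).1 (hx n).2 (ih ▸ (hy n).2) ?_
        rw [hn, ih]
    have key : ∀ j, decodedRow φ x j = decodedRow φ y j := by
      intro j
      rcases le_total 0 j with hj | hj
      · lift j to ℕ using hj
        exact fut j
      · exact IsRun.eq_of_le hM hx hy h0 hj
    funext c
    exact hφ (congrFun (key c.2) c.1)

end PebbleMachine

end Diagrams

namespace Prog

variable {κ : Type}

/-- The step from `e` to `e'` leaves a loop whose exit test is ambiguous. -/
def Choice : (P : Prog κ) → P.Edge → P.Edge → Prop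
  | push _ _ => fun _ _ => False
  | check _ _ _ => fun _ _ => False
  | seq P Q => fun e e' => match e, e' with
    | .inl u, .inl u' => P.Choice u u'
    | .inr v, .inr v' => Q.Choice v v'
    | _, _ => False
  | loop _ _ _ _ _ _ U V P => fun e e' => match e, e' with
    | .inl .mid, .inl .exit => ¬ Disjoint U V
    | .inr u, .inr u' => P.Choice u u'
    | _, _ => False

theorem ExitDisjoint.not_choice {P : Prog κ} (hP : P.ExitDisjoint) (e e' : P.Edge) :
    ¬ P.Choice e e' := by
  induction P with
  | push i up => exact id
  | check b a S => exact id
  | seq P Q ihP ihQ =>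
    rcases e with u | v <;> rcases e' with u' | v'
    · exact ihP hP.1 _ _
    · exact id
    · exact id
    · exact ihQ hP.2 _ _
  | loop b a S T d c U V P ih =>
    rcases e with (_ | _ | _) | u <;> rcases e' with (_ | _ | _) | u' <;>
      first
      | exact id
      | exact ih hP.2 _ _
      | exact not_not_intro hP.1

/-- The only alternatives in a program that checks do not resolve are the exits of loops with an
ambiguous exit test. -/
theorem resolves_choice (P : Prog κ) {e e₁ e₂ : P.Edge} {a₁ a₂ : Action κ} (h₁ : P.Rule e a₁ e₁)
    (h₂ : P.Rule e a₂ e₂) : (a₁ = a₂ ∧ e₁ = e₂) ∨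
    (∃ c S₁ S₂, a₁ = .check c S₁ ∧ a₂ = .check c S₂ ∧ Disjoint S₁ S₂) ∨
      ¬ (P.Choice e e₁ ↔ P.Choice e e₂) := by
  induction P with
  | push i up =>
    obtain ⟨-, rfl, rfl⟩ := h₁
    obtain ⟨-, rfl, rfl⟩ := h₂
    exact Or.inl ⟨rfl, rfl⟩
  | check b a S =>
    obtain ⟨-, rfl, rfl⟩ := h₁
    obtain ⟨-, rfl, rfl⟩ := h₂
    exact Or.inl ⟨rfl, rfl⟩
  | seq P Q ihP ihQ =>
    rcases e with u | v <;> rcases e₁ with u₁ | v₁ <;> rcases e₂ with u₂ | v₂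
    · exact (ihP h₁ h₂).imp (fun h => ⟨h.1, congrArg Sum.inl h.2⟩) id
    · obtain ⟨rfl, -⟩ := h₂
      exact absurd h₁ (not_rule_last _ _ _)
    · obtain ⟨rfl, -⟩ := h₁
      exact absurd h₂ (not_rule_last _ _ _)
    · obtain ⟨-, rfl, rfl⟩ := h₁
      obtain ⟨-, rfl, rfl⟩ := h₂
      exact Or.inl ⟨rfl, rfl⟩
    · exact h₁.elim
    · exact h₁.elim
    · exact h₂.elim
    · exact (ihQ h₁ h₂).imp (fun h => ⟨h.1, congrArg Sum.inr h.2⟩) id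
  | loop b a S T d c U V P ih =>
    rcases e with (_ | _ | _) | u <;> rcases e₁ with (_ | _ | _) | u₁ <;>
      rcases e₂ with (_ | _ | _) | u₂ <;>
      first
      | exact h₁.elim
      | exact h₂.elim
      | (cases h₁; cases h₂; exact Or.inl ⟨rfl, rfl⟩)
      | (obtain ⟨rfl, rfl⟩ := h₁; obtain ⟨rfl, rfl⟩ := h₂; exact Or.inl ⟨rfl, rfl⟩)
      | (obtain ⟨rfl, rfl⟩ := h₁; obtain ⟨-, rfl⟩ := h₂; exact Or.inl ⟨rfl, rfl⟩)
      | (obtain ⟨rfl, -⟩ := h₁; exact absurd h₂ (not_rule_last _ _ _))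
      | (obtain ⟨rfl, -⟩ := h₂; exact absurd h₁ (not_rule_last _ _ _))
      | exact (ih h₁ h₂).imp (fun h => ⟨h.1, congrArg Sum.inr h.2⟩) id
      | skip
    all_goals
      by_cases hd : Disjoint U V
      · right; left
        first
        | (cases h₁; obtain ⟨rfl, rfl⟩ := h₂; exact ⟨_, _, _, rfl, rfl, hd.symm⟩)
        | (cases h₂; obtain ⟨rfl, rfl⟩ := h₁; exact ⟨_, _, _, rfl, rfl, hd⟩)
      · right; right
        first
        | exact fun h => h.1 hd
        | exact fun h => h.2 hd

end Prog

/-! ### The main program -/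

theorem Prog.dst_mem_pushes {κ : Type} (P : Prog κ) (o : κ) {e e' : P.Edge} {b : Bool}
    (h : P.Rule e (.push b) e') : P.dst o e ∈ P.pushes := by
  induction P generalizing o with
  | push i up => obtain ⟨rfl, -, -⟩ := h; rfl
  | check b a S => obtain ⟨-, h, -⟩ := h; cases h
  | seq P Q ihP ihQ =>
    rcases e with u | v <;> rcases e' with u' | v'
    · exact Or.inl (ihP _ h)
    · obtain ⟨-, h, -⟩ := h; cases h
    · exact h.elim
    · exact Or.inr (ihQ _ h)
  | loop b a S T d c U V P ih =>
    rcases e with (_ | _ | _) | u <;> rcases e' with (_ | _ | _) | u' <;>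
      first
      | exact h.elim
      | exact ih _ h
      | (obtain ⟨h, -⟩ := h; cases h; done)
      | (obtain ⟨-, h⟩ := h; cases h)
      | (cases h)

/-- The parameters of the main program: five registers, of which `z` holds `0`, and two
programs. -/
structure Layout (κ : Type) where
  /-- a register that holds `0` -/
  z : κ
  /-- the number of guesses that were made -/
  i : κ
  /-- the number of guesses to be made -/
  k : κ
  /-- the present guess -/
  m : κ
  /-- the running time that is examined -/
  t : κ
  /-- the program that processes a guess -/
  Q : Prog κ
  /-- the program that checks one running time -/
  R : Prog κ

namespace Layout

variable {κ : Type} (D : Layout κ)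

/-- Guess a number: count up from `0` and stop at any time. Stopping requires `i < k`. This is the
only choice that is made in the main program. Since register `i` is incremented after each
guess, only finitely many choices can stop, even in runs that were not properly initialized. -/
def guess : Prog κ := .loop D.m D.z {0} {0}ᶜ D.k D.i Set.univ {1} (.push D.m true)

/-- Guess a number and process it. -/
def phase : Prog κ := .seq D.guess (.seq (.push D.i true) D.Q)

/-- Run `k` phases, and then check all running times, without end. -/
def main : Prog κ := .seq (.loop D.i D.z {0} {0}ᶜ D.i D.k {0}ᶜ {0} D.phase)
  (.loop D.t D.z {0} {0}ᶜ D.t D.z Set.univ ∅ D.R)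

/-- The requirements on the parameters that make the space-time diagrams deterministic into the
past and countable in number. -/
structure Sound : Prop where
  entryQ : D.Q.EntryDisjoint
  exitQ : D.Q.ExitDisjoint
  entryR : D.R.EntryDisjoint
  exitR : D.R.ExitDisjoint
  i_ne_k : D.i ≠ D.k
  m_ne_i : D.m ≠ D.i
  m_ne_k : D.m ≠ D.k
  iQ : D.i ∉ D.Q.pushes
  kQ : D.k ∉ D.Q.pushes
  iR : D.i ∉ D.R.pushes
  kR : D.k ∉ D.R.pushes

/-- The state at the head of the loop over the phases. -/
def phaseMid : D.main.Edge := .inl (.inl .mid)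

/-- The state at the head of the loop of a guess, where the choices are made. -/
def guessMid : D.main.Edge := .inl (.inr (.inl (.inl .mid)))

/-- The state that counts up in a guess. -/
def guessBody : D.main.Edge := .inl (.inr (.inl (.inr false)))

/-- The state after a guess. -/
def guessExit : D.main.Edge := .inl (.inr (.inl (.inl .exit)))

/-- The state in which register `i` is incremented. -/
def incPhase : D.main.Edge := .inl (.inr (.inr (.inl false)))

/-- The state at the head of the loop over the running times. -/
def timeMid : D.main.Edge := .inr (.inl .mid)

variable {D}

theorem Sound.entryDisjoint (hD : D.Sound) : D.main.EntryDisjoint :=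
  ⟨⟨disjoint_compl_right, ⟨disjoint_compl_right, trivial⟩, trivial, hD.entryQ⟩,
    disjoint_compl_right, hD.entryR⟩

theorem Sound.reversible (hD : D.Sound) : D.main.machine.Reversible :=
  hD.entryDisjoint.reversible

theorem resolves : D.main.machine.Resolves D.main.Choice := fun _ _ _ _ _ h₁ h₂ =>
  D.main.resolves_choice h₁ h₂

/-- The only choice of the main program is the decision to stop counting. -/
theorem Sound.choice (hD : D.Sound) {e e' : D.main.Edge} (h : D.main.Choice e e') :
    e = D.guessMid ∧ e' = D.guessExit := by
  rcases e with ((_ | _ | _) | ((_ | _ | _) | _) | _ | e) | (_ | _ | _) | e <;>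
  rcases e' with ((_ | _ | _) | ((_ | _ | _) | _) | _ | e') | (_ | _ | _) | e' <;>
  first
  | exact h.elim
  | exact ⟨rfl, rfl⟩
  | exact absurd h (hD.exitQ.not_choice _ _)
  | exact absurd h (hD.exitR.not_choice _ _)
  | exact absurd disjoint_compl_left h
  | exact absurd (Set.disjoint_empty Set.univ) h

theorem rule_guessMid {a : Action κ} {e : D.main.Edge} (h : D.main.machine.rule D.guessMid a e) :
    (a = .check D.i Set.univ ∧ e = D.guessBody) ∨ (a = .check D.i {1} ∧ e = D.guessExit) := by
  change D.main.Rule _ _ _ at h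
  rcases e with ((_ | _ | _) | ((_ | _ | _) | _) | _ | e) | (_ | _ | _) | e <;>
  first
  | exact h.elim
  | exact Or.inr ⟨h, rfl⟩
  | (obtain ⟨rfl, rfl⟩ := h; exact Or.inl ⟨rfl, rfl⟩)
  | (obtain ⟨h, -⟩ := h; cases h)

theorem rule_guessExit {a : Action κ} {e : D.main.Edge} (h : D.main.machine.rule D.guessExit a e) :
    a = .check D.i Set.univ ∧ e = D.incPhase := by
  change D.main.Rule _ _ _ at h
  rcases e with ((_ | _ | _) | ((_ | _ | _) | _) | (_ | _) | e) | (_ | _ | _) | e <;>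
  first
  | exact h.elim
  | (obtain ⟨-, rfl, h⟩ := h; cases h <;> exact ⟨rfl, rfl⟩)
  | (obtain ⟨h, -⟩ := h; cases h)

theorem rule_incPhase {a : Action κ} {e : D.main.Edge} (h : D.main.machine.rule D.incPhase a e) :
    a = .push true := by
  change D.main.Rule _ _ _ at h
  rcases e with ((_ | _ | _) | ((_ | _ | _) | _) | (_ | _) | e) | (_ | _ | _) | e <;>
  first
  | exact h.elim
  | (obtain ⟨-, h, -⟩ := h; exact h)
  | (obtain ⟨h, -⟩ := h; cases h)

/-- Pebble `k` never moves, and pebble `i` only moves up, after a guess. -/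
theorem Sound.rule_push (hD : D.Sound) {b : Bool} {e e' : D.main.Edge}
    (h : D.main.Rule e (.push b) e') : D.main.machine.dst e ≠ D.k ∧
    (D.main.machine.dst e = D.i → e = D.incPhase ∧ b = true) := by
  rcases e with ((_ | _ | _) | ((_ | _ | _) | (_ | _)) | (_ | _) | e) | (_ | _ | _) | e <;>
  rcases e' with ((_ | _ | _) | ((_ | _ | _) | (_ | _)) | (_ | _) | e') | (_ | _ | _) | e' <;>
  first
  | exact h.elim
  | (obtain ⟨-, h, -⟩ := h; cases h; exact ⟨hD.m_ne_k, fun h => absurd h hD.m_ne_i⟩)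
  | (obtain ⟨-, h, -⟩ := h; cases h; exact ⟨hD.i_ne_k, fun _ => ⟨rfl, rfl⟩⟩)
  | (have h' := D.Q.dst_mem_pushes D.i h
     exact ⟨fun hc => hD.kQ (hc ▸ h'), fun hc => absurd (hc ▸ h') hD.iQ⟩)
  | (have h' := D.R.dst_mem_pushes D.t h
     exact ⟨fun hc => hD.kR (hc ▸ h'), fun hc => absurd (hc ▸ h') hD.iR⟩)
  | (obtain ⟨-, -, h⟩ := h; cases h; done)
  | (obtain ⟨h, -⟩ := h; cases h; done)
  | (obtain ⟨-, h⟩ := h; cases h; done)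
  | (obtain ⟨-, h, -⟩ := h; cases h)
  | (cases h)

variable [DecidableEq κ]

theorem Sound.chooses (hD : D.Sound) {r r' : ℤ → Symbol (Option κ) D.main.Edge}
    (h : D.main.machine.Step r r') (hc : Chooses D.main.Choice r r') : ∃ s h,
      r = headRow s h D.guessMid ∧ r' = headRow s h D.guessExit ∧ s (some D.k) h = 0 ∧
      s (some D.i) h = 1 := by
  obtain ⟨s, p, w, s', p', w', rfl, rfl, hw⟩ := hc
  obtain ⟨rfl, rfl⟩ := hD.choice hw
  rcases h.forward_cases with ⟨-, -, e⟩ | ⟨z, ⟨a, S, w₁, ru, m, e⟩ | ⟨b, w₁, ru, e⟩⟩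
  · obtain ⟨-, -, e⟩ := headRow_inj.1 e
    cases e
  · obtain ⟨rfl, rfl, rfl⟩ := headRow_inj.1 e
    rcases rule_guessMid (D := D) ru with ⟨-, e⟩ | ⟨e, -⟩
    · cases e
    · cases e
      exact ⟨_, _, rfl, rfl, z, m⟩
  · rcases rule_guessMid (D := D) ru with ⟨e, -⟩ | ⟨e, -⟩ <;> cases e

/-- A bound on the progress of the phases: pebble `k` is at `a`, and the number of completed
guesses, as counted by pebble `i` and the state, is at least `p`. -/
def Progress (D : Layout κ) (p a : ℤ) (r : ℤ → Symbol (Option κ) D.main.Edge) : Prop :=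
  ∃ s h w q, r = headRow s h w ∧ s (some D.k) = cut a ∧ s (some D.i) = cut q ∧
    (p ≤ q ∨ (p ≤ q + 1 ∧ (w = D.guessExit ∨ w = D.incPhase)))

theorem Sound.progress_step (hD : D.Sound) {r r' : ℤ → Symbol (Option κ) D.main.Edge} {p a : ℤ}
    (h : D.main.machine.Step r r') (hp : D.Progress p a r) : D.Progress p a r' := by
  obtain ⟨s, x, w, q, rfl, hk, hi, hq⟩ := hp
  rcases h.forward_cases with ⟨-, -, rfl⟩ | ⟨z, ⟨c, S, w₁, ru, m, rfl⟩ | ⟨b, w₁, ru, rfl⟩⟩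
  · exact ⟨_, _, _, q, rfl, hk, hi, hq⟩
  · refine ⟨_, _, _, q, rfl, hk, hi, ?_⟩
    rcases hq with hq | ⟨hq, rfl | rfl⟩
    · exact Or.inl hq
    · exact Or.inr ⟨hq, Or.inr (rule_guessExit (D := D) ru).2⟩
    · cases rule_incPhase (D := D) ru
  · obtain ⟨h1, h2⟩ := hD.rule_push ru
    by_cases hdi : D.main.machine.dst w = D.i
    · obtain ⟨rfl, rfl⟩ := h2 hdi
      rw [hdi, hi, cut_eq_zero] at z
      subst z
      refine ⟨_, _, _, x + 1, rfl, ?_, ?_, Or.inl (by omega)⟩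
      · rw [Function.update_of_ne (by simpa using h1.symm), hk]
      · rw [hdi, Function.update_self]
        rfl
    · refine ⟨_, _, _, q, rfl, ?_, ?_, Or.inl ?_⟩
      · rw [Function.update_of_ne (by simpa using h1.symm), hk]
      · rw [Function.update_of_ne (by simpa using Ne.symm hdi), hi]
      · rcases hq with hq | ⟨hq, rfl | rfl⟩
        · exact hq
        · cases (rule_guessExit (D := D) ru).1
        · exact absurd rfl hdi

/-- Choices require `i < k`, and each of them is followed by an increment of `i`. -/
theorem Sound.progress_choice (hD : D.Sound) {R : ℤ → ℤ → Symbol (Option κ) D.main.Edge}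
    (hR : D.main.machine.IsRun R) {p a : ℤ} {n j : ℕ} (hp : D.Progress p a (R n)) (hj : n ≤ j)
    (hc : Chooses D.main.Choice (R j) (R (j + 1))) :
    ∃ q, p ≤ q ∧ q < a ∧ D.Progress (q + 1) a (R (j + 1)) := by
  have hpj : D.Progress p a (R j) := by
    induction j, hj using Nat.le_induction with
    | base => exact hp
    | succ j hj ih =>
      clear ih hc
      have : ∀ l : ℕ, D.Progress p a (R ((n + l : ℕ) : ℤ)) := by
        intro l
        induction l with
        | zero => exact hp
        | succ l ih => exact_mod_cast hD.progress_step (hR _).2 ih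
      have h := this (j + 1 - n)
      rwa [show n + (j + 1 - n) = j + 1 by omega] at h
  obtain ⟨s, h, e, e', hk, hi⟩ := hD.chooses (hR j).2 hc
  obtain ⟨s₁, h₁, w₁, q, e₁, hk₁, hi₁, hq⟩ := hpj
  obtain ⟨rfl, rfl, rfl⟩ := headRow_inj.1 (e.symm.trans e₁)
  rw [hk₁, cut_eq_zero] at hk
  subst hk
  have hqh : q < h := by
    by_contra hcon
    rcases (not_lt.1 hcon).eq_or_lt with rfl | hlt
    · rw [hi₁, cut_self] at hi; cases hi
    · rw [hi₁, cut_of_lt hlt] at hi; cases hi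
  refine ⟨q, ?_, hqh, s, h, _, q, e', hk₁, hi₁, Or.inr ⟨le_rfl, Or.inl rfl⟩⟩
  rcases hq with hq | ⟨-, hq | hq⟩
  · exact hq
  · cases hq
  · cases hq

/-- A choice is possible only while the progress is below `a`, and it raises the progress by one. -/
theorem Sound.finite_choices_of_progress (hD : D.Sound)
    {R : ℤ → ℤ → Symbol (Option κ) D.main.Edge} (hR : D.main.machine.IsRun R) (a : ℤ) (d : ℕ) :
    ∀ (p : ℤ) (n : ℕ), a - p ≤ d → D.Progress p a (R n) →
      {j : ℕ | n ≤ j ∧ Chooses D.main.Choice (R j) (R (j + 1))}.Finite := by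
  induction d with
  | zero =>
    intro p n hd hp
    convert Set.finite_empty
    refine Set.eq_empty_iff_forall_notMem.2 fun j ⟨hj, hc⟩ => ?_
    obtain ⟨q, hq, hqa, -⟩ := hD.progress_choice hR hp hj hc
    omega
  | succ d ih =>
    intro p n hd hp
    by_cases hex : ∃ j, n ≤ j ∧ Chooses D.main.Choice (R j) (R (j + 1))
    · obtain ⟨j, hj, hc⟩ := hex
      obtain ⟨q, hq, hqa, hp'⟩ := hD.progress_choice hR hp hj hc
      refine ((Set.finite_Iio (j + 1)).union (ih (q + 1) (j + 1) (by omega) ?_)).subset ?_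
      · exact_mod_cast hp'
      · rintro l ⟨-, hl⟩
        rcases lt_or_ge l (j + 1) with h | h
        · exact Or.inl h
        · exact Or.inr ⟨h, hl⟩
    · convert Set.finite_empty
      exact Set.eq_empty_iff_forall_notMem.2 fun j hj => hex ⟨j, hj⟩

/-- A run makes finitely many choices: the head is at pebble `k` in a choice. If pebble `i` is at
infinity, it is not reached after the choice; otherwise the progress is bounded by the position
of pebble `k`. -/
theorem Sound.finite_choices (hD : D.Sound)
    {R : ℤ → ℤ → Symbol (Option κ) D.main.Edge} (hR : D.main.machine.IsRun R) :
    {j : ℕ | Chooses D.main.Choice (R j) (R (j + 1))}.Finite := by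
  by_cases hex : ∃ j : ℕ, Chooses D.main.Choice (R j) (R (j + 1))
  · obtain ⟨j, hc⟩ := hex
    obtain ⟨s, h, e, e', hk, hi⟩ := hD.chooses (hR j).2 hc
    have hs : ∀ l, IsCut (s l) := validRow_headRow.1 (e ▸ (hR j).1)
    by_cases hq : ∃ q, s (some D.i) = cut q
    · obtain ⟨q, hq⟩ := hq
      refine ((Set.finite_Iio j).union (hD.finite_choices_of_progress hR h (h - q).toNat q j
        (by omega) ⟨s, h, _, q, e, (hs _).eq_cut hk, hq, Or.inl le_rfl⟩)).subset fun l hl => ?_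
      rcases lt_or_ge l j with h | h
      · exact Or.inl h
      · exact Or.inr ⟨h, hl⟩
    · -- pebble `i` is at infinity, and the head never reaches it
      have key : ∀ n : ℕ, ∃ h', R (j + 1 + n) = headRow s h' D.guessExit := by
        intro n
        induction n with
        | zero => exact ⟨h, by simpa using e'⟩
        | succ n ih =>
          obtain ⟨h', eh⟩ := ih
          have hst := (hR (j + 1 + n)).2
          rw [eh] at hst
          push_cast
          rw [← add_assoc]
          rcases hst.forward_cases with ⟨-, -, e₁⟩ | ⟨z, -⟩
          · exact ⟨_, e₁⟩
          · exact absurd ⟨h', (hs _).eq_cut z⟩ hq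
      refine (Set.finite_Iio (j + 1)).subset fun l hl => ?_
      by_contra hlj
      obtain ⟨n, rfl⟩ : ∃ n, l = j + 1 + n := Nat.exists_eq_add_of_le (not_lt.1 hlj)
      obtain ⟨h', eh⟩ := key n
      obtain ⟨_, _, e₁, -⟩ := hD.chooses (hR _).2 hl
      push_cast at e₁
      rw [eh] at e₁
      cases (headRow_inj.1 e₁).2.2
  · convert Set.finite_empty
    exact Set.eq_empty_iff_forall_notMem.2 fun j hj => hex ⟨j, hj⟩

end Layout

/-! ### Runs of the main program -/

section Leads

variable {κ W : Type} [DecidableEq κ] {M : PebbleMachine κ W}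

/-- At least one step leads from `r` to `r'`, and none of the steps has an alternative. -/
def PebbleMachine.Leads (M : PebbleMachine κ W) (r r' : ℤ → Symbol (Option κ) W) : Prop :=
  ∃ n, M.DetSteps (n + 1) r r'

theorem PebbleMachine.Leads.trans {r r' r'' : ℤ → Symbol (Option κ) W} (h : M.Leads r r')
    (h' : M.Leads r' r'') : M.Leads r r'' := by
  obtain ⟨m, h⟩ := h
  obtain ⟨n, h'⟩ := h'
  have := h.trans h'
  exact ⟨m + 1 + n, this⟩

end Leads

namespace Layout

variable {κ : Type} {D : Layout κ} [DecidableEq κ]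

/-- Away from the choice of the guess, a rule that fires is the only one. -/
theorem Sound.leads (hD : D.Sound) {e e' : D.main.Edge} {a : Action κ} {σ τ : κ → ℤ}
    (hr : D.main.machine.rule e a e') (ha : a.Fires (D.main.machine.dst e) σ τ)
    (he : e ≠ D.guessMid) :
    D.main.machine.Leads (D.main.machine.arrived e σ) (D.main.machine.arrived e' τ) := by
  refine PebbleMachine.detSteps_of_fires hr ha fun a' e'' τ' hr' ha' => ?_
  rcases resolves hr hr' with ⟨rfl, rfl⟩ | ⟨c, S₁, S₂, rfl, rfl, hd⟩ | hne
  · exact ⟨rfl, rfl⟩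
  · exact absurd ha'.1 (Set.disjoint_left.1 hd ha.1)
  · exact absurd (iff_of_false (fun h => he (hD.choice h).1) fun h => he (hD.choice h).1) hne

end Layout

/-- The registers of the main program, in the order `z`, `i`, `k`, `m`, `t`, `e`, `d`, `y`: here
`e` is the index of a partial recursive function, `d` encodes its argument, and the registers
from `8` on are scratch space. -/
def cfg (e k d i m t y : ℕ) (r : ℕ) : ℤ :=
  if r = 1 then i else if r = 2 then k else if r = 3 then m else if r = 4 then t else
    if r = 5 then e else if r = 6 then d else if r = 7 then y else 0

/-- `1` if the function with index `e` is seen to halt on `d` within time `t`, and `0` otherwise. -/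
def haltBit (e d t : ℕ) : ℕ :=
  bif (Nat.Partrec.Code.evaln t (Denumerable.ofNat Nat.Partrec.Code e) d).isSome then 1 else 0

/-- The layout of the main program with a program `H` that computes `haltBit`. -/
def layout (N : ℕ) (H : Prog (Fin (N + 9))) : Layout (Fin (N + 9)) where
  z := ⟨0, by omega⟩
  i := ⟨1, by omega⟩
  k := ⟨2, by omega⟩
  m := ⟨3, by omega⟩
  t := ⟨4, by omega⟩
  Q := (Prog.pushTri 6 3 8).map (Fin.ofNat (N + 9))
  R := .seq H (.seq (.check ⟨7, by omega⟩ ⟨0, by omega⟩ {0}) (.push ⟨4, by omega⟩ true))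

/-- `H` computes `haltBit` in register `7`. -/
structure Checker {N : ℕ} (H : Prog (Fin (N + 9))) : Prop where
  tidy : H.Tidy {r | 7 ≤ r.val}
  exec : ∀ e k d i t : ℕ, H.Exec (fun r => cfg e k d i 0 t 0 r) fun r =>
    cfg e k d i 0 t (haltBit e d t) r

theorem primrec_haltBit :
    Primrec fun v : List.Vector ℕ 3 => haltBit (v.get 0) (v.get 1) (v.get 2) := by
  have h (j : Fin 3) : Primrec fun v : List.Vector ℕ 3 => v.get j :=
    Primrec.vector_get.comp .id (.const j)
  have h' : Primrec fun v : List.Vector ℕ 3 =>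
      ((v.get 2, Denumerable.ofNat Nat.Partrec.Code (v.get 0)), v.get 1) :=
    ((h 2).pair ((Primrec.ofNat _).comp (h 0))).pair (h 1)
  exact Primrec.cond (Primrec.option_isSome.comp (Nat.Partrec.Code.primrec_evaln.comp h'))
    (Primrec.const 1) (Primrec.const 0)

theorem exists_checker : ∃ (N : ℕ) (H : Prog (Fin (N + 9))), Checker H := by
  obtain ⟨P, hP, hE⟩ := Prog.compilable_of_primrec' (Nat.Primrec'.of_prim primrec_haltBit)
    ![5, 6, 4] 7 8 (by decide) (by decide) (by decide) (by decide)
  obtain ⟨N, hN⟩ := P.finite_regs.bddAbove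
  have hval : ∀ r ∈ P.regs, (Fin.ofNat (N + 9) r).val = r := fun r hr =>
    Nat.mod_eq_of_lt (by have := hN hr; omega)
  have hsub : P.pushes ⊆ P.regs := by
    clear hP hE hN hval
    induction P with
    | push i up => exact subset_rfl
    | check b a S => exact Set.empty_subset _
    | seq P Q ihP ihQ => exact Set.union_subset_union ihP ihQ
    | loop b a S T d c U V P ih => exact ih.trans Set.subset_union_right
  refine ⟨N, P.map (Fin.ofNat (N + 9)), ⟨hP.entry.map _, hP.exit.map _, ?_⟩, ?_⟩
  · rw [Prog.pushes_map]
    rintro _ ⟨r, hr, rfl⟩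
    change 7 ≤ (Fin.ofNat (N + 9) r).val
    rw [hval r (hsub hr)]
    rcases hP.pushes hr with rfl | h
    · rfl
    · exact le_trans (by norm_num) h
  · intro e k d i t
    have h := hE (cfg e k d i 0 t 0) (e ::ᵥ d ::ᵥ t ::ᵥ List.Vector.nil) rfl ?_ ?_
    · have h' := Prog.Exec.map Fin.val_injective hval h
      have key : (fun r : Fin (N + 9) => cfg e k d i 0 t (haltBit e d t) r) =
          Function.update (cfg e k d i 0 t 0) 7 (0 + (haltBit e d t : ℤ)) ∘ Fin.val := by
        funext r
        simp only [Function.comp, Function.update_apply, cfg]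
        split_ifs <;> omega
      rw [key]
      exact h'
    · intro r hr
      simp only [cfg]
      split_ifs <;> first | rfl | omega
    · intro j
      fin_cases j <;> rfl

theorem exec_layout_Q {N : ℕ} (H : Prog (Fin (N + 9))) (e k d i m : ℕ) :
    (layout N H).Q.Exec (fun r => cfg e k d i m 0 0 r)
      fun r => cfg e k (triPair d m) i 0 0 0 r := by
  have h := Prog.Exec.map (f := Fin.ofNat (N + 9)) Fin.val_injective ?_
    (Prog.exec_pushTri (d := 6) (m := 3) (t := 8) (by decide) (by decide) (by decide) (by decide)
      (by decide) (by decide) (σ := cfg e k d i m 0 0) rfl rfl (a := d) (x := m) rfl rfl)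
  · have key : (fun r : Fin (N + 9) => cfg e k (triPair d m) i 0 0 0 r) =
        Function.update (Function.update (cfg e k d i m 0 0) 6 (triPair d m : ℕ)) 3 0 ∘
          Fin.val := by
      funext r
      simp only [Function.comp, Function.update_apply, cfg]
      split_ifs <;> omega
    rw [key]
    exact h
  · intro r hr
    have hr' : r ≤ 8 := by
      simp only [Prog.pushTri, Prog.add, Prog.forLoop, Prog.inv, Prog.regs, Set.mem_union,
        Set.mem_insert_iff, Set.mem_singleton_iff] at hr
      omega
    exact Nat.mod_eq_of_lt (by omega)

theorem Checker.sound {N : ℕ} {H : Prog (Fin (N + 9))} (hH : Checker H) : (layout N H).Sound := by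
  have hQ := (Prog.tidy_pushTri 6 3 8)
  have hQp : ∀ r ∈ (layout N H).Q.pushes, 3 ≤ r.val := by
    intro r hr
    obtain ⟨l, hl, rfl⟩ := (Prog.pushes_map _ _).subset hr
    rcases hQ.pushes hl with rfl | rfl | rfl
    · exact (show 3 ≤ 6 % (N + 9) by rw [Nat.mod_eq_of_lt (by omega)]; omega)
    · exact (show 3 ≤ 3 % (N + 9) by rw [Nat.mod_eq_of_lt (by omega)])
    · exact (show 3 ≤ 8 % (N + 9) by rw [Nat.mod_eq_of_lt (by omega)]; omega)
  have hRp : ∀ r ∈ (layout N H).R.pushes, 3 ≤ r.val := by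
    rintro r (hr | hr | hr)
    · exact le_trans (by norm_num) (hH.tidy.pushes hr)
    · exact hr.elim
    · cases hr
      exact (by norm_num)
  refine ⟨hQ.entry.map _, hQ.exit.map _, ⟨hH.tidy.entry, trivial, trivial⟩,
    ⟨hH.tidy.exit, trivial, trivial⟩, ?_, ?_, ?_, fun h => ?_, fun h => ?_, fun h => ?_,
    fun h => ?_⟩
  · exact fun h => absurd (congrArg Fin.val h) (show ¬ 1 = 2 by decide)
  · exact fun h => absurd (congrArg Fin.val h) (show ¬ 3 = 1 by decide)
  · exact fun h => absurd (congrArg Fin.val h) (show ¬ 3 = 2 by decide)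
  · exact absurd (hQp _ h) (show ¬ 3 ≤ 1 by decide)
  · exact absurd (hQp _ h) (show ¬ 3 ≤ 2 by decide)
  · exact absurd (hRp _ h) (show ¬ 3 ≤ 1 by decide)
  · exact absurd (hRp _ h) (show ¬ 3 ≤ 2 by decide)

namespace Checker

variable {N : ℕ} {H : Prog (Fin (N + 9))}

/-- The machine of the main program. -/
abbrev machine (_ : Checker H) : PebbleMachine (Fin (N + 9)) (layout N H).main.Edge :=
  (layout N H).main.machine

/-- The row in which the head has arrived at the goal of state `w`, with given register contents. -/
noncomputable def conf (_ : Checker H) (w : (layout N H).main.Edge) (e k d i m t y : ℕ) :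
    ℤ → Symbol (Option (Fin (N + 9))) (layout N H).main.Edge :=
  (layout N H).main.machine.arrived w fun r => cfg e k d i m t y r

variable (hH : Checker H)

theorem update_eq {e k d i m t y e' k' d' i' m' t' y' : ℕ} {r : Fin (N + 9)} {v : ℤ}
    (h : ∀ l : ℕ, cfg e' k' d' i' m' t' y' l = if l = r then v else cfg e k d i m t y l) :
    (fun l : Fin (N + 9) => cfg e' k' d' i' m' t' y' l) =
      Function.update (fun l : Fin (N + 9) => cfg e k d i m t y l) r v := by
  funext l
  rw [h, Function.update_apply]
  simp only [Fin.ext_iff]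

theorem leads_start (e k d : ℕ) : hH.machine.Leads (hH.conf (layout N H).main.first e k d 0 0 0 0)
    (hH.conf (layout N H).phaseMid e k d 0 0 0 0) :=
  hH.sound.leads (a := .check (layout N H).z {0}) rfl ⟨Prog.relSign_eq_zero.2 rfl, rfl⟩ nofun

theorem leads_guess {e k d i : ℕ} (hik : i ≠ k) :
    hH.machine.Leads (hH.conf (layout N H).phaseMid e k d i 0 0 0)
      (hH.conf (layout N H).guessMid e k d i 0 0 0) := by
  refine PebbleMachine.Leads.trans (r' := hH.conf (.inl (.inr (.inl (.inl .entry)))) e k d i 0 0 0)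
    (hH.sound.leads (a := .check (layout N H).k {0}ᶜ) ⟨rfl, rfl⟩ ⟨?_, rfl⟩ nofun)
    (hH.sound.leads (a := .check (layout N H).z {0}) rfl ⟨Prog.relSign_eq_zero.2 rfl, rfl⟩ nofun)
  intro h
  have h' : (i : ℤ) = k := Prog.relSign_eq_zero.1 h
  omega

/-- The row after the decision to continue counting, and after the decision to stop. -/
noncomputable def decision (_ : Checker H) (w : (layout N H).main.Edge) (e k d i m : ℕ) :
    ℤ → Symbol (Option (Fin (N + 9))) (layout N H).main.Edge :=
  headRow (layers fun r : Fin (N + 9) => cfg e k d i m 0 0 r) k w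

/-- At the decision, the machine either continues counting or stops. -/
theorem step_guess {e k d i m : ℕ}
    {r : ℤ → Symbol (Option (Fin (N + 9))) (layout N H).main.Edge}
    (h : hH.machine.Step (hH.conf (layout N H).guessMid e k d i m 0 0) r) :
    r = hH.decision (layout N H).guessBody e k d i m ∨
      r = hH.decision (layout N H).guessExit e k d i m := by
  obtain ⟨a, w, τ, hr, hf, rfl⟩ := PebbleMachine.step_arrived_iff.1 h
  rcases Layout.rule_guessMid hr with ⟨rfl, rfl⟩ | ⟨rfl, rfl⟩
  · obtain ⟨-, rfl⟩ := hf
    exact Or.inl rfl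
  · obtain ⟨-, rfl⟩ := hf
    exact Or.inr rfl

theorem step_continue (e k d i m : ℕ) :
    hH.machine.Step (hH.conf (layout N H).guessMid e k d i m 0 0)
      (hH.decision (layout N H).guessBody e k d i m) :=
  PebbleMachine.step_arrived_iff.2 ⟨.check (layout N H).i Set.univ, (layout N H).guessBody, _,
    ⟨rfl, rfl⟩,
    ⟨trivial, rfl⟩, rfl⟩

theorem step_stop {e k d i : ℕ} (m : ℕ) (hik : i < k) :
    hH.machine.Step (hH.conf (layout N H).guessMid e k d i m 0 0)
      (hH.decision (layout N H).guessExit e k d i m) := by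
  refine PebbleMachine.step_arrived_iff.2
    ⟨.check (layout N H).i {1}, (layout N H).guessExit, _, rfl, ⟨?_, rfl⟩, rfl⟩
  refine sign_eq_one_iff.2 ?_
  change 0 < (k : ℤ) - i
  omega

theorem leads_continue (e k d i m : ℕ) :
    ∃ n, hH.machine.DetSteps n (hH.decision (layout N H).guessBody e k d i m)
      (hH.conf (layout N H).guessMid e k d i (m + 1) 0 0) := by
  obtain ⟨n₁, h₁⟩ := PebbleMachine.detSteps_walk (M := hH.machine) (w := (layout N H).guessBody)
    (l := (layout N H).k) rfl fun r => cfg e k d i m 0 0 r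
  have hpush : hH.machine.Leads (hH.conf (layout N H).guessBody e k d i m 0 0)
      (hH.conf (.inl (.inr (.inl (.inr true)))) e k d i (m + 1) 0 0) :=
    hH.sound.leads (a := .push true) ⟨rfl, rfl, rfl⟩ (update_eq fun l => by
      change _ = if l = 3 then (m : ℤ) + 1 else _
      simp only [cfg]
      split_ifs <;> omega) nofun
  have hback : hH.machine.Leads (hH.conf (.inl (.inr (.inl (.inr true)))) e k d i (m + 1) 0 0)
      (hH.conf (layout N H).guessMid e k d i (m + 1) 0 0) := by
    refine hH.sound.leads (a := .check (layout N H).z {0}ᶜ) ⟨rfl, rfl⟩ ⟨fun h => ?_, rfl⟩ nofun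
    have h' : ((m + 1 : ℕ) : ℤ) = 0 := Prog.relSign_eq_zero.1 h
    omega
  obtain ⟨n₂, h₂⟩ := hpush.trans hback
  exact ⟨_, h₁.trans h₂⟩

theorem leads_stop (e k d i m : ℕ) :
    ∃ n, hH.machine.DetSteps n (hH.decision (layout N H).guessExit e k d i m)
      (hH.conf (layout N H).phaseMid e k (triPair d m) (i + 1) 0 0 0) := by
  obtain ⟨n₁, h₁⟩ := PebbleMachine.detSteps_walk (M := hH.machine) (w := (layout N H).guessExit)
    (l := (layout N H).k) rfl fun r => cfg e k d i m 0 0 r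
  have hinc : hH.machine.Leads (hH.conf (layout N H).incPhase e k d i m 0 0)
      (hH.conf (.inl (.inr (.inr (.inl true)))) e k d (i + 1) m 0 0) :=
    hH.sound.leads (a := .push true) ⟨rfl, rfl, rfl⟩ (update_eq fun l => by
      change _ = if l = 1 then (i : ℤ) + 1 else _
      simp only [cfg]
      split_ifs <;> omega) nofun
  have hQ : hH.machine.Leads (hH.conf (.inl (.inr (.inr (.inr (layout N H).Q.first)))) e k d
      (i + 1) m 0 0) (hH.conf (.inl (.inr (.inr (.inr (layout N H).Q.last)))) e k (triPair d m)
      (i + 1) 0 0 0) := by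
    refine (exec_layout_Q H e k d (i + 1) m).detSteps
      (φ := fun u => (.inl (.inr (.inr (.inr u))) : (layout N H).main.Edge)) (layout N H).i
      (fun _ _ _ h => h) ?_ (fun _ _ => rfl) hH.sound.exitQ
    intro u a w hu hr
    rcases w with ((_ | _ | _) | ((_ | _ | _) | (_ | _)) | (_ | _) | u') | (_ | _ | _) | u' <;>
    first
    | exact hr.elim
    | exact ⟨_, rfl, hr⟩
    | (obtain ⟨hr, -⟩ := hr; exact absurd (Sum.inr.inj (Sum.inr.inj hr)) hu)
    | (obtain ⟨hr, -⟩ := hr; cases hr)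
  have hinit : hH.machine.Leads (hH.conf (layout N H).guessExit e k d i m 0 0)
      (hH.conf (layout N H).incPhase e k d i m 0 0) :=
    hH.sound.leads (a := .check (layout N H).i Set.univ) ⟨rfl, rfl, rfl⟩ ⟨trivial, rfl⟩ nofun
  have hcall : hH.machine.Leads (hH.conf (.inl (.inr (.inr (.inl true)))) e k d (i + 1) m 0 0)
      (hH.conf (.inl (.inr (.inr (.inr (layout N H).Q.first)))) e k d (i + 1) m 0 0) :=
    hH.sound.leads (a := .check (layout N H).Q.start Set.univ) ⟨rfl, rfl, rfl⟩ ⟨trivial, rfl⟩ nofun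
  have hback : hH.machine.Leads (hH.conf (.inl (.inr (.inr (.inr (layout N H).Q.last)))) e k
      (triPair d m) (i + 1) 0 0 0)
      (hH.conf (layout N H).phaseMid e k (triPair d m) (i + 1) 0 0 0) := by
    refine hH.sound.leads (a := .check (layout N H).z {0}ᶜ) ⟨rfl, rfl⟩ ⟨fun h => ?_, rfl⟩ nofun
    have hd : (layout N H).main.machine.dst (.inl (.inr (.inr (.inr (layout N H).Q.last)))) =
      (layout N H).i := Prog.dst_last _ _
    rw [hd] at h
    have h' : ((i + 1 : ℕ) : ℤ) = 0 := Prog.relSign_eq_zero.1 h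
    omega
  obtain ⟨n₂, h₂⟩ := hinit.trans (hinc.trans (hcall.trans (hQ.trans hback)))
  exact ⟨_, h₁.trans h₂⟩

theorem leads_times (e k d : ℕ) :
    hH.machine.Leads (hH.conf (layout N H).phaseMid e k d k 0 0 0)
      (hH.conf (layout N H).timeMid e k d k 0 0 0) :=
  PebbleMachine.Leads.trans (r' := hH.conf (.inl (.inl .exit)) e k d k 0 0 0)
    (hH.sound.leads (a := .check (layout N H).k {0}) rfl ⟨Prog.relSign_eq_zero.2 rfl, rfl⟩ nofun)
    (PebbleMachine.Leads.trans (r' := hH.conf (.inr (.inl .entry)) e k d k 0 0 0)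
    (hH.sound.leads (a := .check (layout N H).t Set.univ) ⟨rfl, rfl, rfl⟩ ⟨trivial, rfl⟩ nofun)
    (hH.sound.leads (a := .check (layout N H).z {0}) rfl ⟨Prog.relSign_eq_zero.2 rfl, rfl⟩ nofun))

/-- The edge at which `haltBit` is compared with `0`. -/
def test (_ : Checker H) : (layout N H).main.Edge := .inr (.inr (.inr (.inl false)))

theorem leads_test (e k d i t : ℕ) :
    hH.machine.Leads (hH.conf (layout N H).timeMid e k d i 0 t 0)
      (hH.conf hH.test e k d i 0 t (haltBit e d t)) := by
  have hE : hH.machine.Leads (hH.conf (.inr (.inr (.inl H.first))) e k d i 0 t 0)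
      (hH.conf (.inr (.inr (.inl H.last))) e k d i 0 t (haltBit e d t)) := by
    refine (hH.exec e k d i t).detSteps
      (φ := fun u => (.inr (.inr (.inl u)) : (layout N H).main.Edge)) ⟨7, by omega⟩
      (fun _ _ _ h => h) ?_ (fun _ _ => rfl) hH.tidy.exit
    intro u a w hu hr
    rcases w with ((_ | _ | _) | ((_ | _ | _) | (_ | _)) | (_ | _) | u') |
      (_ | _ | _) | u' | (_ | _) | (_ | _) <;>
    first
    | exact hr.elim
    | exact ⟨_, rfl, hr⟩
    | (obtain ⟨hr, -⟩ := hr; exact absurd hr hu)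
    | (obtain ⟨hr, -⟩ := hr; cases hr)
  exact PebbleMachine.Leads.trans (r' := hH.conf (.inr (.inr (.inl H.first))) e k d i 0 t 0)
    (hH.sound.leads (a := .check (layout N H).z Set.univ) ⟨rfl, rfl⟩ ⟨trivial, rfl⟩ nofun)
    (hE.trans (hH.sound.leads (a := .check ⟨7, by omega⟩ Set.univ) ⟨rfl, rfl, rfl⟩
      ⟨trivial, rfl⟩ nofun))

theorem leads_time {e k d i t : ℕ} (ht : haltBit e d t = 0) :
    hH.machine.Leads (hH.conf (layout N H).timeMid e k d i 0 t 0)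
      (hH.conf (layout N H).timeMid e k d i 0 (t + 1) 0) := by
  have h := hH.leads_test e k d i t
  rw [ht] at h
  refine h.trans (PebbleMachine.Leads.trans
    (r' := hH.conf (.inr (.inr (.inr (.inl true)))) e k d i 0 t 0)
    (hH.sound.leads (a := .check (layout N H).z {0}) ⟨rfl, rfl, rfl⟩
      ⟨Prog.relSign_eq_zero.2 rfl, rfl⟩ nofun)
    (PebbleMachine.Leads.trans (r' := hH.conf (.inr (.inr (.inr (.inr false)))) e k d i 0 t 0)
    (hH.sound.leads (a := .check (layout N H).t Set.univ) ⟨rfl, rfl, rfl⟩ ⟨trivial, rfl⟩ nofun)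
    (PebbleMachine.Leads.trans
      (r' := hH.conf (.inr (.inr (.inr (.inr true)))) e k d i 0 (t + 1) 0)
      (hH.sound.leads (a := .push true) ⟨rfl, rfl, rfl⟩ (update_eq fun l => ?_) nofun)
      (hH.sound.leads (a := .check (layout N H).z {0}ᶜ) ⟨rfl, rfl⟩ ⟨fun h => ?_, rfl⟩ nofun))))
  · change _ = if l = 4 then (t : ℤ) + 1 else _
    simp only [cfg]
    split_ifs <;> omega
  · have h' : ((t + 1 : ℕ) : ℤ) = 0 := Prog.relSign_eq_zero.1 h
    omega

/-- The machine gets stuck if the function halts within the time that is examined. -/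
theorem not_step_test {e k d i t y : ℕ} (hy : y ≠ 0)
    {r : ℤ → Symbol (Option (Fin (N + 9))) (layout N H).main.Edge} :
    ¬ hH.machine.Step (hH.conf hH.test e k d i 0 t y) r := by
  intro h
  obtain ⟨a, w, τ, hr, hf, rfl⟩ := PebbleMachine.step_arrived_iff.1 h
  have ha : a = .check (layout N H).z {0} := by
    rcases w with ((_ | _ | _) | ((_ | _ | _) | (_ | _)) | (_ | _) | u') |
      (_ | _ | _) | u' | (_ | _) | (_ | _) <;>
    first
    | exact hr.elim
    | (obtain ⟨-, hr, -⟩ := hr; exact hr)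
    | (obtain ⟨hr, -⟩ := hr; cases hr)
  subst ha
  have h' : (y : ℤ) = 0 := Prog.relSign_eq_zero.1 hf.1
  omega

end Checker

/-! ### Fans of isolated points -/

/-- Let `S` be a clopen subset of a closed set `D`, up to a part outside `D`, that is covered by
clopen sets `F m`, each with at most one point in `D`, and one further point. Then at most that
point can be an accumulation point of `D` in `S`, and it is one iff infinitely many `F m` meet
`D`. -/
theorem relDerivedSet_fan {Y : Type*} [TopologicalSpace Y] [CompactSpace Y] [T2Space Y]
    {D S N O : Set Y} {F O' : ℕ → Set Y} (hD : IsClosed D) (hS : IsClosed S) (hO : IsOpen O)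
    (hSO : D ∩ O ⊆ S) (hSO' : S ⊆ O) (hO' : ∀ m, IsOpen (O' m)) (hFO : ∀ m, D ∩ O' m ⊆ F m)
    (hFO' : ∀ m, F m ⊆ O' m) (hF : ∀ m, (F m ∩ D).Subsingleton) (hFS : ∀ m, F m ⊆ S)
    (hdisj : ∀ m m', m ≠ m' → Disjoint (F m) (F m')) (hN : N.Subsingleton)
    (hcov : S ⊆ N ∪ ⋃ m, F m) :
    (S ∩ relDerivedSet D).Subsingleton ∧
      ((S ∩ relDerivedSet D).Nonempty ↔ {m | (F m ∩ D).Nonempty}.Infinite) := by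
  have hacc : ∀ x ∈ S ∩ relDerivedSet D, x ∈ N := by
    rintro x ⟨hxS, hx, hxD⟩
    refine (hcov hxS).resolve_right fun hx' => ?_
    obtain ⟨m, hm⟩ := Set.mem_iUnion.1 hx'
    obtain ⟨y, ⟨hy, hyD⟩, hne⟩ := accPt_iff_nhds.1 (mem_derivedSet.1 hx) _
      ((hO' m).mem_nhds (hFO' m hm))
    exact hne (hF m ⟨hFO m ⟨hyD, hy⟩, hyD⟩ ⟨hm, hxD⟩)
  refine ⟨hN.anti hacc, ?_, fun hinf => ?_⟩
  · rintro ⟨x, hx⟩ hfin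
    have hxN := hacc x hx
    obtain ⟨hxS, hx, hxD⟩ := hx
    -- otherwise `x` would be isolated from the finitely many other points of `D` in `S`
    have hfin' : ((S ∩ D) \ {x}).Finite := by
      refine (Set.Finite.biUnion hfin fun m _ => (hF m).finite).subset ?_
      rintro y ⟨⟨hyS, hyD⟩, hyx⟩
      rcases hcov hyS with hy | hy
      · exact absurd (hN hy hxN) hyx
      · obtain ⟨m, hm⟩ := Set.mem_iUnion.1 hy
        exact Set.mem_biUnion (show (F m ∩ D).Nonempty from ⟨y, hm, hyD⟩) ⟨hm, hyD⟩
    obtain ⟨y, ⟨⟨hyO, hy⟩, hyD⟩, hne⟩ := accPt_iff_nhds.1 (mem_derivedSet.1 hx) _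
      ((hO.sdiff hfin'.isClosed).mem_nhds ⟨hSO' hxS, fun h => h.2 rfl⟩)
    exact hy ⟨⟨hSO ⟨hyD, hyO⟩, hyD⟩, hne⟩
  · have hne : ∀ m : {m | (F m ∩ D).Nonempty}, ∃ y, y ∈ F m ∩ D := fun m => m.2
    choose y hy using hne
    have hinj : Function.Injective y := by
      intro m m' h
      by_contra hmm
      exact Set.disjoint_left.1 (hdisj m m' fun h => hmm (Subtype.ext h)) (hy m).1
        (h ▸ (hy m').1)
    have : Infinite {m | (F m ∩ D).Nonempty} := hinf.to_subtype
    obtain ⟨x, hxK, hx⟩ := (Set.infinite_range_of_injective hinj).exists_accPt_of_subset_isCompact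
      (hS.inter hD).isCompact (by
        rintro _ ⟨m, rfl⟩
        exact ⟨hFS m (hy m).1, (hy m).2⟩)
    refine ⟨x, hxK.1, mem_derivedSet.2 (hx.mono ?_), hxK.2⟩
    rw [Filter.le_principal_iff, Filter.mem_principal]
    rintro _ ⟨m, rfl⟩
    exact (hy m).2

/-! ### Space-time diagrams through a given row -/

namespace PebbleMachine

variable {κ W : Type} {M : PebbleMachine κ W}

section DecodedRow

variable {A : Type} (φ : A ≃ Symbol (Option κ) W)

variable [TopologicalSpace A] [DiscreteTopology A]

theorem isOpen_decodedRow_eq (T i : ℤ) (a : Symbol (Option κ) W) :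
    IsOpen {x : ℤ × ℤ → A | decodedRow φ x T i = a} := by
  have hc : Continuous fun x : ℤ × ℤ → A => x (i, T) := continuous_apply _
  exact (isOpen_discrete {b | φ b = a}).preimage hc

theorem isClosed_decodedRow_eq (T : ℤ) (r : ℤ → Symbol (Option κ) W) :
    IsClosed {x : ℤ × ℤ → A | decodedRow φ x T = r} := by
  have : {x : ℤ × ℤ → A | decodedRow φ x T = r} = ⋂ i, {x | decodedRow φ x T i = r i} := by
    ext x
    simp only [Set.mem_iInter]
    exact funext_iff
  rw [this]
  refine isClosed_iInter fun i => ?_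
  have hc : Continuous fun x : ℤ × ℤ → A => x (i, T) := continuous_apply _
  exact (isClosed_discrete {b | φ b = r i}).preimage hc

end DecodedRow

variable [DecidableEq κ]

/-- The successors of a given row are distinguished by finitely many cells. -/
theorem Step.exists_window {r : ℤ → Symbol (Option κ) W} (hr : ValidRow r) : ∃ F : Finset ℤ,
    ∀ q q', M.Step r q → M.Step r q' → (∀ i ∈ F, q i = q' i) → q = q' := by
  rcases hr.cases_head with ⟨s, h, w, rfl, -⟩ | hn | hn
  · refine ⟨Finset.Icc (h - 1) (h + 1), fun q q' hq hq' hF => funext fun i => ?_⟩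
    by_cases hi : i ∈ Finset.Icc (h - 1) (h + 1)
    · exact hF i hi
    · have hfar : ∀ k, i - 1 ≤ k → k ≤ i + 1 → (headRow s h w k).2.sign ≠ 0 := by
        intro k hk1 hk2
        rw [sign_headRow, ne_eq, cut_eq_zero]
        rw [Finset.mem_Icc] at hi
        omega
      rw [hq.eq_of_far hr hfar, hq'.eq_of_far hr hfar]
  all_goals
    refine ⟨∅, fun q q' hq hq' _ => funext fun i => ?_⟩
    have hfar : ∀ k, i - 1 ≤ k → k ≤ i + 1 → (r k).2.sign ≠ 0 := fun k _ _ => by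
      simp [hn, HeadMark.sign]
    rw [hq.eq_of_far hr hfar, hq'.eq_of_far hr hfar]

variable {A : Type} (φ : A ≃ Symbol (Option κ) W)

/-- The space-time diagrams with row `r` at time `T`. -/
def through (M : PebbleMachine κ W) (T : ℤ) (r : ℤ → Symbol (Option κ) W) : Set (ℤ × ℤ → A) :=
  {x | x ∈ M.diagrams φ ∧ decodedRow φ x T = r}

variable [TopologicalSpace A] [DiscreteTopology A]

/-- The row at time `T` being `r` is an open condition on space-time diagrams. -/
def IsOpenAt (M : PebbleMachine κ W) (T : ℤ) (r : ℤ → Symbol (Option κ) W) : Prop :=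
  ∃ O : Set (ℤ × ℤ → A), IsOpen O ∧ M.diagrams φ ∩ O ⊆ M.through φ T r ∧ M.through φ T r ⊆ O

variable {φ}

/-- A row that is reached from an open row is open: as the machine is reversible, seeing the row
means to see all choices that were made since, and these are visible in finitely many cells. -/
theorem IsOpenAt.of_steps (hM : M.Reversible) {n : ℕ} {r r' : ℤ → Symbol (Option κ) W}
    (hr : ValidRow r) (h : M.Steps n r r') {T : ℤ} (hT : M.IsOpenAt φ T r) :
    M.IsOpenAt φ (T + n) r' := by
  induction n generalizing r T with
  | zero =>
    have h' : r = r' := h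
    simpa [← h'] using hT
  | succ n ih =>
    obtain ⟨q, hq, h⟩ := h
    obtain ⟨F, hF⟩ := Step.exists_window (M := M) hr
    obtain ⟨O, hO, h1, h2⟩ := hT
    have key : M.IsOpenAt φ (T + 1) q := by
      refine ⟨O ∩ ⋂ i ∈ F, {x | decodedRow φ x (T + 1) i = q i},
        hO.inter (isOpen_biInter_finset fun i _ => isOpen_decodedRow_eq φ _ _ _), ?_, ?_⟩
      · rintro x ⟨hx, hxO, hxF⟩
        have hxr := (h1 ⟨hx, hxO⟩).2
        refine ⟨hx, hF _ _ (hxr ▸ (hx T).2) hq fun i hi => ?_⟩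
        exact Set.mem_iInter₂.1 hxF i hi
      · rintro x ⟨hx, hxq⟩
        refine ⟨h2 ⟨hx, hM.step_injective (hx T).1 hr (hxq ▸ (hx T).2) hq⟩, ?_⟩
        exact Set.mem_iInter₂.2 fun i _ => congrFun hxq i
    have := ih (hq.validRow hr) h key
    rwa [add_assoc, add_comm 1 (n : ℤ), ← Nat.cast_succ] at this

/-- A diagram that passes through an infinite sequence of rows without alternatives is unique. -/
theorem IsRun.eq_of_leads (hM : M.Reversible) {R R' : ℤ → ℤ → Symbol (Option κ) W} (hR : M.IsRun R)
    (hR' : M.IsRun R') {B : ℕ → ℤ → Symbol (Option κ) W} (hB : ∀ s, M.Leads (B s) (B (s + 1)))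
    {T : ℤ} (hT : R T = B 0) (hT' : R' T = B 0) : R = R' := by
  have key : ∀ s : ℕ, ∃ T', T + s ≤ T' ∧ R T' = B s ∧ R' T' = B s := by
    intro s
    induction s with
    | zero => exact ⟨T, by simp, hT, hT'⟩
    | succ s ih =>
      obtain ⟨T', h, h1, h2⟩ := ih
      obtain ⟨n, hn⟩ := hB s
      exact ⟨T' + (n + 1 : ℕ), by push_cast; omega, hn.eq_of_chain (fun j => (hR j).2) h1,
        hn.eq_of_chain (fun j => (hR' j).2) h2⟩
  funext j
  obtain ⟨T', h, h1, h2⟩ := key (j - T).toNat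
  exact hR.eq_of_le hM hR' (h1.trans h2.symm) (by omega)

theorem IsRun.visits_of_leads {R : ℤ → ℤ → Symbol (Option κ) W} (hR : M.IsRun R)
    {r r' : ℤ → Symbol (Option κ) W} (h : M.Leads r r') {T : ℤ} (hT : R T = r) :
    ∃ T', R T' = r' := by
  obtain ⟨n, hn⟩ := h
  exact ⟨_, hn.eq_of_chain (fun j => (hR j).2) hT⟩

/-- An infinite sequence of rows, each of which leads to the next one, extends to a one-sided
run. -/
theorem exists_chain {n : ℕ} {r : ℤ → Symbol (Option κ) W} {B : ℕ → ℤ → Symbol (Option κ) W}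
    (hB : ∀ s, M.Leads (B s) (B (s + 1))) (h : M.Steps n r (B 0)) :
    ∃ R : ℕ → ℤ → Symbol (Option κ) W, R 0 = r ∧ R n = B 0 ∧ ∀ j, M.Step (R j) (R (j + 1)) := by
  induction n generalizing r with
  | succ n ih =>
    obtain ⟨q, hq, h⟩ := h
    obtain ⟨R, h0, hn, hR⟩ := ih h
    refine ⟨fun j => Nat.casesOn j r R, rfl, hn, fun j => ?_⟩
    cases j with
    | zero =>
      change M.Step r (R 0)
      rwa [h0]
    | succ j => exact hR j
  | zero =>
    have h' : r = B 0 := h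
    subst h'
    have hgood : ∀ q : {q // ∃ m s, M.Steps m q (B s)}, ∃ q' : {q // ∃ m s, M.Steps m q (B s)},
        M.Step q q' := by
      rintro ⟨q, m, s, hq⟩
      cases m with
      | zero =>
        have h' : q = B s := hq
        obtain ⟨m, hm⟩ := hB s
        obtain ⟨q', h1, h2⟩ := hm.steps
        exact ⟨⟨q', m, s + 1, h2⟩, h' ▸ h1⟩
      | succ m =>
        obtain ⟨q', h1, h2⟩ := hq
        exact ⟨⟨q', m, s, h2⟩, h1⟩
    choose f hf using hgood
    have h0 : ∃ m s, M.Steps m (B 0) (B s) := ⟨0, 0, h⟩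
    refine ⟨fun j => (f^[j] ⟨B 0, h0⟩).1, rfl, rfl, fun j => ?_⟩
    simp only [Function.iterate_succ_apply']
    exact hf _

end PebbleMachine

/-! ### Derivatives of the space-time diagrams of the main program -/

namespace Checker

open PebbleMachine

variable {N : ℕ} {H : Prog (Fin (N + 9))} (hH : Checker H)

theorem validRow_conf (w : (layout N H).main.Edge) (e k d i m t y : ℕ) :
    ValidRow (hH.conf w e k d i m t y) := validRow_headRow.2 (isCut_layers _)

theorem validRow_decision (w : (layout N H).main.Edge) (e k d i m : ℕ) :
    ValidRow (hH.decision w e k d i m) := validRow_headRow.2 (isCut_layers _)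

theorem reversible : hH.machine.Reversible := hH.sound.reversible

variable {A : Type} (φ : A ≃ Symbol (Option (Fin (N + 9))) (layout N H).main.Edge)

/-- One-sided runs from an initial row extend to the past, in which the head comes from the left. -/
theorem exists_diagram {e k d : ℕ}
    {R : ℕ → ℤ → Symbol (Option (Fin (N + 9))) (layout N H).main.Edge}
    (h0 : R 0 = hH.conf (layout N H).main.first e k d 0 0 0 0)
    (hR : ∀ j, hH.machine.Step (R j) (R (j + 1))) :
    ∃ x ∈ hH.machine.diagrams φ, ∀ j : ℕ, decodedRow φ x j = R j := by
  let L : Option (Fin (N + 9)) → ℤ → SignType := layers fun r => cfg e k d 0 0 0 0 r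
  let Z : ℤ → ℤ → Symbol (Option (Fin (N + 9))) (layout N H).main.Edge := fun j =>
    if j < 0 then headRow L j (layout N H).main.first else R j.toNat
  have hZ : ∀ j, decodedRow φ (fun c => φ.symm (Z c.2 c.1)) j = Z j := fun j => by
    funext i
    simp [decodedRow]
  have hRv : ∀ j, ValidRow (R j) := by
    intro j
    induction j with
    | zero => rw [h0]; exact hH.validRow_conf _ _ _ _ _ _ _ _
    | succ j ih => exact (hR j).validRow ih
  refine ⟨fun c => φ.symm (Z c.2 c.1), fun j => ?_, fun j => ?_⟩
  · rw [hZ, hZ]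
    rcases lt_or_ge j 0 with hj | hj
    · refine ⟨?_, ?_⟩
      · simp only [Z, hj, if_true]
        exact validRow_headRow.2 (isCut_layers _)
      · have hstep : hH.machine.Step (headRow L j (layout N H).main.first)
            (headRow L (j + 1) (layout N H).main.first) := by
          have hc : L (some (hH.machine.dst (layout N H).main.first)) j = -1 := cut_of_lt hj
          have := PebbleMachine.Step.walk (M := hH.machine) L j (layout N H).main.first
            (by rw [hc]; decide) (by rw [hc]; exact (by decide : (1 : SignType) ≠ -1))
          rw [hc] at this
          simpa using this
        simp only [Z, hj, if_true]
        split_ifs with h1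
        · exact hstep
        · obtain rfl : j = -1 := by omega
          rw [show (-1 + 1 : ℤ).toNat = 0 by rfl, h0]
          exact hstep
    · simp only [Z, not_lt.2 hj, not_lt.2 (show 0 ≤ j + 1 by omega), if_false]
      refine ⟨hRv _, ?_⟩
      rw [show (j + 1).toNat = j.toNat + 1 by omega]
      exact hR _
  · rw [hZ]
    simp [Z]

theorem not_dom_iff {e d : ℕ} :
    ¬ ((Denumerable.ofNat Nat.Partrec.Code e).eval d).Dom ↔ ∀ t, haltBit e d t = 0 := by
  have key : ∀ t, haltBit e d t = 0 ↔
      ¬ ∃ y, y ∈ Nat.Partrec.Code.evaln t (Denumerable.ofNat Nat.Partrec.Code e) d := by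
    intro t
    unfold haltBit
    cases Nat.Partrec.Code.evaln t (Denumerable.ofNat Nat.Partrec.Code e) d <;> simp
  simp only [key, Part.dom_iff_mem, Nat.Partrec.Code.evaln_complete]
  push Not
  exact forall_comm

/-- A run does not get stuck, so it sees no time at which the function has halted. -/
theorem haltBit_eq_zero_of_run {e k d i : ℕ}
    {R : ℤ → ℤ → Symbol (Option (Fin (N + 9))) (layout N H).main.Edge} (hR : hH.machine.IsRun R)
    {T : ℤ} (hT : R T = hH.conf (layout N H).timeMid e k d i 0 0 0) (t : ℕ) :
    haltBit e d t = 0 := by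
  have key : ∀ t, (∃ T, R T = hH.conf (layout N H).timeMid e k d i 0 t 0) ∧ haltBit e d t = 0 := by
    intro t
    induction t with
    | zero =>
      refine ⟨⟨T, hT⟩, ?_⟩
      by_contra h
      obtain ⟨T', hT'⟩ := hR.visits_of_leads (hH.leads_test e k d i 0) hT
      exact hH.not_step_test h (hT' ▸ (hR T').2)
    | succ t ih =>
      obtain ⟨⟨T, hT⟩, h0⟩ := ih
      obtain ⟨T₁, hT₁⟩ := hR.visits_of_leads (hH.leads_time h0) hT
      refine ⟨⟨T₁, hT₁⟩, ?_⟩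
      by_contra h
      obtain ⟨T', hT'⟩ := hR.visits_of_leads (hH.leads_test e k d i (t + 1)) hT₁
      exact hH.not_step_test h (hT' ▸ (hR T').2)
  exact (key t).2

theorem eq_of_decodedRow_eq {x y : ℤ × ℤ → A} (h : decodedRow φ x = decodedRow φ y) : x = y := by
  funext c
  exact φ.injective (congrFun (congrFun h c.2) c.1)

/-- After the last phase the run is forced, and it exists iff the function with index `e` does not
halt on `d`. -/
theorem through_times {e k d d₀ T : ℕ}
    (hT : hH.machine.Steps T (hH.conf (layout N H).main.first e k d₀ 0 0 0 0)
      (hH.conf (layout N H).phaseMid e k d k 0 0 0)) :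
    (hH.machine.through φ T (hH.conf (layout N H).phaseMid e k d k 0 0 0)).Subsingleton ∧
      ((hH.machine.through φ T (hH.conf (layout N H).phaseMid e k d k 0 0 0)).Nonempty ↔
        ¬ ((Denumerable.ofNat Nat.Partrec.Code e).eval d).Dom) := by
  let B : ℕ → ℤ → Symbol (Option (Fin (N + 9))) (layout N H).main.Edge := fun s =>
    Nat.casesOn s (hH.conf (layout N H).phaseMid e k d k 0 0 0) fun t =>
      hH.conf (layout N H).timeMid e k d k 0 t 0
  have hB : (∀ t, haltBit e d t = 0) → ∀ s, hH.machine.Leads (B s) (B (s + 1)) := by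
    intro h s
    cases s with
    | zero => exact hH.leads_times e k d
    | succ t => exact hH.leads_time (h t)
  have hrun : ∀ x ∈ hH.machine.through φ T (hH.conf (layout N H).phaseMid e k d k 0 0 0),
      ∀ t, haltBit e d t = 0 := by
    rintro x ⟨hx, hxT⟩
    obtain ⟨T', hT'⟩ := IsRun.visits_of_leads hx (hH.leads_times e k d) hxT
    exact hH.haltBit_eq_zero_of_run hx hT'
  rw [not_dom_iff]
  refine ⟨?_, fun ⟨x, hx⟩ => hrun x hx, fun h => ?_⟩
  · intro x hx y hy
    exact eq_of_decodedRow_eq φ (IsRun.eq_of_leads hH.reversible hx.1 hy.1 (hB (hrun x hx))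
      (T := T) hx.2 hy.2)
  · obtain ⟨R, h0, hn, hR⟩ := exists_chain (B := B) (hB h) hT
    obtain ⟨x, hx, hxR⟩ := hH.exists_diagram φ h0 hR
    exact ⟨x, hx, (hxR T).trans hn⟩

variable [TopologicalSpace A] [DiscreteTopology A] [Finite A] [Inhabited A]

theorem iteratedDerivedSet_subset {Y : Type*} [TopologicalSpace Y] (X : Set Y) (a : Ordinal) :
    CantorBendixson.iteratedDerivedSet X a ⊆ X := by
  have h := CantorBendixson.iteratedDerivedSet_antitone X (zero_le : 0 ≤ a)
  rwa [CantorBendixson.iteratedDerivedSet_zero] at h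

/-- With `j` phases left, the diagrams through a row at the head of the loop over the phases have
at most one point in the `j`-th derivative, and they have one iff the number in register `d` is
infinitely extendable. -/
theorem through_phase {e k d₀ : ℕ}
    (hopen : hH.machine.IsOpenAt φ 0 (hH.conf (layout N H).main.first e k d₀ 0 0 0 0)) (j : ℕ) :
    ∀ (i d T : ℕ), i + j = k →
      hH.machine.Steps T (hH.conf (layout N H).main.first e k d₀ 0 0 0 0)
        (hH.conf (layout N H).phaseMid e k d i 0 0 0) →
      (hH.machine.through φ T (hH.conf (layout N H).phaseMid e k d i 0 0 0) ∩
        CantorBendixson.iteratedDerivedSet (hH.machine.diagrams φ)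
          (j : Ordinal.{0})).Subsingleton ∧
      ((hH.machine.through φ T (hH.conf (layout N H).phaseMid e k d i 0 0 0) ∩
        CantorBendixson.iteratedDerivedSet (hH.machine.diagrams φ)
          (j : Ordinal.{0})).Nonempty ↔ InfinitelyExtendable j e d) := by
  have hXc : IsClosed (hH.machine.diagrams φ) := (isSFT_diagrams _ _).isClosed
  induction j with
  | zero =>
    intro i d T hi hT
    obtain rfl : i = k := hi
    rw [Nat.cast_zero, CantorBendixson.iteratedDerivedSet_zero,
      Set.inter_eq_left.2 fun x hx => hx.1]
    exact hH.through_times φ hT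
  | succ j ih =>
    intro i d T hi hT
    have hv := hH.validRow_conf (layout N H).main.first e k d₀ 0 0 0 0
    have hrev := hH.reversible
    -- the times at which the guess `s` is under decision, and at which it has been processed
    obtain ⟨n₀, hn₀⟩ := hH.leads_guess (e := e) (k := k) (d := d) (i := i) (by omega)
    choose b hb using fun s => hH.leads_continue e k d i s
    choose c hc using fun s => hH.leads_stop e k d i s
    obtain ⟨τ, τ0, τS⟩ : ∃ τ : ℕ → ℕ, τ 0 = T + (n₀ + 1) ∧ ∀ s, τ (s + 1) = τ s + (b s + 1) :=
      ⟨fun s => s.rec (T + (n₀ + 1)) fun s t => t + (b s + 1), rfl, fun _ => rfl⟩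
    have reachG : ∀ s, hH.machine.Steps (τ s) (hH.conf (layout N H).main.first e k d₀ 0 0 0 0)
        (hH.conf (layout N H).guessMid e k d i s 0 0) := by
      intro s
      induction s with
      | zero => rw [τ0]; exact hT.trans hn₀.steps
      | succ s ihs =>
        rw [τS]
        exact ihs.trans ⟨_, hH.step_continue e k d i s, (hb s).steps⟩
    have reachP : ∀ s, hH.machine.Steps (τ s + (c s + 1))
        (hH.conf (layout N H).main.first e k d₀ 0 0 0 0)
        (hH.conf (layout N H).phaseMid e k (triPair d s) (i + 1) 0 0 0) := fun s =>
      (reachG s).trans ⟨_, hH.step_stop s (by omega), (hc s).steps⟩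
    have castS : ∀ s, ((τ (s + 1) : ℕ) : ℤ) = (τ s : ℤ) + 1 + b s := fun s => by
      rw [τS]; push_cast; ring
    have hleave : ∀ s, hH.machine.Steps 1 (hH.conf (layout N H).guessMid e k d i s 0 0)
        (hH.decision (layout N H).guessExit e k d i s) := fun s =>
      ⟨_, hH.step_stop s (by omega), rfl⟩
    have hcont : ∀ s, hH.machine.Steps 1 (hH.conf (layout N H).guessMid e k d i s 0 0)
        (hH.decision (layout N H).guessBody e k d i s) := fun s =>
      ⟨_, hH.step_continue e k d i s, rfl⟩
    let F : ℕ → Set (ℤ × ℤ → A) := fun s => hH.machine.through φ ((τ s + (c s + 1) : ℕ) : ℤ)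
      (hH.conf (layout N H).phaseMid e k (triPair d s) (i + 1) 0 0 0)
    -- the diagrams of `F s` stop at the guess `s`, after continuing at all smaller numbers
    have hF1 : ∀ s, ∀ x ∈ F s, decodedRow φ x ((τ s : ℤ) + 1) =
        hH.decision (layout N H).guessExit e k d i s := by
      rintro s x ⟨hx, hxT⟩
      refine IsRun.eq_of_steps hrev hx (hH.validRow_decision _ _ _ _ _ _) (hc s).steps ?_
      rw [← hxT]
      push_cast
      congr 1
      ring
    have hF2 : ∀ s, ∀ x ∈ F s, decodedRow φ x (τ s) =
        hH.conf (layout N H).guessMid e k d i s 0 0 := fun s x hx =>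
      IsRun.eq_of_steps hrev hx.1 (hH.validRow_conf _ _ _ _ _ _ _ _) (hleave s) (by
          push_cast
          exact hF1 s x hx)
    have hback : ∀ s, ∀ x ∈ hH.machine.diagrams φ, decodedRow φ x (τ (s + 1)) =
        hH.conf (layout N H).guessMid e k d i (s + 1) 0 0 →
        decodedRow φ x ((τ s : ℤ) + 1) = hH.decision (layout N H).guessBody e k d i s ∧
        decodedRow φ x (τ s) = hH.conf (layout N H).guessMid e k d i s 0 0 := by
      intro s x hx hs
      have h1 : decodedRow φ x ((τ s : ℤ) + 1) = hH.decision (layout N H).guessBody e k d i s :=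
        IsRun.eq_of_steps hrev hx (hH.validRow_decision _ _ _ _ _ _) (hb s).steps
          (by rw [← castS]; exact hs)
      exact ⟨h1, IsRun.eq_of_steps hrev hx (hH.validRow_conf _ _ _ _ _ _ _ _)
        (hcont s) (by
          push_cast
          exact h1)⟩
    have hF3 : ∀ s n, ∀ x ∈ F (s + n), decodedRow φ x (τ s) =
        hH.conf (layout N H).guessMid e k d i s 0 0 := by
      intro s n x hx
      induction n generalizing s with
      | zero => exact hF2 s x hx
      | succ n ihn =>
        refine (hback s x hx.1 (ihn (s + 1) ?_)).2
        rwa [show s + 1 + n = s + (n + 1) by ring]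
    have hdisj : ∀ s n, Disjoint (F s) (F (s + (n + 1))) := by
      intro s n
      refine Set.disjoint_left.2 fun x hx hx' => ?_
      have h1 := (hback s x hx.1 (hF3 (s + 1) n x (by
        rwa [show s + 1 + n = s + (n + 1) by ring]))).1
      have h2 := (hF1 s x hx).symm.trans h1
      cases (headRow_inj.1 h2).2.2
    choose O' hO' hFO hFO' using fun s => hopen.of_steps hrev hv (reachP s)
    obtain ⟨O, hO, hSO, hSO'⟩ := hopen.of_steps hrev hv hT
    simp only [zero_add] at hFO hFO' hSO hSO'
    have hsub := iteratedDerivedSet_subset (hH.machine.diagrams φ) (j : Ordinal.{0})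
    have hfan := relDerivedSet_fan
      (D := CantorBendixson.iteratedDerivedSet (hH.machine.diagrams φ) (j : Ordinal.{0}))
      (S := hH.machine.through φ T (hH.conf (layout N H).phaseMid e k d i 0 0 0))
      (N := {x | x ∈ hH.machine.diagrams φ ∧ ∀ s, decodedRow φ x (τ s) =
        hH.conf (layout N H).guessMid e k d i s 0 0}) (O := O) (F := F) (O' := O')
      (CantorBendixson.isClosed_iteratedDerivedSet hXc _)
      (hXc.inter (isClosed_decodedRow_eq φ _ _)) hO
      (fun x hx => hSO ⟨hsub hx.1, hx.2⟩) hSO' hO' (fun s x hx => hFO s ⟨hsub hx.1, hx.2⟩) hFO'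
      (fun s => (ih _ _ _ (by omega) (reachP s)).1) ?_ ?_ ?_ ?_
    · rw [Nat.cast_succ, CantorBendixson.iteratedDerivedSet_succ]
      refine ⟨hfan.1, hfan.2.trans ?_⟩
      have : {s | (F s ∩ CantorBendixson.iteratedDerivedSet (hH.machine.diagrams φ)
          (j : Ordinal.{0})).Nonempty} = {s | InfinitelyExtendable j e (triPair d s)} :=
        Set.ext fun s => (ih _ _ _ (by omega) (reachP s)).2
      rw [this]
      rfl
    · intro s x hx
      refine ⟨hx.1, ?_⟩
      have h0 := hF3 0 s x (by rwa [zero_add])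
      refine IsRun.eq_of_steps hrev hx.1 (hH.validRow_conf _ _ _ _ _ _ _ _) hn₀.steps ?_
      rw [← h0, τ0]
      push_cast
      rfl
    · intro s s' hne
      rcases lt_or_gt_of_ne hne with h | h
      · obtain ⟨n, rfl⟩ := Nat.exists_eq_add_of_lt h
        exact hdisj s n
      · obtain ⟨n, rfl⟩ := Nat.exists_eq_add_of_lt h
        exact (hdisj s' n).symm
    · rintro x ⟨hx, hxs⟩ y ⟨hy, hys⟩
      refine eq_of_decodedRow_eq φ (funext fun l => ?_)
      have hτ : ∀ s, s ≤ τ s := by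
        intro s
        induction s with
        | zero => exact Nat.zero_le _
        | succ s ihs => rw [τS]; omega
      refine IsRun.eq_of_le hrev hx hy (T := τ l.toNat) ((hxs _).trans (hys _).symm) ?_
      have := hτ l.toNat
      omega
    · rintro x ⟨hx, hxT⟩
      by_contra hcon
      rw [Set.mem_union, not_or] at hcon
      refine hcon.1 ⟨hx, fun s => ?_⟩
      induction s with
      | zero =>
        rw [τ0]
        push_cast
        have := hn₀.eq_of_chain (fun j => (hx j).2) hxT
        exact_mod_cast this
      | succ s ihs =>
        have hst := (hx (τ s)).2
        rw [ihs] at hst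
        rcases hH.step_guess hst with h | h
        · rw [castS]
          exact (hb s).eq_of_chain (fun j => (hx j).2) h
        · refine absurd (Set.mem_iUnion.2 ⟨s, (⟨hx, ?_⟩ : x ∈ F s)⟩) hcon.2
          have := (hc s).eq_of_chain (fun j => (hx j).2) h
          rw [← this]
          push_cast
          congr 1
          ring

end Checker

/-! ### Finite patterns that determine the initial row -/

theorem lookup_map_self {G A : Type*} [BEq G] [LawfulBEq G] (f : G → A) {cs : List G} {c : G}
    (hc : c ∈ cs) : (cs.map fun c => (c, f c)).lookup c = some (f c) := by
  induction cs with
  | nil => cases hc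
  | cons a cs ih =>
    by_cases h : c = a
    · subst h
      simp
    · have hb : (c == a) = false := beq_eq_false_iff_ne.2 h
      simpa [List.lookup_cons, hb] using ih ((List.mem_cons.1 hc).resolve_left h)

theorem matches_map_iff {A : Type} {f : ℤ × ℤ → A} {cs : List (ℤ × ℤ)} {x : ℤ × ℤ → A} :
    Matches (cs.map fun c => (c, f c)) x ↔ ∀ c ∈ cs, x c = f c := by
  refine ⟨fun h c hc => h c _ (@lookup_map_self _ _ cellBEq
    (by unfold cellBEq; infer_instance) f _ _ hc), fun h => matches_of_forall_mem fun p hp => ?_⟩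
  obtain ⟨c, hc, rfl⟩ := List.mem_map.1 hp
  exact h c hc

/-- A function on `ℕ` that is eventually constant is primitive recursive. -/
theorem primrec_of_eventually_const {α : Type*} [Primcodable α] (m : ℕ) :
    ∀ f : ℕ → α, (∀ n, m ≤ n → f n = f m) → Primrec f := by
  induction m with
  | zero => exact fun f hf => (Primrec.const (f 0)).of_eq fun n => (hf n (Nat.zero_le n)).symm
  | succ m ih =>
    intro f hf
    have h := ih (fun n => f (n + 1)) fun n hn => hf (n + 1) (by omega)
    refine (Primrec.nat_casesOn₁ (f 0) h).of_eq fun n => ?_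
    cases n <;> rfl

instance {W : Type} [Finite W] : Finite (HeadMark W) :=
  Finite.of_injective (β := Option (Option W))
    (fun | .left => none | .right => some none | .here w => some (some w)) (by
      rintro (_ | _ | w) (_ | _ | w') h <;> simp_all)

namespace Checker

open PebbleMachine

variable {N : ℕ} {H : Prog (Fin (N + 9))} (hH : Checker H)

/-- The cells at which the pebbles of the initial row are located. -/
def marks (e k n : ℕ) : List (ℤ × ℤ) := [(0, 0), (n, 0), (e, 0), (k, 0)]

/-- A run whose initial row agrees with the intended one at the locations of the pebbles has the
intended initial row. That the remaining pebble `none` is at `-∞` follows from the past: otherwise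
the head would have started its first walk at this pebble, but no rule leads to the first
state. -/
theorem eq_initial {e k n : ℕ}
    {R : ℤ → ℤ → Symbol (Option (Fin (N + 9))) (layout N H).main.Edge} (hR : hH.machine.IsRun R)
    (h : ∀ c ∈ marks e k n, R c.2 c.1 = hH.conf (layout N H).main.first e k n 0 0 0 0 c.1) :
    R 0 = hH.conf (layout N H).main.first e k n 0 0 0 0 := by
  have h0 : R 0 0 = _ := h (0, 0) (by simp [marks])
  have hhead : (R 0 0).2 = .here (layout N H).main.first := by
    rw [h0]
    exact headRow_snd_eq_here.2 ⟨rfl, rfl⟩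
  have hv := (hR 0).1
  have hrow := hv.eq_headRow hhead
  rw [hrow]
  refine headRow_inj.2 ⟨?_, rfl, rfl⟩
  funext l
  cases l with
  | some r =>
    have hmem : ((cfg e k n 0 0 0 0 r, 0) : ℤ × ℤ) ∈ marks e k n := by
      simp only [cfg, marks]
      split_ifs <;> simp
    have hc : (R 0 (cfg e k n 0 0 0 0 r)).1 (some r) = 0 := by
      rw [h _ hmem]
      exact cut_self _
    exact (hv.1 (some r)).eq_cut hc
  | none =>
    have h1 : (R 0 0).1 none = 1 := by rw [h0]; rfl
    rcases (hv.1 none).trichotomy with ⟨p, hp⟩ | hp | hp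
    · exfalso
      have hp0 : p < 0 := by
        by_contra hcon
        have h2 := congrFun hp 0
        rw [h1] at h2
        rcases (not_lt.1 hcon).eq_or_lt with rfl | hlt
        · rw [cut_self] at h2; cases h2
        · rw [cut_of_lt hlt] at h2; cases h2
      have hsrc : hH.machine.src (layout N H).main.first = none := Prog.src_first _ _
      have key : ∀ m : ℕ, p ≤ -m → R (-m) =
          headRow (fun l i => (R 0 i).1 l) (-m) (layout N H).main.first := by
        intro m
        induction m with
        | zero => exact fun _ => by simpa using hrow
        | succ m ih =>
          intro hm
          have hst := (hR (-((m + 1 : ℕ) : ℤ))).2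
          have hval := (hR (-((m + 1 : ℕ) : ℤ))).1
          rw [show (-((m + 1 : ℕ) : ℤ)) + 1 = -m by push_cast; ring, ih (by omega)] at hst
          obtain ⟨s₁, p₁, w₁, e₁⟩ := hst.eq_headRow
          rw [e₁] at hst hval ⊢
          have hone : (R 0 (-m)).1 none = 1 := by
            rw [show (R 0 (-m)).1 none = cut p (-m) from congrFun hp _, cut_of_gt (by omega)]
          rcases hst.walk_iff hv.1 (validRow_headRow.1 hval) with ⟨-, rfl, rfl, hp₁, -⟩ | ⟨hz, -⟩
          · rw [hsrc, hone] at hp₁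
            rw [hp₁]
            congr 1
            push_cast
            simp
            ring
          · rw [hsrc, hone] at hz
            cases hz
      have hst := (hR (p - 1)).2
      have hval := (hR (p - 1)).1
      have hlast := key (-p).toNat (by omega)
      rw [show (-((-p).toNat : ℤ)) = p by omega] at hlast
      rw [sub_add_cancel, hlast] at hst
      obtain ⟨s₁, p₁, w₁, e₁⟩ := hst.eq_headRow
      rw [e₁] at hst hval
      have hzero : (R 0 p).1 none = 0 := by
        rw [show (R 0 p).1 none = cut p p from congrFun hp _, cut_self]
      rcases hst.walk_iff hv.1 (validRow_headRow.1 hval) with ⟨hz, -⟩ |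
        ⟨-, -, ⟨a, S, hr, -⟩ | ⟨b, hr, -⟩⟩
      · rw [hsrc] at hz
        exact hz hzero
      · exact Prog.not_rule_first _ _ _ hr
      · exact Prog.not_rule_first _ _ _ hr
    · exact hp
    · have h2 := congrFun hp 0
      rw [h1] at h2
      cases h2

variable {A : Type} (φ : A ≃ Symbol (Option (Fin (N + 9))) (layout N H).main.Edge)

/-- The pattern by which the initial row for the argument `n` is recognized. -/
noncomputable def pattern (e k n : ℕ) : List ((ℤ × ℤ) × A) :=
  (marks e k n).map fun c => (c, φ.symm (hH.conf (layout N H).main.first e k n 0 0 0 0 c.1))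

theorem matches_pattern_iff {e k n : ℕ} {x : ℤ × ℤ → A} (hx : x ∈ hH.machine.diagrams φ) :
    Matches (hH.pattern φ e k n) x ↔
      decodedRow φ x 0 = hH.conf (layout N H).main.first e k n 0 0 0 0 := by
  rw [pattern, matches_map_iff (f := fun c : ℤ × ℤ =>
    φ.symm (hH.conf (layout N H).main.first e k n 0 0 0 0 c.1))]
  constructor
  · intro h
    refine hH.eq_initial hx fun c hc => ?_
    simp [decodedRow, h c hc]
  · intro h c hc
    rw [← h]
    have hc2 : c.2 = 0 := by
      simp only [marks, List.mem_cons, List.not_mem_nil, or_false] at hc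
      rcases hc with rfl | rfl | rfl | rfl <;> rfl
    simp only [decodedRow, Equiv.symm_apply_apply, ← hc2]

theorem isOpenAt_initial [TopologicalSpace A] [DiscreteTopology A] (e k n : ℕ) :
    hH.machine.IsOpenAt φ 0 (hH.conf (layout N H).main.first e k n 0 0 0 0) := by
  refine ⟨{x | Matches (hH.pattern φ e k n) x}, ?_, ?_, ?_⟩
  · have : {x : ℤ × ℤ → A | Matches (hH.pattern φ e k n) x} = ⋂ c ∈ (marks e k n).toFinset,
        {x | decodedRow φ x c.2 c.1 = hH.conf (layout N H).main.first e k n 0 0 0 0 c.1} := by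
      ext x
      rw [Set.mem_ofPred_eq, pattern, matches_map_iff (f := fun c : ℤ × ℤ =>
        φ.symm (hH.conf (layout N H).main.first e k n 0 0 0 0 c.1))]
      simp only [Set.mem_iInter, List.mem_toFinset, Set.mem_ofPred_eq, decodedRow,
        Equiv.eq_symm_apply]
    rw [this]
    exact isOpen_biInter_finset fun c _ => isOpen_decodedRow_eq φ _ _ _
  · exact fun x hx => ⟨hx.1, (hH.matches_pattern_iff φ hx.1).1 hx.2⟩
  · exact fun x hx => (hH.matches_pattern_iff φ hx.1).2 hx.2

/-- In an initial row, each register holds the argument `n` or a constant. -/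
theorem cfg_initial (e k r : ℕ) : (∀ n : ℕ, cfg e k n 0 0 0 0 r = n) ∨
    ∃ v : ℤ, v ≤ e + k ∧ ∀ n : ℕ, cfg e k n 0 0 0 0 r = v := by
  by_cases h : r = 6
  · exact Or.inl fun n => by simp [cfg, h]
  · refine Or.inr ⟨cfg e k 0 0 0 0 0 r, ?_, fun n => ?_⟩ <;> simp only [cfg] <;> split_ifs <;> omega

theorem primrec_pattern [Primcodable A] (e k : ℕ) : Primrec (hH.pattern φ e k) := by
  -- the symbols depend only on comparisons of `n` with constants
  have hconst : ∀ c : ℕ, c ≤ e + k → Primrec fun n : ℕ =>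
      φ.symm (hH.conf (layout N H).main.first e k n 0 0 0 0 (c : ℤ)) := by
    intro c hc
    refine primrec_of_eventually_const (e + k + 1) _ fun n hn => congrArg φ.symm ?_
    refine headRow_congr (fun l => ?_) rfl
    cases l with
    | none => rfl
    | some r =>
      simp only [layers]
      rcases cfg_initial e k r with h | ⟨v, -, h⟩
      · rw [h, h, cut_of_lt (by omega), cut_of_lt (by omega)]
      · rw [h, h]
  have hvar : Primrec fun n : ℕ =>
      φ.symm (hH.conf (layout N H).main.first e k n 0 0 0 0 (n : ℤ)) := by
    refine primrec_of_eventually_const (e + k + 1) _ fun n hn => congrArg φ.symm ?_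
    have hright : ∀ m : ℕ, 0 < m →
        (hH.conf (layout N H).main.first e k m 0 0 0 0 (m : ℤ)).2 = .right := by
      intro m hm
      change (if (m : ℤ) < 0 then HeadMark.left else if (m : ℤ) = 0 then
        HeadMark.here (layout N H).main.first else HeadMark.right) = _
      rw [if_neg (by omega), if_neg (by omega)]
    refine Prod.ext (funext fun l => ?_) ((hright n (by omega)).trans (hright _ (by omega)).symm)
    cases l with
    | none => rfl
    | some r =>
      change cut (cfg e k n 0 0 0 0 r) n = cut (cfg e k (e + k + 1) 0 0 0 0 r) (e + k + 1 : ℕ)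
      rcases cfg_initial e k r with h | ⟨v, hv, h⟩
      · rw [h, h, cut_self, cut_self]
      · rw [h, h, cut_of_gt (by omega), cut_of_gt (by omega)]
  have hcons {f : ℕ → (ℤ × ℤ) × A} {g : ℕ → List ((ℤ × ℤ) × A)} (hf : Primrec f) (hg : Primrec g) :
      Primrec fun n => f n :: g n := Primrec.list_cons.comp hf hg
  exact hcons ((Primrec.const (0, 0)).pair (hconst 0 (by omega)))
    (hcons (((primrec_int_natCast.comp .id).pair (.const 0)).pair hvar)
    (hcons ((Primrec.const ((e : ℤ), 0)).pair (hconst e (by omega)))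
    (hcons ((Primrec.const ((k : ℤ), 0)).pair (hconst k (by omega))) (Primrec.const []))))

variable [TopologicalSpace A] [DiscreteTopology A] [Finite A] [Inhabited A]

/-- The reduction: the pattern of the initial row occurs in the `k`-th derivative iff its argument is
infinitely extendable. -/
theorem exists_matches_pattern_iff (e k n : ℕ) :
    (∃ x ∈ CantorBendixson.iteratedDerivedSet (hH.machine.diagrams φ) (k : Ordinal.{0}),
      Matches (hH.pattern φ e k n) x) ↔ InfinitelyExtendable k e n := by
  obtain ⟨T, hT⟩ := hH.leads_start e k n
  have h := (hH.through_phase φ (hH.isOpenAt_initial φ e k n) k 0 n (T + 1) (zero_add k) hT.steps).2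
  rw [← h]
  refine exists_congr fun x => ?_
  rw [and_comm]
  refine and_congr_left fun hx => ?_
  have hx' := iteratedDerivedSet_subset _ _ hx
  rw [hH.matches_pattern_iff φ hx']
  constructor
  · intro h0
    refine ⟨hx', ?_⟩
    have := hT.eq_of_chain (fun j => (hx' j).2) h0
    rwa [zero_add] at this
  · rintro ⟨-, h1⟩
    exact IsRun.eq_of_steps hH.reversible hx' (hH.validRow_conf _ _ _ _ _ _ _ _) hT.steps
      (by rwa [zero_add])

end Checker

end CountableSFT

theorem mainTheorem2 :
    ∃ (n : ℕ) (X : Set (ℤ × ℤ → Fin (n + 1))),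
      CountableSFT.IsSFT X ∧
      X.Countable ∧
      CountableSFT.IsSouthwardDeterministic X ∧
      CountableSFT.HasPProperty X ∧
      ∀ k : ℕ,
        CountableSFT.IsPiComplete (2 * k + 1)
          (fun L : List ((ℤ × ℤ) × Fin (n + 1)) =>
            CountableSFT.OccursInSet (CountableSFT.patternOfList L)
              (CantorBendixson.iteratedDerivedSet X (k : Ordinal.{0}))) := by
  obtain ⟨N, H, hH⟩ := CountableSFT.exists_checker
  obtain ⟨n, ⟨ψ⟩⟩ := Finite.exists_equiv_fin
    (CountableSFT.Symbol (Option (Fin (N + 9))) (CountableSFT.layout N H).main.Edge)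
  obtain ⟨n, rfl⟩ : ∃ n', n = n' + 1 :=
    Nat.exists_eq_succ_of_ne_zero fun h => (h ▸ ψ (fun _ => 1, .left)).elim0
  let X := hH.machine.diagrams ψ.symm
  have hX : CountableSFT.IsSFT X := CountableSFT.PebbleMachine.isSFT_diagrams _ _
  refine ⟨n, X, hX, ?_, ?_, ?_, fun k => ?_⟩
  · exact CountableSFT.PebbleMachine.countable_diagrams hH.reversible CountableSFT.Layout.resolves
      (fun R hR => hH.sound.finite_choices hR) ψ.symm.injective
  · exact CountableSFT.PebbleMachine.isSouthwardDeterministic_diagrams hH.reversible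
      ψ.symm.injective
  · exact CountableSFT.PebbleMachine.hasPProperty_diagrams _ ψ.symm.injective
  · have hocc (L : List ((ℤ × ℤ) × Fin (n + 1))) :
        CountableSFT.OccursInSet (CountableSFT.patternOfList L)
          (CantorBendixson.iteratedDerivedSet X (k : Ordinal.{0})) ↔
        ∃ x ∈ CantorBendixson.iteratedDerivedSet X (k : Ordinal.{0}), CountableSFT.Matches L x :=
      (hX.shiftInvariant.iteratedDerivedSet k).occursInSet_iff
    refine ⟨(CountableSFT.isPi_exists_matches_derivative hX k).of_eq fun L => (hocc L).symm,
      fun q hq => ?_⟩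
    obtain ⟨e, he⟩ := hq.exists_infinitelyExtendable
    refine ⟨hH.pattern ψ.symm e k, (hH.primrec_pattern ψ.symm e k).to_comp, fun m => ?_⟩
    exact (he m).trans ((hH.exists_matches_pattern_iff ψ.symm e k m).symm.trans (hocc _).symm)
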